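/- Let $\mathbf k$ be an algebraically closed field, $(V,\omega)$ a finite-dimensional symplectic vector space over $\mathbf k$, and $G$ a finite group acting linearly on $V$ and preserving $\omega$; assume that $\operatorname{char}\mathbf k$ is zero or greater than both $\dim V$ and $|G|$. Let $\mathbf k[V]$ be the algebra of polynomial functions on $V$, with $a^g=a\circ g^{-1}$, and let $\mathbf k[V]g=\{ag\}$ be the $\mathbf k[V]$-bimodule with $a\cdot(bg)=(ab)g$ and $(bg)\cdot a=(b\,a^g)g$ (a sub-bimodule of the crossed product $\mathbf k[G]\ltimes\mathbf k[V]$). Let $H^i(\mathbf k[V],\mathbf k[V]g)$ be its Hochschild cohomology. The multiplication $$H^i(\mathbf k[V],\mathbf k[V]g)\otimes H^j(\mathbf k[V],\mathbf k[V]h)\to H^{i+j}(\mathbf k[V],\mathbf k[V]gh)$$ is the cup product $(\varphi\cdot\psi)(a_1,\dots,a_{i+j})=\varphi(a_1,\dots,a_i)\,\psi(a_{i+1},\dots,a_{i+j})$ induced by the product $(ag)(bh)=(a\,b^g)gh$ of the crossed product. For $g\in G$ let $V^g$ be the space of $g$-invariant vectors, $(V^g)^\vee$ the span of the eigenvectors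 of $g$ with eigenvalue $\neq1$, $d_g=\operatorname{codim}V^g$, and $\pi^g=\frac1m\sum_{l=1}^m g^l:V\to V^g$, where $m$ is the order of $g$. Put $\Lambda^n=0$ for $n<0$. Then there are nonzero elements $s_g\in\Lambda^{d_g}(V^g)^\vee$ $(g\in G)$, with $s_{gh}=s_g\wedge s_h$ whenever $V^{gh}=V^g\cap V^h$ and $d_{gh}=d_g+d_h$, and $\mathbf k$-linear isomorphisms $$\Phi_g^i: H^i(\mathbf k[V],\mathbf k[V]g)\;\xrightarrow{\ \sim\ }\;\Lambda^{i-d_g}V^g\otimes\mathbf k[V^g]\qquad(g\in G,\ i\ge0)$$ such that the following hold. 1. $\Phi_g^i$ is the natural isomorphism determined by $s_g$: for every $i$-cocycle $\varphi$ with values in $\mathbf k[V]g$ and all linear forms $y_1,\dots,y_i\in V^*$, $$\sum_{\sigma\in S_i}\operatorname{sgn}(\sigma)\,\varphi(y_{\sigma(1)},\dots,y_{\sigma(i)})\big|_{V^g}=\big\langle \Phi_g^i([\varphi])\wedge s_g,\;y_1\wedge\dots\wedge y_i\big\rangle\in\mathbf k[V^g],$$ where on the left the coefficient of $g$ is restricted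 to $V^g$, and $\langle v_1\wedge\dots\wedge v_i,y_1\wedge\dots\wedge y_i\rangle=\det(\langle v_p,y_q\rangle)$. 2. Let $x\in H^i(\mathbf k[V],\mathbf k[V]g)$ and $y\in H^j(\mathbf k[V],\mathbf k[V]h)$, and let $\xi_g=\Phi_g^i(x)$ and $\xi_h=\Phi_h^j(y)$ be the corresponding multivector fields. If $V^{gh}\ne V^g\cap V^h$, or if $d_{gh}\neq d_g+d_h$, then $x\cdot y=0$. If $V^{gh}=V^g\cap V^h$ and $d_{gh}=d_g+d_h$, then $$\Phi_{gh}^{i+j}(x\cdot y)=(-1)^{d_g(j-d_h)}\,\xi_g\wedge\xi_h,$$ where $\xi_g$ and $\xi_h$ are first mapped to multivector fields on $V^{gh}$ by $\xi\otimes f\mapsto\pi^{gh}\xi\otimes f|_{V^{gh}}$. -/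

import Mathlib

open scoped TensorProduct

noncomputable section

namespace Hochschild

open MulOpposite

section Complex

variable (k A M : Type*) [Field k] [CommRing A] [Algebra k A] [AddCommGroup M] [Module k M]
  [Module A M] [Module Aᵐᵒᵖ M] [IsScalarTower k A M] [IsScalarTower k Aᵐᵒᵖ M]

/-- Hochschild `n`-cochains of the `k`-algebra `A` with values in an `A`-bimodule `M`:
`k`-linear maps from the `n`-fold tensor power of `A` to `M`, i.e. `k`-multilinear maps. -/
abbrev Cochain (n : ℕ) : Type _ := MultilinearMap k (fun _ : Fin n => A) M

variable {A} in
/-- Merging two neighbouring entries commutes with changing one entry. -/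
theorem exists_contractNth_update {n : ℕ} (j : Fin n) (p : Fin (n + 1)) (a : Fin (n + 1) → A) :
    ∃ (q : Fin n) (L : A →ₗ[k] A), ∀ x : A,
      Fin.contractNth j.castSucc (· * ·) (Function.update a p x) =
        Function.update (Fin.contractNth j.castSucc (· * ·) a) q (L x) := by
  rcases lt_trichotomy (p : ℕ) j with h | h | h
  · refine ⟨⟨p, by omega⟩, LinearMap.id, fun x => ?_⟩
    funext r
    simp only [Fin.contractNth, Function.update_apply, Fin.ext_iff, Fin.val_castSucc, Fin.val_succ,
      LinearMap.id_apply]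
    split_ifs <;> first | rfl | omega
  · refine ⟨j, (LinearMap.mulRight k (a j.succ)), fun x => ?_⟩
    funext r
    simp only [Fin.contractNth, Function.update_apply, Fin.ext_iff, Fin.val_castSucc, Fin.val_succ,
      LinearMap.mulRight_apply]
    split_ifs <;> first | rfl | omega | (congr 2; ext; simp; omega)
  · by_cases h' : (p : ℕ) = j + 1
    · refine ⟨j, (LinearMap.mulLeft k (a j.castSucc)), fun x => ?_⟩
      funext r
      simp only [Fin.contractNth, Function.update_apply, Fin.ext_iff, Fin.val_castSucc,
        Fin.val_succ, LinearMap.mulLeft_apply]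
      split_ifs <;> first | rfl | omega | (congr 2; ext; simp; omega)
    · refine ⟨⟨p - 1, by omega⟩, LinearMap.id, fun x => ?_⟩
      funext r
      simp only [Fin.contractNth, Function.update_apply, Fin.ext_iff, Fin.val_castSucc,
        Fin.val_succ, LinearMap.id_apply]
      split_ifs <;> first | rfl | omega

variable {k A M}

/-- The cochain `(a₀, …, aₙ) ↦ φ (a₀, …, aⱼ aⱼ₊₁, …, aₙ)`. -/
def innerFace {n : ℕ} (j : Fin n) (φ : Cochain k A M n) : Cochain k A M (n + 1) where
  toFun a := φ (Fin.contractNth j.castSucc (· * ·) a)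
  map_update_add' {inst} a p x y := by
    have e : inst = instDecidableEqFin (n + 1) := Subsingleton.elim _ _
    subst e
    obtain ⟨q, L, h⟩ := exists_contractNth_update k j p a
    simp only [h, map_add, MultilinearMap.map_update_add]
  map_update_smul' {inst} a p c x := by
    have e : inst = instDecidableEqFin (n + 1) := Subsingleton.elim _ _
    subst e
    obtain ⟨q, L, h⟩ := exists_contractNth_update k j p a
    simp only [h, map_smul, MultilinearMap.map_update_smul]

/-- The cochain `(a₀, …, aₙ) ↦ a₀ φ (a₁, …, aₙ)`. -/
def firstFace {n : ℕ} (φ : Cochain k A M n) : Cochain k A M (n + 1) where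
  toFun a := a 0 • φ (Fin.tail a)
  map_update_add' {inst} a p x y := by
    have e : inst = instDecidableEqFin (n + 1) := Subsingleton.elim _ _
    subst e
    refine Fin.cases ?_ (fun p => ?_) p
    · simp [add_smul]
    · simp [Fin.tail_update_succ, Function.update_of_ne (Fin.succ_ne_zero p).symm]
  map_update_smul' {inst} a p c x := by
    have e : inst = instDecidableEqFin (n + 1) := Subsingleton.elim _ _
    subst e
    refine Fin.cases ?_ (fun p => ?_) p
    · simp [smul_assoc]
    · simp [Fin.tail_update_succ, Function.update_of_ne (Fin.succ_ne_zero p).symm,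
        smul_algebra_smul_comm]

/-- The cochain `(a₀, …, aₙ) ↦ φ (a₀, …, aₙ₋₁) aₙ`. -/
def lastFace {n : ℕ} (φ : Cochain k A M n) : Cochain k A M (n + 1) where
  toFun a := op (a (Fin.last n)) • φ (Fin.init a)
  map_update_add' {inst} a p x y := by
    have e : inst = instDecidableEqFin (n + 1) := Subsingleton.elim _ _
    subst e
    refine Fin.lastCases ?_ (fun p => ?_) p
    · simp [add_smul]
    · simp [Fin.init_update_castSucc, Function.update_of_ne (Fin.castSucc_lt_last p).ne']
  map_update_smul' {inst} a p c x := by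
    have e : inst = instDecidableEqFin (n + 1) := Subsingleton.elim _ _
    subst e
    refine Fin.lastCases ?_ (fun p => ?_) p
    · simp [smul_assoc]
    · simp [Fin.init_update_castSucc, Function.update_of_ne (Fin.castSucc_lt_last p).ne',
        smul_algebra_smul_comm]

variable (k A M) in
/-- The Hochschild differential. -/
def d (n : ℕ) : Cochain k A M n →ₗ[k] Cochain k A M (n + 1) where
  toFun φ := firstFace φ + ∑ j : Fin n, (-1 : k) ^ ((j : ℕ) + 1) • innerFace j φ
    + (-1 : k) ^ (n + 1) • lastFace φ
  map_add' φ ψ := by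
    ext a
    simp [firstFace, innerFace, lastFace, Finset.sum_add_distrib]
    abel
  map_smul' c φ := by
    ext a
    simp only [firstFace, innerFace, lastFace, add_apply, sum_apply, smul_apply,
      MultilinearMap.coe_mk, RingHom.id_apply, smul_add, Finset.smul_sum]
    refine congrArg₂ _ (congrArg₂ _ (smul_algebra_smul_comm c (a 0) _)
      (Finset.sum_congr rfl fun j _ => smul_comm _ _ _)) ?_
    rw [smul_comm c, smul_algebra_smul_comm c (op (a (Fin.last n)))]

variable (k A M) in
/-- Hochschild `n`-cocycles. -/
def cocycles (n : ℕ) : Submodule k (Cochain k A M n) := LinearMap.ker (d k A M n)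

variable (k A M) in
/-- Hochschild `n`-coboundaries. -/
def coboundaries : (n : ℕ) → Submodule k (Cochain k A M n)
  | 0 => ⊥
  | n + 1 => LinearMap.range (d k A M n)

variable (k A M) in
/-- Hochschild cohomology `Hⁿ(A, M)`: cocycles modulo those cocycles that are coboundaries. -/
abbrev Cohomology (n : ℕ) : Type _ :=
  cocycles k A M n ⧸ (coboundaries k A M n).submoduleOf (cocycles k A M n)

/-- The class of a cocycle. -/
abbrev cls {n : ℕ} (φ : cocycles k A M n) : Cohomology k A M n := Submodule.Quotient.mk φ

end Complex

section Cup

variable {k A L M N : Type*} [Field k] [CommRing A] [Algebra k A]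
  [AddCommGroup L] [Module k L] [Module A L] [Module Aᵐᵒᵖ L] [IsScalarTower k A L]
  [IsScalarTower k Aᵐᵒᵖ L]
  [AddCommGroup M] [Module k M] [Module A M] [Module Aᵐᵒᵖ M] [IsScalarTower k A M]
  [IsScalarTower k Aᵐᵒᵖ M]
  [AddCommGroup N] [Module k N] [Module A N] [Module Aᵐᵒᵖ N] [IsScalarTower k A N]
  [IsScalarTower k Aᵐᵒᵖ N]

variable (k A L M N) in
/-- A pairing `L ⊗_A M → N` of `A`-bimodules. -/
structure Pairing where
  /-- the underlying `k`-bilinear map -/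
  toBilin : L →ₗ[k] M →ₗ[k] N
  smul_left : ∀ (a : A) (x : L) (y : M), toBilin (a • x) y = a • toBilin x y
  smul_middle : ∀ (a : A) (x : L) (y : M), toBilin (op a • x) y = toBilin x (a • y)
  smul_right : ∀ (a : A) (x : L) (y : M), toBilin x (op a • y) = op a • toBilin x y

/-- The cup product of cochains,
`(φ ∪ ψ) (a₁, …, a_{i+j}) = φ (a₁, …, a_i) · ψ (a_{i+1}, …, a_{i+j})`. -/
def cupCochain (μ : Pairing k A L M N) (i j : ℕ) :
    Cochain k A L i →ₗ[k] Cochain k A M j →ₗ[k] Cochain k A N (i + j) :=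
  LinearMap.mk₂ k
    (fun φ ψ => (((TensorProduct.lift μ.toBilin).compMultilinearMap
      (φ.domCoprod ψ)).domDomCongr finSumFinEquiv))
    (by intro φ φ' ψ; ext a; simp [MultilinearMap.domCoprod])
    (by intro c φ ψ; ext a; simp [MultilinearMap.domCoprod])
    (by intro φ ψ ψ'; ext a; simp [MultilinearMap.domCoprod])
    (by intro c φ ψ; ext a; simp [MultilinearMap.domCoprod])

set_option linter.unusedSectionVars false in
theorem cupCochain_apply (μ : Pairing k A L M N) {i j : ℕ} (φ : Cochain k A L i)
    (ψ : Cochain k A M j) (a : Fin (i + j) → A) :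
    cupCochain μ i j φ ψ a =
      μ.toBilin (φ fun p => a (Fin.castAdd j p)) (ψ fun q => a (Fin.natAdd i q)) := by
  simp [cupCochain, MultilinearMap.domCoprod]

/-- The differential is a graded derivation for the cup product. -/
theorem d_cupCochain (μ : Pairing k A L M N) {i j : ℕ} (φ : Cochain k A L i)
    (ψ : Cochain k A M j) (a : Fin (i + j + 1) → A) :
    d k A N (i + j) (cupCochain μ i j φ ψ) a =
      cupCochain μ (i + 1) j (d k A L i φ) ψ (fun p => a (Fin.cast (by omega) p)) +
        (-1 : k) ^ i • cupCochain μ i (j + 1) φ (d k A M j ψ) a := by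
  simp only [d, LinearMap.coe_mk, AddHom.coe_mk, add_apply, cupCochain_apply,
    sum_apply, smul_apply, map_add, LinearMap.add_apply, map_sum,
    LinearMap.sum_apply, map_smul, LinearMap.smul_apply, Fin.sum_univ_add, smul_add,
    Finset.smul_sum, firstFace, innerFace, lastFace, MultilinearMap.coe_mk,
    μ.smul_left, μ.smul_right, μ.smul_middle]
  have key : ∀ {P Q R : N} {S T U V X Y Z : N}, P = S → Q = T → R = V → X = Z → U + Y = 0 →
      P + (Q + R) + X = S + T + U + (Y + V + Z) := by
    rintro P Q R S T U V X Y Z rfl rfl rfl rfl h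
    have : U = -Y := eq_neg_of_add_eq_zero_left h
    subst this
    abel
  have e : ∀ p q : Fin (i + j + 1), (p : ℕ) = q → a p = a q := fun p q h => by
    rw [Fin.ext h]
  have hB : ∀ u u' v v', u = u' → v = v' →
      μ.toBilin (φ u) (ψ v) = μ.toBilin (φ u') (ψ v') := by
    rintro u _ v _ rfl rfl
    rfl
  apply key
  · refine congrArg _ (hB _ _ _ _ rfl ?_)
    funext q
    apply e; simp; omega
  · refine Finset.sum_congr rfl fun x _ => congrArg _ (hB _ _ _ _ rfl ?_)
    funext q
    simp only [Fin.contractNth, Fin.val_castSucc, Fin.val_castAdd, Fin.val_natAdd]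
    rw [if_neg (by omega), if_neg (by omega)]
    apply e; simp; omega
  · refine Finset.sum_congr rfl fun x _ => ?_
    rw [smul_smul, ← pow_add]
    refine congrArg₂ _ (by rw [Fin.val_natAdd, add_assoc]) (hB _ _ _ _ ?_ ?_)
    · funext q
      simp only [Fin.contractNth, Fin.val_castSucc, Fin.val_castAdd, Fin.val_natAdd]
      rw [if_pos (by omega)]
      rfl
    · funext q
      simp only [Fin.contractNth, Fin.val_castSucc, Fin.val_natAdd]
      split_ifs <;> first | omega | rfl
  · rw [smul_smul, ← pow_add]
    rfl
  · have : ∀ u v : N, u = v → (-1 : k) ^ (i + 1) • u + (-1 : k) ^ i • v = 0 := by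
      rintro u v rfl
      rw [pow_succ]; simp
    apply this
    congr 3
    funext q
    apply e; simp; omega

theorem cupCochain_mem_cocycles (μ : Pairing k A L M N) {i j : ℕ} {φ : Cochain k A L i}
    (hφ : φ ∈ cocycles k A L i) {ψ : Cochain k A M j} (hψ : ψ ∈ cocycles k A M j) :
    cupCochain μ i j φ ψ ∈ cocycles k A N (i + j) := by
  rw [cocycles, LinearMap.mem_ker] at *
  ext a
  rw [d_cupCochain, hφ, hψ]
  simp

theorem cupCochain_mem_coboundaries_right (μ : Pairing k A L M N) {i j : ℕ}
    {φ : Cochain k A L i} (hφ : φ ∈ cocycles k A L i)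
    {ψ : Cochain k A M j} (hψ : ψ ∈ coboundaries k A M j) :
    cupCochain μ i j φ ψ ∈ coboundaries k A N (i + j) := by
  rw [cocycles, LinearMap.mem_ker] at hφ
  cases j with
  | zero => simp only [coboundaries, Submodule.mem_bot] at hψ; simp [hψ]
  | succ j =>
    obtain ⟨χ, rfl⟩ := hψ
    refine ⟨(-1 : k) ^ i • cupCochain μ i j φ χ, ?_⟩
    ext a
    rw [map_smul, smul_apply]
    refine (congrArg _ (d_cupCochain μ φ χ a)).trans ?_
    rw [hφ, smul_add, smul_smul, ← mul_pow]
    simp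

theorem cupCochain_mem_coboundaries_left (μ : Pairing k A L M N) {i j : ℕ}
    {φ : Cochain k A L i} (hφ : φ ∈ coboundaries k A L i)
    {ψ : Cochain k A M j} (hψ : ψ ∈ cocycles k A M j) :
    cupCochain μ i j φ ψ ∈ coboundaries k A N (i + j) := by
  rw [cocycles, LinearMap.mem_ker] at hψ
  cases i with
  | zero => simp only [coboundaries, Submodule.mem_bot] at hφ; simp [hφ]
  | succ i =>
    obtain ⟨χ, rfl⟩ := hφ
    have : ∀ (n : ℕ) (h : i + j + 1 = n) (f : Cochain k A N n),
        (∀ a : Fin n → A, f a = d k A N (i + j) (cupCochain μ i j χ ψ) (a ∘ Fin.cast h)) →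
        f ∈ coboundaries k A N n := by
      rintro _ rfl f hf
      exact ⟨cupCochain μ i j χ ψ, by ext a; exact (hf a).symm⟩
    refine this _ (by omega) _ fun a => ?_
    rw [d_cupCochain, hψ]
    simp [Function.comp_def]

/-- The cup product of cocycles, as a cohomology class. -/
def cupCocycles (μ : Pairing k A L M N) (i j : ℕ) :
    cocycles k A L i →ₗ[k] cocycles k A M j →ₗ[k] Cohomology k A N (i + j) :=
  LinearMap.mk₂ k
    (fun φ ψ => cls ⟨cupCochain μ i j φ ψ, cupCochain_mem_cocycles μ φ.2 ψ.2⟩)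
    (fun φ φ' ψ => by
      simp only [cls, ← Submodule.Quotient.mk_add]
      congr 1; ext1; simp)
    (fun c φ ψ => by
      simp only [cls, ← Submodule.Quotient.mk_smul]
      congr 1; ext1; simp)
    (fun φ ψ ψ' => by
      simp only [cls, ← Submodule.Quotient.mk_add]
      congr 1; ext1; simp)
    (fun c φ ψ => by
      simp only [cls, ← Submodule.Quotient.mk_smul]
      congr 1; ext1; simp)

/-- The cup product `Hⁱ(A, L) × Hʲ(A, M) → Hⁱ⁺ʲ(A, N)` induced by a pairing `L ⊗_A M → N`. -/
def cup (μ : Pairing k A L M N) (i j : ℕ) :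
    Cohomology k A L i →ₗ[k] Cohomology k A M j →ₗ[k] Cohomology k A N (i + j) :=
  LinearMap.flip <| Submodule.liftQ _
    (LinearMap.flip <| Submodule.liftQ _ (cupCocycles μ i j) <| by
      intro φ hφ
      rw [LinearMap.mem_ker]
      ext ψ
      exact (Submodule.Quotient.mk_eq_zero _).2
        (cupCochain_mem_coboundaries_left μ hφ ψ.2)) <| by
    intro ψ hψ
    rw [LinearMap.mem_ker]
    ext φ
    exact (Submodule.Quotient.mk_eq_zero _).2
      (cupCochain_mem_coboundaries_right μ φ.2 hψ)

theorem cup_cls (μ : Pairing k A L M N) {i j : ℕ} (φ : cocycles k A L i)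
    (ψ : cocycles k A M j) :
    cup μ i j (cls φ) (cls ψ) =
      cls ⟨cupCochain μ i j φ ψ, cupCochain_mem_cocycles μ φ.2 ψ.2⟩ := rfl

end Cup

end Hochschild

namespace Symplectic

open Hochschild MulOpposite

section Poly

variable (k : Type*) [Field k] (U : Type*) [AddCommGroup U] [Module k U]

/-- The algebra `k[U]` of polynomial functions on `U`: the symmetric algebra of the dual space. -/
abbrev PolyFun : Type _ := SymmetricAlgebra k (Module.Dual k U)

variable {k U}

/-- Pullback of polynomial functions along a linear map, `a ↦ a ∘ f`. For the inclusion of a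
subspace this is restriction. -/
def pullback {W : Type*} [AddCommGroup W] [Module k W] (f : U →ₗ[k] W) :
    PolyFun k W →ₐ[k] PolyFun k U :=
  SymmetricAlgebra.lift (SymmetricAlgebra.ι k (Module.Dual k U) ∘ₗ f.dualMap)

theorem pullback_comp_apply {W X : Type*} [AddCommGroup W] [Module k W] [AddCommGroup X]
    [Module k X] (f : U →ₗ[k] W) (f' : W →ₗ[k] X) (a : PolyFun k X) :
    pullback (f' ∘ₗ f) a = pullback f (pullback f' a) := by
  have : pullback (f' ∘ₗ f) = (pullback f).comp (pullback f') := by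
    apply SymmetricAlgebra.algHom_ext
    ext x
    simp [pullback]
    rfl
  rw [this]
  rfl

variable (k U)

/-- The algebra `ΛU ⊗ k[U]` of polynomial multivector fields on `U`; its product is the wedge
product of multivector fields. -/
abbrev MultiVec : Type _ := ExteriorAlgebra k U ⊗[k] PolyFun k U

/-- `Λⁿ U` for an integer `n`; it is zero for negative `n`. -/
def extPow (n : ℤ) : Submodule k (ExteriorAlgebra k U) :=
  if 0 ≤ n then ⋀[k]^n.toNat U else ⊥

variable {k U}

/-- The inclusion `Λⁿ U ⊗ k[U] → ΛU ⊗ k[U]`. -/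
def toMultiVec {n : ℤ} : extPow k U n ⊗[k] PolyFun k U →ₗ[k] MultiVec k U :=
  LinearMap.rTensor _ (extPow k U n).subtype

/-- The pairing of multivectors with `y₁ ∧ … ∧ yᵢ`, where `y₁, …, yᵢ` are linear forms on `U`:
`v₁ ∧ … ∧ vᵢ ↦ det (y_q (v_p))`, and multivectors of any other degree are sent to zero. -/
def pairForms {i : ℕ} (y : Fin i → Module.Dual k U) : ExteriorAlgebra k U →ₗ[k] k :=
  ExteriorAlgebra.liftAlternating
    (Pi.single i (Matrix.detRowAlternating.compLinearMap (LinearMap.pi y)))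

end Poly

section Action

variable {k G V : Type*} [Field k] [Group G] [AddCommGroup V] [Module k V]
  (ρ : Representation k G V)

/-- The action of `g` on polynomial functions, `a^g = a ∘ g⁻¹`. -/
def polyAct (g : G) : PolyFun k V →ₐ[k] PolyFun k V := pullback (ρ g⁻¹)

theorem polyAct_mul (g h : G) (a : PolyFun k V) :
    polyAct ρ (g * h) a = polyAct ρ g (polyAct ρ h a) := by
  rw [polyAct, mul_inv_rev, map_mul]
  exact pullback_comp_apply _ _ _

/-- The `k[V]`-bimodule `k[V]g = {a g}` inside the crossed product `k[G] ⋉ k[V]`, in which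
`g a = a^g g`. The element `b g` is represented by `b`; so `a · (b g) = (a b) g` and
`(b g) · a = (b a^g) g`. -/
def Component (_ρ : Representation k G V) (_g : G) : Type _ := PolyFun k V

instance (g : G) : AddCommGroup (Component ρ g) := inferInstanceAs (AddCommGroup (PolyFun k V))
instance (g : G) : Module k (Component ρ g) := inferInstanceAs (Module k (PolyFun k V))
instance (g : G) : Module (PolyFun k V) (Component ρ g) :=
  inferInstanceAs (Module (PolyFun k V) (PolyFun k V))

/-- The coefficient `b` of the element `b g`. -/
def coeff (g : G) : Component ρ g ≃ₗ[k] PolyFun k V := LinearEquiv.refl k (PolyFun k V)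

instance (g : G) : Module (PolyFun k V)ᵐᵒᵖ (Component ρ g) where
  smul a b := (coeff ρ g).symm (coeff ρ g b * polyAct ρ g (unop a))
  one_smul b := show (coeff ρ g).symm (coeff ρ g b * polyAct ρ g 1) = b by simp
  mul_smul a a' b := by
    show (coeff ρ g).symm (coeff ρ g b * polyAct ρ g (unop a' * unop a)) =
      (coeff ρ g).symm (coeff ρ g b * polyAct ρ g (unop a') * polyAct ρ g (unop a))
    rw [map_mul (polyAct ρ g), mul_assoc]
  smul_zero a := show (coeff ρ g).symm (coeff ρ g 0 * polyAct ρ g (unop a)) = 0 by simp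
  smul_add a b b' := by
    show (coeff ρ g).symm (coeff ρ g (b + b') * polyAct ρ g (unop a)) =
      (coeff ρ g).symm (coeff ρ g b * polyAct ρ g (unop a)) +
        (coeff ρ g).symm (coeff ρ g b' * polyAct ρ g (unop a))
    rw [map_add, add_mul, map_add]
  add_smul a a' b := by
    show (coeff ρ g).symm (coeff ρ g b * polyAct ρ g (unop a + unop a')) =
      (coeff ρ g).symm (coeff ρ g b * polyAct ρ g (unop a)) +
        (coeff ρ g).symm (coeff ρ g b * polyAct ρ g (unop a'))
    rw [map_add, mul_add, map_add]
  zero_smul b := show (coeff ρ g).symm (coeff ρ g b * polyAct ρ g 0) = 0 by simp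

theorem coeff_smul (g : G) (a : PolyFun k V) (b : Component ρ g) :
    coeff ρ g (a • b) = a * coeff ρ g b := rfl

theorem coeff_op_smul (g : G) (a : PolyFun k V) (b : Component ρ g) :
    coeff ρ g (op a • b) = coeff ρ g b * polyAct ρ g a := rfl

instance (g : G) : IsScalarTower k (PolyFun k V) (Component ρ g) :=
  inferInstanceAs (IsScalarTower k (PolyFun k V) (PolyFun k V))

instance (g : G) : IsScalarTower k (PolyFun k V)ᵐᵒᵖ (Component ρ g) where
  smul_assoc c a b := by
    apply (coeff ρ g).injective
    induction a using MulOpposite.rec' with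
    | h a => rw [← op_smul, coeff_op_smul, map_smul, map_smul, coeff_op_smul, mul_smul_comm]

/-- The product `k[V]g ⊗ k[V]h → k[V]gh` in the crossed product, `(a g)(b h) = (a b^g) gh`. -/
def componentMul (g h : G) :
    Pairing k (PolyFun k V) (Component ρ g) (Component ρ h) (Component ρ (g * h)) where
  toBilin := LinearMap.mk₂ k
    (fun a b => (coeff ρ (g * h)).symm (coeff ρ g a * polyAct ρ g (coeff ρ h b)))
    (fun a a' b => by simp [add_mul])
    (fun c a b => by simp)
    (fun a b b' => by simp [mul_add])
    (fun c a b => by simp)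
  smul_left a x y := by
    apply (coeff ρ (g * h)).injective
    simp [coeff_smul, mul_assoc]
  smul_middle a x y := by
    apply (coeff ρ (g * h)).injective
    simp [coeff_smul, coeff_op_smul, mul_assoc]
  smul_right a x y := by
    apply (coeff ρ (g * h)).injective
    simp [coeff_op_smul, mul_assoc, polyAct_mul]

/-- The space `V^g` of `g`-invariant vectors. -/
def fixedSpace (g : G) : Submodule k V := LinearMap.eqLocus (ρ g) LinearMap.id

/-- The space `(V^g)^∨` spanned by the eigenvectors of `g` with eigenvalue different from `1`. -/
def movingSpace (g : G) : Submodule k V := ⨆ (c : k) (_ : c ≠ 1), Module.End.eigenspace (ρ g) c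

/-- `d_g`, the codimension of `V^g` in `V`. -/
def codim (g : G) : ℕ := Module.finrank k (V ⧸ fixedSpace ρ g)

/-- The symmetrization `π^g = (1/m) ∑_{i=1}^m g^i : V → V^g`, where `m` is the order of `g`. -/
def symmetrization (g : G) : V →ₗ[k] fixedSpace ρ g :=
  LinearMap.codRestrict _
    ((orderOf g : k)⁻¹ • ∑ i ∈ Finset.range (orderOf g), ρ (g ^ (i + 1))) <| by
    intro v
    change ρ g (((orderOf g : k)⁻¹ • ∑ i ∈ Finset.range (orderOf g), ρ (g ^ (i + 1))) v) =
      ((orderOf g : k)⁻¹ • ∑ i ∈ Finset.range (orderOf g), ρ (g ^ (i + 1))) v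
    rw [LinearMap.smul_apply, LinearMap.sum_apply, map_smul, map_sum]
    congr 1
    have h : ∀ i, ρ g (ρ (g ^ (i + 1)) v) = ρ (g ^ (i + 2)) v := fun i => by
      rw [← Module.End.mul_apply, ← map_mul, ← pow_succ']
    simp only [h]
    have h1 := Finset.sum_range_succ (fun i => ρ (g ^ (i + 1)) v) (orderOf g)
    have h2 := Finset.sum_range_succ' (fun i => ρ (g ^ (i + 1)) v) (orderOf g)
    rw [h1] at h2
    rw [pow_succ, pow_orderOf_eq_one, one_mul, zero_add, pow_one] at h2
    exact (add_right_cancel h2).symm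

/-- For `V^u ⊆ V^g`, the map `ξ ⊗ f ↦ π^u ξ ⊗ f|_{V^u}` from multivector fields on `V^g` to
multivector fields on `V^u`. -/
def restrictMultiVec {g u : G} (h : fixedSpace ρ u ≤ fixedSpace ρ g) :
    MultiVec k (fixedSpace ρ g) →ₐ[k] MultiVec k (fixedSpace ρ u) :=
  Algebra.TensorProduct.map
    (ExteriorAlgebra.map (symmetrization ρ u ∘ₗ (fixedSpace ρ g).subtype))
    (pullback (Submodule.inclusion h))

/-- The map `ΛV^g ⊗ k[V^g] → ΛV ⊗ k[V^g]`, `ξ ⊗ f ↦ (ξ ∧ s) ⊗ f`. -/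
def wedgeWith (g : G) (s : ExteriorAlgebra k V) :
    MultiVec k (fixedSpace ρ g) →ₗ[k] ExteriorAlgebra k V ⊗[k] PolyFun k (fixedSpace ρ g) :=
  LinearMap.rTensor _
    (LinearMap.mulRight k s ∘ₗ (ExteriorAlgebra.map (fixedSpace ρ g).subtype).toLinearMap)

/-- The multivector on `V` defined by an element of `Λⁿ (V^g)^∨`. -/
def movingToExt (g : G) {n : ℕ} (s : ⋀[k]^n (movingSpace ρ g)) : ExteriorAlgebra k V :=
  ExteriorAlgebra.map (movingSpace ρ g).subtype s

/-- The alternation of a cochain on linear forms, restricted to `V^g`: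
`∑_σ sgn(σ) φ (y_{σ(1)}, …, y_{σ(i)})|_{V^g}`. -/
def altEval (g : G) {i : ℕ} (φ : Cochain k (PolyFun k V) (Component ρ g) i)
    (y : Fin i → Module.Dual k V) : PolyFun k (fixedSpace ρ g) :=
  ∑ σ : Equiv.Perm (Fin i), Equiv.Perm.sign σ •
    pullback (fixedSpace ρ g).subtype
      (coeff ρ g (φ fun p => SymmetricAlgebra.ι k (Module.Dual k V) (y (σ p))))

end Action

end Symplectic

end

/-! Alternating a Hochschild cochain on linear forms is a chain map to the Koszul complex of
alternating maps on `V*` whose operators are the commutators with linear forms. For a polynomial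
algebra it induces an isomorphism on cohomology. The proof is by dimension shifting along `M →
Hom_k(A, M)`: both complexes of the coinduced bimodule are acyclic in positive degrees, so
injectivity (`exists_d_eq`) and surjectivity (`exists_altOn_sub_mem`) pass to one degree lower with
coefficients in the quotient.

For `k[V]g` the commutator with `y` is multiplication by `y - y^g`. In an eigenbasis of `g` these
elements are combinations of the coordinates with eigenvalue different from 1. A divided difference
removes such coordinates one by one, so a cocycle whose alternation vanishes on `V^g` is a
coboundary (`mem_coboundaries_of_altEvalMap_eq_zero`). The restricted alternation is annihilated by
wedging with every moving vector (`koszulD_scalOp_altEvalMap`), hence equals `ξ ∧ s_g` for a unique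
multivector field `ξ` on `V^g`. Every `ξ` occurs, by extending coefficients constantly along `π^g`.
This gives `cohomologyEquiv`.

Alternation turns cup products into wedge products. If the moving spaces of `g` and `h` share a
vector `v ≠ 0`, then `s_g` and `s_h` are both divisible by `v` and the product vanishes. If they are
disjoint, then `V^(gh) = V^g ∩ V^h`, and since a moving space is the symplectic complement of the
fixed space, the moving space of `gh` is the sum of the two. The sign comes from moving `s_g` past
`ξ_h`.

The delicate point is to choose all `s_g` multiplicatively. Over `ℂ`, `G` commutes with a
quaternionic structure `j`. The moving spaces are quaternionic, and the product of the bivectors `v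
∧ j v` over a quaternionic basis is canonical up to a positive factor; this fixes the phase of
`s_g`. Its length is fixed by the determinant of Wall's form `(x - g x, y - g y) ↦ ω(x, y - g y)`,
which is multiplicative on transversal pairs (`exists_frameVec_mul_eq`). For general `k`, the group,
the form and the frames lift to a local ring `O` embedded in `ℂ` with a homomorphism to `k`. The
structure constants are then units of `O`, and the map `Oˣ → kˣ` extends to `ℂˣ → kˣ` because `kˣ`
is divisible. This extension carries the complex scalars to scalars in `k` (`exists_frames`). -/

noncomputable section

set_option linter.unusedSectionVars false

/-! ### Koszul complexes of commuting operators. -/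

namespace Koszul

section Differential

variable {k E M M' : Type*} [Field k] [AddCommGroup E] [Module k E] [AddCommGroup M] [Module k M]
  [AddCommGroup M'] [Module k M'] {n : ℕ}

/-- The Koszul differential of a family of operators `T y` depending linearly on `y`. -/
def koszulD (T : E →ₗ[k] M →ₗ[k] M) : (E [⋀^Fin n]→ₗ[k] M) →ₗ[k] E [⋀^Fin (n + 1)]→ₗ[k] M :=
  AlternatingMap.alternatizeUncurryFinLM ∘ₗ LinearMap.mk₂ k
    (fun α y => (T y).compAlternatingMap α)
    (fun α α' y => by ext; simp) (fun c α y => by ext; simp)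
    (fun α y y' => by ext; simp) (fun c α y => by ext; simp)

theorem koszulD_apply (T : E →ₗ[k] M →ₗ[k] M) (α : E [⋀^Fin n]→ₗ[k] M) (v : Fin (n + 1) → E) :
    koszulD T α v = ∑ i : Fin (n + 1), (-1) ^ (i : ℕ) • T (v i) (α (i.removeNth v)) := by
  simp [koszulD, AlternatingMap.alternatizeUncurryFin_apply]

/-- Cartan's formula. The term that uses up `y` gives `T y`; in the other terms `y` stays in front,
which shifts the position of the removed argument by one and reverses the sign. -/
theorem curryLeft_koszulD (T : E →ₗ[k] M →ₗ[k] M) (α : E [⋀^Fin (n + 1)]→ₗ[k] M) (y : E) :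
    (koszulD T α).curryLeft y = (T y).compAlternatingMap α - koszulD T (α.curryLeft y) := by
  ext v
  simp only [AlternatingMap.curryLeft_apply_apply, koszulD_apply, AlternatingMap.sub_apply,
    LinearMap.compAlternatingMap_apply]
  rw [Fin.sum_univ_succ, sub_eq_add_neg, ← Finset.sum_neg_distrib]
  congr 1
  · simp [Matrix.vecCons]
  · refine Finset.sum_congr rfl fun i _ => ?_
    simp only [Fin.val_succ, pow_succ, mul_neg, mul_one, neg_smul, Matrix.cons_val_succ]
    congr 4
    funext j
    refine Fin.cases ?_ (fun j => ?_) j <;> simp [Fin.removeNth, Matrix.vecCons]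

/-- All terms of the differential but the first keep `y` as an argument of `γ`. -/
theorem curryLeft_koszulD_of_forall (T : E →ₗ[k] M →ₗ[k] M) (γ : E [⋀^Fin n]→ₗ[k] M) (y : E)
    (h : ∀ v i, v i = y → γ v = 0) :
    (koszulD T γ).curryLeft y = (T y).compAlternatingMap γ := by
  ext v
  simp only [AlternatingMap.curryLeft_apply_apply, koszulD_apply,
    LinearMap.compAlternatingMap_apply]
  rw [Fin.sum_univ_succ, Finset.sum_eq_zero, add_zero]
  · simp [Matrix.vecCons]
  · intro i _
    obtain ⟨n, rfl⟩ : ∃ m, n = m + 1 := ⟨n - 1, by have := i.2; omega⟩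
    rw [h _ 0 (by simp [Fin.removeNth, Matrix.vecCons]), map_zero, smul_zero]

theorem koszulD_koszulD (T : E →ₗ[k] M →ₗ[k] M) (hT : ∀ y y' m, T y (T y' m) = T y' (T y m))
    (α : E [⋀^Fin n]→ₗ[k] M) : koszulD T (koszulD T α) = 0 := by
  let f : E →ₗ[k] E →ₗ[k] E [⋀^Fin n]→ₗ[k] M := LinearMap.mk₂ k
    (fun y y' => (T y).compAlternatingMap ((T y').compAlternatingMap α))
    (fun α α' y => by ext; simp) (fun c α y => by ext; simp)
    (fun α y y' => by ext; simp) (fun c α y => by ext; simp)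
  have := AlternatingMap.alternatizeUncurryFin_alternatizeUncurryFinLM_comp_of_symmetric
    (f := f) (fun x y => by ext v; simp [f, hT x y])
  rw [← this]
  ext v
  simp [koszulD_apply, AlternatingMap.alternatizeUncurryFin_apply, f]

theorem compAlternatingMap_koszulD (T : E →ₗ[k] M →ₗ[k] M) (T' : E →ₗ[k] M' →ₗ[k] M')
    (f : M →ₗ[k] M') (h : ∀ y m, f (T y m) = T' y (f m)) (α : E [⋀^Fin n]→ₗ[k] M) :
    f.compAlternatingMap (koszulD T α) = koszulD T' (f.compAlternatingMap α) := by
  ext v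
  simp [koszulD_apply, h]

theorem eq_zero_of_curryLeft_eq_zero {ι : Type*} (e : ι → E)
    (he : Submodule.span k (Set.range e) = ⊤) (α : E [⋀^Fin (n + 1)]→ₗ[k] M)
    (h : ∀ i, α.curryLeft (e i) = 0) : α = 0 := by
  have h0 : α.curryLeft = 0 := LinearMap.ext_on_range he (by simpa using h)
  ext v
  have := congrArg (fun f => f (v 0) (Fin.tail v)) h0
  simpa [AlternatingMap.curryLeft_apply_apply, Matrix.vecCons, Fin.cons_self_tail] using this

/-- The surjection from `K ⊓ K.comap T` onto `K` splits over a field, and a linear projection onto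
`K` extends the section to all of `M`. Linearity is what allows composing it with alternating maps.
-/
theorem exists_linear_section (T : M →ₗ[k] M) (K : Submodule k M)
    (h : ∀ m ∈ K, ∃ m' ∈ K, T m' = m) :
    ∃ S : M →ₗ[k] M, ∀ m ∈ K, S m ∈ K ∧ T (S m) = m := by
  let K' : Submodule k M := K ⊓ K.comap T
  let r : K' →ₗ[k] K := (T.comp K'.subtype).codRestrict K (fun x => x.2.2)
  have hr : LinearMap.range r = ⊤ := by
    rw [LinearMap.range_eq_top]
    rintro ⟨m, hm⟩
    obtain ⟨m', hm', rfl⟩ := h m hm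
    exact ⟨⟨m', hm', hm⟩, rfl⟩
  obtain ⟨s, hs⟩ := r.exists_rightInverse_of_surjective hr
  obtain ⟨p, hp⟩ := K.subtype.exists_leftInverse_of_injective (Submodule.ker_subtype K)
  refine ⟨K'.subtype ∘ₗ s ∘ₗ p, fun m hm => ?_⟩
  have hpm : p m = ⟨m, hm⟩ := LinearMap.congr_fun hp ⟨m, hm⟩
  refine ⟨(s (p m)).2.1, ?_⟩
  have := congrArg Subtype.val (LinearMap.congr_fun hs (p m))
  rw [hpm] at this
  simp only [LinearMap.comp_apply, hpm]
  exact this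

/-- The Koszul complex is acyclic in positive degrees if each operator is surjective on the common
kernel of the preceding ones. -/
theorem exists_koszulD_eq {N : ℕ} (T : E →ₗ[k] M →ₗ[k] M)
    (hT : ∀ y y' m, T y (T y' m) = T y' (T y m)) (e : Fin N → E)
    (he : Submodule.span k (Set.range e) = ⊤)
    (hsurj : ∀ j m, (∀ i < j, T (e i) m = 0) → ∃ m', (∀ i < j, T (e i) m' = 0) ∧ T (e j) m' = m)
    (α : E [⋀^Fin (n + 1)]→ₗ[k] M) (hα : koszulD T α = 0) : ∃ β, koszulD T β = α := by
  -- `α` is corrected by boundaries until its contractions with the first `j` generators vanish; for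
  -- `j = N` nothing is left.
  have key : ∀ j ≤ N, ∃ β, ∀ i : Fin N, (i : ℕ) < j → (α - koszulD T β).curryLeft (e i) = 0 := by
    intro j
    induction j with
    | zero => exact fun _ => ⟨0, fun i hi => absurd hi (Nat.not_lt_zero _)⟩
    | succ j ih =>
      intro hj
      obtain ⟨β, hβ⟩ := ih (by omega)
      set α' := α - koszulD T β with hα'
      have hcl : koszulD T α' = 0 := by rw [hα', map_sub, hα, koszulD_koszulD T hT, sub_zero]
      let j' : Fin N := ⟨j, by omega⟩
      let K : Submodule k M := ⨅ i : {i : Fin N // i < j'}, LinearMap.ker (T (e i))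
      have hK : ∀ m, m ∈ K ↔ ∀ i < j', T (e i) m = 0 := fun m => by simp [K]
      obtain ⟨S, hS⟩ := exists_linear_section (T (e j')) K (fun m hm => by
        obtain ⟨m', h1, h2⟩ := hsurj j' m ((hK m).1 hm)
        exact ⟨m', (hK m').2 h1, h2⟩)
      -- By Cartan's formula, a closed form whose contraction with `e i` vanishes has its values in
      -- the kernel of `T (e i)`.
      have hval : ∀ v, α' v ∈ K := fun v => (hK _).2 fun i hi => by
        have := curryLeft_koszulD T α' (e i)
        rw [hcl, hβ i hi, map_zero, sub_zero] at this
        exact (congrArg (fun f => f v) this).symm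
      -- `S` inverts `T (e j')` on `K`, so the boundary of `γ` has the same contraction with `e j'`
      -- as `α'`, and zero contraction with the earlier generators.
      let γ := S.compAlternatingMap (α'.curryLeft (e j'))
      have hγK : ∀ v, γ v ∈ K := fun v => (hS _ (hval _)).1
      have hγ0 : ∀ i ≤ j', ∀ v l, v l = e i → γ v = 0 := by
        intro i hi v l hl
        have : α'.curryLeft (e j') v = 0 := by
          rw [AlternatingMap.curryLeft_apply_apply]
          rcases hi.eq_or_lt with rfl | hi
          · exact α'.map_eq_zero_of_eq _ (i := 0) (j := l.succ) (by simp [hl])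
              (Fin.succ_ne_zero l).symm
          · have h1 : Matrix.vecCons (e j') v = Fin.insertNth l.succ (e i)
                (Fin.removeNth l.succ (Matrix.vecCons (e j') v)) := by
              conv_lhs => rw [← Fin.insertNth_self_removeNth l.succ (Matrix.vecCons (e j') v)]
              simp [hl]
            rw [h1, AlternatingMap.map_insertNth, ← AlternatingMap.curryLeft_apply_apply, hβ i hi]
            simp
        simp [γ, this]
      refine ⟨β + γ, ?_⟩
      intro i hi
      have hsub : α - koszulD T (β + γ) = α' - koszulD T γ := by rw [map_add, hα']; abel
      have hc : ∀ u w : E [⋀^Fin (n + 1)]→ₗ[k] M, ∀ y,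
          (u - w).curryLeft y = u.curryLeft y - w.curryLeft y := fun u w y => by ext; simp
      have hij : i ≤ j' := Fin.le_def.2 (Nat.lt_succ_iff.1 hi)
      rw [hsub, hc, curryLeft_koszulD_of_forall T γ (e i) (hγ0 i hij)]
      rcases hij.eq_or_lt with hi | hi
      · subst hi
        ext v
        simp [γ, (hS _ (hval (Matrix.vecCons (e j') v))).2]
      · rw [hβ i hi]
        ext v
        simpa using (hK _).1 (hγK v) i hi
  obtain ⟨β, hβ⟩ := key N le_rfl
  exact ⟨β, (sub_eq_zero.1 (eq_zero_of_curryLeft_eq_zero e he _ fun i => hβ i i.2)).symm⟩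

end Differential

end Koszul

/-! ### Functoriality of Hochschild cochains, and coinduced bimodules. -/

namespace Hochschild

open MulOpposite

section Functoriality

variable {k A M M' : Type*} [Field k] [CommRing A] [Algebra k A]
  [AddCommGroup M] [Module k M] [Module A M] [Module Aᵐᵒᵖ M] [IsScalarTower k A M]
  [IsScalarTower k Aᵐᵒᵖ M]
  [AddCommGroup M'] [Module k M'] [Module A M'] [Module Aᵐᵒᵖ M'] [IsScalarTower k A M']
  [IsScalarTower k Aᵐᵒᵖ M']

theorem d_apply {n : ℕ} (φ : Cochain k A M n) (a : Fin (n + 1) → A) :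
    d k A M n φ a = a 0 • φ (Fin.tail a) +
      ∑ j : Fin n, (-1 : k) ^ ((j : ℕ) + 1) • φ (Fin.contractNth j.castSucc (· * ·) a) +
      (-1 : k) ^ (n + 1) • (op (a (Fin.last n)) • φ (Fin.init a)) := by
  simp [d, firstFace, innerFace, lastFace]

theorem compMultilinearMap_d (F : M →ₗ[k] M') (hl : ∀ (a : A) m, F (a • m) = a • F m)
    (hr : ∀ (a : A) m, F (op a • m) = op a • F m) {n : ℕ} (φ : Cochain k A M n) :
    F.compMultilinearMap (d k A M n φ) = d k A M' n (F.compMultilinearMap φ) := by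
  ext a
  simp [d_apply, hl, hr]

variable (k A M) in
/-- The commutator `m ↦ a m - m a`. -/
def ad : A →ₗ[k] M →ₗ[k] M := LinearMap.mk₂ k (fun a m => a • m - op a • m)
  (fun a b m => by simp only [op_add, add_smul]; abel)
  (fun c a m => by rw [op_smul, smul_assoc, smul_assoc, smul_sub])
  (fun a m m' => by simp only [smul_add]; abel)
  (fun c a m => by
    rw [smul_algebra_smul_comm c a m, smul_algebra_smul_comm c (op a) m, smul_sub])

theorem ad_apply (a : A) (m : M) : ad k A M a m = a • m - op a • m := rfl

theorem ad_ad [SMulCommClass A Aᵐᵒᵖ M] (a b : A) (m : M) :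
    ad k A M a (ad k A M b m) = ad k A M b (ad k A M a m) := by
  simp only [ad_apply, smul_sub, smul_smul, ← op_mul, mul_comm b a, smul_comm a (op b),
    smul_comm b (op a)]
  abel

theorem d_zero_apply (φ : Cochain k A M 0) (a : Fin 1 → A) (v : Fin 0 → A) :
    d k A M 0 φ a = ad k A M (a 0) (φ v) := by
  rw [d_apply, Subsingleton.elim (Fin.tail a) v, Subsingleton.elim (Fin.init a) v, ad_apply]
  simp [sub_eq_add_neg]

end Functoriality

section Coinduced

variable (k A M : Type*) [Field k] [CommRing A] [Algebra k A]
  [AddCommGroup M] [Module k M] [Module A M] [Module Aᵐᵒᵖ M] [IsScalarTower k A M]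
  [IsScalarTower k Aᵐᵒᵖ M]

/-- The coinduced bimodule `Hom_k(A, M)`, with `(a f) x = f (x a)` and `(f a) x = f x a`. -/
def Coind : Type _ := A →ₗ[k] M

instance : AddCommGroup (Coind k A M) := inferInstanceAs (AddCommGroup (A →ₗ[k] M))
instance : Module k (Coind k A M) := inferInstanceAs (Module k (A →ₗ[k] M))

/-- The `k`-module underlying the coinduced bimodule. -/
def Coind.toHom : Coind k A M ≃ₗ[k] (A →ₗ[k] M) := LinearEquiv.refl k _

variable {k A M}

instance : FunLike (Coind k A M) A M := inferInstanceAs (FunLike (A →ₗ[k] M) A M)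
instance : LinearMapClass (Coind k A M) k A M := inferInstanceAs (LinearMapClass (A →ₗ[k] M) k A M)

@[ext] theorem Coind.ext {f g : Coind k A M} (h : ∀ x, f x = g x) : f = g := LinearMap.ext h

@[simp] theorem Coind.add_apply (f g : Coind k A M) (x : A) : (f + g) x = f x + g x := rfl
@[simp] theorem Coind.sub_apply (f g : Coind k A M) (x : A) : (f - g) x = f x - g x := rfl
@[simp] theorem Coind.zero_apply (x : A) : (0 : Coind k A M) x = 0 := rfl
@[simp] theorem Coind.smul_apply (c : k) (f : Coind k A M) (x : A) : (c • f) x = c • f x := rfl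

variable (k A M) in
/-- Evaluation of coinduced functions. -/
def Coind.eval (x : A) : Coind k A M →ₗ[k] M := LinearMap.applyₗ x

@[simp] theorem Coind.eval_apply (x : A) (f : Coind k A M) : Coind.eval k A M x f = f x := rfl

instance : Module A (Coind k A M) where
  smul a f := (f : A →ₗ[k] M) ∘ₗ LinearMap.mulRight k a
  one_smul f := Coind.ext fun x => congrArg f (mul_one x)
  mul_smul a b f := Coind.ext fun x => congrArg f (show x * (a * b) = x * a * b by ring)
  smul_zero a := rfl
  smul_add a f g := rfl
  add_smul a b f := Coind.ext fun x => (congrArg f (mul_add x a b)).trans (map_add f _ _)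
  zero_smul f := Coind.ext fun x => (congrArg f (mul_zero x)).trans (map_zero f)

@[simp] theorem Coind.left_smul_apply (a : A) (f : Coind k A M) (x : A) : (a • f) x = f (x * a) :=
  rfl

instance : Module Aᵐᵒᵖ (Coind k A M) where
  smul a f := ({ toFun := fun x => a • f x
                 map_add' := fun x y => by rw [map_add, smul_add]
                 map_smul' := fun c x => by
                  rw [map_smul, smul_algebra_smul_comm, RingHom.id_apply] } : A →ₗ[k] M)
  one_smul f := Coind.ext fun x => one_smul _ (f x)
  mul_smul a b f := Coind.ext fun x => mul_smul a b (f x)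
  smul_zero a := Coind.ext fun x => smul_zero a
  smul_add a f g := Coind.ext fun x => smul_add a (f x) (g x)
  add_smul a b f := Coind.ext fun x => add_smul a b (f x)
  zero_smul f := Coind.ext fun x => zero_smul _ (f x)

@[simp] theorem Coind.right_smul_apply (a : Aᵐᵒᵖ) (f : Coind k A M) (x : A) :
    (a • f) x = a • f x := rfl

instance : IsScalarTower k A (Coind k A M) where
  smul_assoc c a f := Coind.ext fun x => by simp

instance : IsScalarTower k Aᵐᵒᵖ (Coind k A M) where
  smul_assoc c a f := Coind.ext fun x => by simp

instance : SMulCommClass A Aᵐᵒᵖ (Coind k A M) where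
  smul_comm a b f := Coind.ext fun x => by simp

variable (k A M) in
/-- The embedding `m ↦ (x ↦ x m)` of a bimodule into the coinduced one. -/
def Coind.emb : M →ₗ[k] Coind k A M :=
  LinearMap.mk₂ k (fun m (x : A) => x • m) (fun m m' x => smul_add x m m')
    (fun c m x => smul_algebra_smul_comm c x m) (fun m x y => add_smul x y m)
    (fun c m x => smul_assoc c x m)

@[simp] theorem Coind.emb_apply (m : M) (x : A) : Coind.emb k A M m x = x • m := rfl

theorem Coind.emb_smul (a : A) (m : M) : Coind.emb k A M (a • m) = a • Coind.emb k A M m :=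
  Coind.ext fun x => by simp [mul_smul]

theorem Coind.emb_op_smul [SMulCommClass A Aᵐᵒᵖ M] (a : A) (m : M) :
    Coind.emb k A M (op a • m) = op a • Coind.emb k A M m :=
  Coind.ext fun x => by simp [smul_comm]

variable (k A M) in
/-- The quotient of `Hom_k(A, M)` by `M`, realised as the functions vanishing at `1`. -/
def CoindQuot : Type _ := LinearMap.ker (Coind.eval k A M 1)

instance : AddCommGroup (CoindQuot k A M) :=
  inferInstanceAs (AddCommGroup (LinearMap.ker (Coind.eval k A M 1)))
instance : Module k (CoindQuot k A M) :=
  inferInstanceAs (Module k (LinearMap.ker (Coind.eval k A M 1)))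

variable (k A M) in
/-- The inclusion of the functions vanishing at `1`. -/
def CoindQuot.incl : CoindQuot k A M →ₗ[k] Coind k A M :=
  (LinearMap.ker (Coind.eval k A M 1)).subtype

variable (k A M) in
/-- The projection `f ↦ f - f(1)`. -/
def CoindQuot.proj : Coind k A M →ₗ[k] CoindQuot k A M :=
  (LinearMap.id - Coind.emb k A M ∘ₗ Coind.eval k A M 1).codRestrict _ fun f => by simp

theorem CoindQuot.incl_injective : Function.Injective (CoindQuot.incl k A M) :=
  Subtype.val_injective

@[simp] theorem CoindQuot.incl_apply_one (f : CoindQuot k A M) : CoindQuot.incl k A M f 1 = 0 :=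
  f.2

@[simp] theorem CoindQuot.incl_proj (f : Coind k A M) :
    CoindQuot.incl k A M (CoindQuot.proj k A M f) = f - Coind.emb k A M (f 1) := rfl

@[simp] theorem CoindQuot.proj_incl (f : CoindQuot k A M) :
    CoindQuot.proj k A M (CoindQuot.incl k A M f) = f :=
  CoindQuot.incl_injective <| by simp

@[simp] theorem CoindQuot.proj_emb (m : M) : CoindQuot.proj k A M (Coind.emb k A M m) = 0 :=
  CoindQuot.incl_injective <| by simp

theorem CoindQuot.emb_eval_one_of_proj_eq_zero {f : Coind k A M}
    (h : CoindQuot.proj k A M f = 0) : Coind.emb k A M (f 1) = f := by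
  have := congrArg (CoindQuot.incl k A M) h
  rw [incl_proj, map_zero, sub_eq_zero] at this
  exact this.symm

/-- Functions vanishing at `1` are stable under the right action of the coinduced bimodule but not
under the left one, so the left action is followed by the projection. -/
instance : Module A (CoindQuot k A M) where
  smul a f := CoindQuot.proj k A M (a • CoindQuot.incl k A M f)
  one_smul f := show CoindQuot.proj k A M ((1 : A) • CoindQuot.incl k A M f) = f by simp
  mul_smul a b f := CoindQuot.incl_injective <| Coind.ext fun x => by
    change CoindQuot.incl k A M (CoindQuot.proj k A M ((a * b) • CoindQuot.incl k A M f)) x =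
      CoindQuot.incl k A M (CoindQuot.proj k A M (a • CoindQuot.incl k A M
        (CoindQuot.proj k A M (b • CoindQuot.incl k A M f)))) x
    simp [mul_smul, smul_sub, mul_assoc]
  smul_zero a := show CoindQuot.proj k A M (a • CoindQuot.incl k A M 0) = 0 by simp
  smul_add a f g := show CoindQuot.proj k A M (a • CoindQuot.incl k A M (f + g)) =
    CoindQuot.proj k A M (a • CoindQuot.incl k A M f) +
      CoindQuot.proj k A M (a • CoindQuot.incl k A M g) by simp
  add_smul a b f := show CoindQuot.proj k A M ((a + b) • CoindQuot.incl k A M f) =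
    CoindQuot.proj k A M (a • CoindQuot.incl k A M f) +
      CoindQuot.proj k A M (b • CoindQuot.incl k A M f) by simp [add_smul]
  zero_smul f := show CoindQuot.proj k A M ((0 : A) • CoindQuot.incl k A M f) = 0 by simp

theorem CoindQuot.smul_def (a : A) (f : CoindQuot k A M) :
    a • f = CoindQuot.proj k A M (a • CoindQuot.incl k A M f) := rfl

instance : Module Aᵐᵒᵖ (CoindQuot k A M) where
  smul a f := ⟨a • CoindQuot.incl k A M f, by simp⟩
  one_smul f := CoindQuot.incl_injective (one_smul _ (CoindQuot.incl k A M f))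
  mul_smul a b f := CoindQuot.incl_injective (mul_smul a b (CoindQuot.incl k A M f))
  smul_zero a := CoindQuot.incl_injective (smul_zero a)
  smul_add a f g := CoindQuot.incl_injective
    (smul_add a (CoindQuot.incl k A M f) (CoindQuot.incl k A M g))
  add_smul a b f := CoindQuot.incl_injective (add_smul a b (CoindQuot.incl k A M f))
  zero_smul f := CoindQuot.incl_injective (zero_smul _ (CoindQuot.incl k A M f))

@[simp] theorem CoindQuot.incl_op_smul (a : Aᵐᵒᵖ) (f : CoindQuot k A M) :
    CoindQuot.incl k A M (a • f) = a • CoindQuot.incl k A M f := rfl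

@[simp] theorem CoindQuot.incl_smul (a : A) (f : CoindQuot k A M) (x : A) :
    CoindQuot.incl k A M (a • f) x =
      CoindQuot.incl k A M f (x * a) - x • CoindQuot.incl k A M f a := by
  simp [CoindQuot.smul_def]

instance : IsScalarTower k A (CoindQuot k A M) where
  smul_assoc c a f := CoindQuot.incl_injective <| Coind.ext fun x => by
    simp [smul_sub, smul_algebra_smul_comm]

instance : IsScalarTower k Aᵐᵒᵖ (CoindQuot k A M) where
  smul_assoc c a f := CoindQuot.incl_injective <| Coind.ext fun x => by simp

theorem CoindQuot.proj_smul (a : A) (f : Coind k A M) :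
    CoindQuot.proj k A M (a • f) = a • CoindQuot.proj k A M f :=
  CoindQuot.incl_injective <| Coind.ext fun x => by simp [mul_smul, smul_sub]

variable [SMulCommClass A Aᵐᵒᵖ M]

instance : SMulCommClass A Aᵐᵒᵖ (CoindQuot k A M) where
  smul_comm a b f := CoindQuot.incl_injective <| Coind.ext fun x => by
    simp [smul_sub, smul_comm x b]

theorem CoindQuot.proj_op_smul (a : A) (f : Coind k A M) :
    CoindQuot.proj k A M (op a • f) = op a • CoindQuot.proj k A M f :=
  CoindQuot.incl_injective <| Coind.ext fun x => by simp [smul_sub, smul_comm x (op a)]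

end Coinduced

end Hochschild

/-! ### Currying as a contracting homotopy; the alternation map. -/

namespace Hochschild

open MulOpposite

section Curry

variable {k A M : Type*} [Field k] [CommRing A] [Algebra k A]
  [AddCommGroup M] [Module k M] [Module A M] [Module Aᵐᵒᵖ M] [IsScalarTower k A M]
  [IsScalarTower k Aᵐᵒᵖ M]

/-- Currying the first variable of a cochain. -/
def curry {n : ℕ} (φ : Cochain k A M (n + 1)) : Cochain k A (Coind k A M) n where
  toFun a := (Coind.toHom k A M).symm
    { toFun := fun x => φ (Fin.cons x a)
      map_add' := fun x y => φ.cons_add a x y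
      map_smul' := fun c x => φ.cons_smul a c x }
  map_update_add' {inst} a p x y := by
    have e : inst = instDecidableEqFin n := Subsingleton.elim _ _
    subst e
    refine Coind.ext fun z => ?_
    change φ _ = φ _ + φ _
    simp only [Fin.cons_update, MultilinearMap.map_update_add]
  map_update_smul' {inst} a p c x := by
    have e : inst = instDecidableEqFin n := Subsingleton.elim _ _
    subst e
    refine Coind.ext fun z => ?_
    change φ _ = c • φ _
    simp only [Fin.cons_update, MultilinearMap.map_update_smul]

@[simp] theorem curry_apply {n : ℕ} (φ : Cochain k A M (n + 1)) (a : Fin n → A) (x : A) :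
    curry φ a x = φ (Fin.cons x a) := rfl

/-- Merging the variable `x` with the next one is the left action on coinduced functions, so all
faces except `x • φ a` reassemble into the differential of `curry φ`. Consequently a cocycle becomes
the boundary of `curry φ` in the coinduced bimodule. -/
theorem d_cons {n : ℕ} (φ : Cochain k A M (n + 1)) (x : A) (a : Fin (n + 1) → A) :
    d k A M (n + 1) φ (Fin.cons x a) =
      x • φ a - d k A (Coind k A M) n (curry φ) a x := by
  have hsum : ∀ (s : Fin n → Coind k A M) (x : A), (∑ j, s j) x = ∑ j, s j x := fun s x =>
    map_sum (Coind.eval k A M x) s Finset.univ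
  rw [d_apply, d_apply, Fin.sum_univ_succ]
  simp only [Fin.cons_zero, Fin.tail_cons, Coind.add_apply, hsum, Coind.smul_apply,
    Coind.left_smul_apply, Coind.right_smul_apply, curry_apply]
  have h0 : Fin.contractNth (Fin.castSucc (0 : Fin (n + 1))) (· * ·) (Fin.cons x a : Fin (n + 2) → A)
      = Fin.cons (x * a 0) (Fin.tail a) := by
    funext j
    refine Fin.cases ?_ (fun j => ?_) j
    · simp [Fin.contractNth]
    · simp [Fin.contractNth, Fin.tail]
  have h1 : ∀ i : Fin n, Fin.contractNth (Fin.castSucc i.succ) (· * ·)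
      (Fin.cons x a : Fin (n + 2) → A) = Fin.cons x (Fin.contractNth i.castSucc (· * ·) a) := by
    intro i
    funext j
    refine Fin.cases ?_ (fun j => ?_) j
    · simp [Fin.contractNth]
    · simp [Fin.contractNth]
  have h2 : Fin.init (Fin.cons x a : Fin (n + 2) → A) = Fin.cons x (Fin.init a) := by
    funext j
    refine Fin.cases ?_ (fun j => ?_) j
    · simp [Fin.init]
    · simp [Fin.init]
  have h3 : (Fin.cons x a : Fin (n + 2) → A) (Fin.last (n + 1)) = a (Fin.last n) := by
    rw [← Fin.succ_last, Fin.cons_succ]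
  simp only [h0, h1, h2, h3, Fin.val_zero, Fin.val_succ, zero_add, pow_one, pow_succ _ (_ + 1),
    mul_neg, mul_one, neg_smul, Finset.sum_neg_distrib, one_smul]
  abel

theorem curry_d {n : ℕ} (φ : Cochain k A M (n + 1)) :
    curry (d k A M (n + 1) φ) =
      (Coind.emb k A M).compMultilinearMap φ - d k A (Coind k A M) n (curry φ) := by
  ext a x
  simp [d_cons]

end Curry

section Square

universe u v

variable {k : Type v} {A : Type u} [Field k] [CommRing A] [Algebra k A]

/-- Induction on the degree by `d_cons` and `curry_d`: two copies of `x • d φ` cancel, leaving the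
square of the differential one degree lower with coefficients in `Coind k A M`. Taking `M` in the
universe of `A` keeps the coinduced bimodule in the range of the induction. -/
theorem d_comp_d (n : ℕ) : ∀ (M : Type u) [AddCommGroup M] [Module k M] [Module A M]
    [Module Aᵐᵒᵖ M] [IsScalarTower k A M] [IsScalarTower k Aᵐᵒᵖ M] [SMulCommClass A Aᵐᵒᵖ M]
    (φ : Cochain k A M n), d k A M (n + 1) (d k A M n φ) = 0 := by
  induction n with
  | zero =>
    intro M _ _ _ _ _ _ _ φ
    ext a
    have h : a = Fin.cons (a 0) (Fin.tail a) := (Fin.cons_self_tail a).symm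
    rw [h, d_cons, d_zero_apply _ _ default, d_zero_apply _ _ default, ad_apply, ad_apply]
    simp only [Coind.sub_apply, Coind.left_smul_apply, Coind.right_smul_apply, curry_apply,
      d_zero_apply _ _ default, ad_apply, Fin.cons_zero, smul_sub, mul_smul, op_mul,
      zero_apply]
    rw [smul_comm (a 0) (op (Fin.tail a 0))]
    simp only [smul_smul, ← op_mul, mul_comm (a 0) (Fin.tail a 0)]
    abel
  | succ n ih =>
    intro M _ _ _ _ _ _ _ φ
    ext a
    have h : a = Fin.cons (a 0) (Fin.tail a) := (Fin.cons_self_tail a).symm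
    rw [h, d_cons, curry_d, map_sub, ih,
      ← compMultilinearMap_d _ Coind.emb_smul Coind.emb_op_smul]
    simp

end Square

section Alternation

variable {k A M M' E : Type*} [Field k] [CommRing A] [Algebra k A]
  [AddCommGroup M] [Module k M] [Module A M] [Module Aᵐᵒᵖ M] [IsScalarTower k A M]
  [IsScalarTower k Aᵐᵒᵖ M] [AddCommGroup E] [Module k E] (ι : E →ₗ[k] A)
  [AddCommGroup M'] [Module k M']

/-- The alternation of a cochain on generators. -/
def altOn {n : ℕ} : Cochain k A M n →ₗ[k] E [⋀^Fin n]→ₗ[k] M where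
  toFun φ := MultilinearMap.alternatization (φ.compLinearMap fun _ => ι)
  map_add' φ ψ := by ext; simp [MultilinearMap.alternatization_apply, Finset.sum_add_distrib]
  map_smul' c φ := by
    ext; simp [MultilinearMap.alternatization_apply, Finset.smul_sum, smul_comm c]

theorem altOn_apply {n : ℕ} (φ : Cochain k A M n) (y : Fin n → E) :
    altOn ι φ y = ∑ σ : Equiv.Perm (Fin n), Equiv.Perm.sign σ • φ fun p => ι (y (σ p)) := by
  simp [altOn, MultilinearMap.alternatization_apply]

theorem compAlternatingMap_altOn {n : ℕ} (F : M →ₗ[k] M') (φ : Cochain k A M n)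
    (y : Fin n → E) : F (altOn ι φ y) =
      ∑ σ : Equiv.Perm (Fin n), Equiv.Perm.sign σ • F (φ fun p => ι (y (σ p))) := by
  simp [altOn_apply, map_sum, map_zsmul_unit]

/-- Permutations are sorted by the image `i` of `0`. The representative used here sends `p.succ` to
`i.succAbove (τ p)`, which matches the removal of the `i`-th argument in the Koszul differential. -/
theorem sum_perm_succ {n : ℕ} {N : Type*} [AddCommGroup N] (F : Equiv.Perm (Fin (n + 1)) → N) :
    ∑ σ, F σ = ∑ i : Fin (n + 1), ∑ τ : Equiv.Perm (Fin n),
      F (i.cycleRange⁻¹ * Equiv.Perm.decomposeFin.symm (0, τ)) := by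
  refine Eq.trans ?_ (Fintype.sum_prod_type fun x : Fin (n + 1) × Equiv.Perm (Fin n) =>
    F (x.1.cycleRange⁻¹ * Equiv.Perm.decomposeFin.symm (0, x.2)))
  refine (Fintype.sum_bijective (fun x : Fin (n + 1) × Equiv.Perm (Fin n) =>
    x.1.cycleRange⁻¹ * Equiv.Perm.decomposeFin.symm (0, x.2)) ?_ _ _ fun _ => rfl).symm
  rw [Fintype.bijective_iff_injective_and_card]
  refine ⟨?_, by rw [Fintype.card_congr Equiv.Perm.decomposeFin]⟩
  rintro ⟨i, τ⟩ ⟨i', τ'⟩ h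
  have h0 := congrArg (fun σ : Equiv.Perm (Fin (n + 1)) => σ 0) h
  simp only [Equiv.Perm.coe_mul, Function.comp_apply, Equiv.Perm.decomposeFin_symm_apply_zero,
    Equiv.Perm.inv_def, Fin.cycleRange_symm_zero] at h0
  subst h0
  have := Equiv.Perm.decomposeFin.symm.injective (mul_left_cancel h)
  simp_all

theorem koszulD_altOn {n : ℕ} (T : E →ₗ[k] M →ₗ[k] M) (ψ : Cochain k A M n)
    (y : Fin (n + 1) → E) :
    Koszul.koszulD T (altOn ι ψ) y = ∑ σ : Equiv.Perm (Fin (n + 1)), Equiv.Perm.sign σ •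
      T (y (σ 0)) (ψ fun p => ι (y (σ p.succ))) := by
  rw [sum_perm_succ, Koszul.koszulD_apply]
  refine Finset.sum_congr rfl fun i _ => ?_
  rw [compAlternatingMap_altOn, Finset.smul_sum]
  refine Finset.sum_congr rfl fun τ _ => ?_
  have hs : Equiv.Perm.sign (i.cycleRange⁻¹ * Equiv.Perm.decomposeFin.symm (0, τ)) =
      (-1) ^ (i : ℕ) * Equiv.Perm.sign τ := by
    rw [map_mul, map_inv, Fin.sign_cycleRange, Equiv.Perm.decomposeFin.symm_sign]
    simp
  have hp : ∀ p : Fin n, (i.cycleRange⁻¹ * Equiv.Perm.decomposeFin.symm (0, τ)) p.succ =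
      i.succAbove (τ p) := by
    intro p
    simp [Equiv.Perm.inv_def]
  rw [hs, mul_smul]
  simp only [hp]
  simp [Equiv.Perm.inv_def, Fin.removeNth, Units.smul_def]

/-- The alternation is a morphism from the Hochschild complex to the Koszul complex. -/
theorem altOn_d {n : ℕ} (ψ : Cochain k A M n) :
    altOn ι (d k A M n ψ) = Koszul.koszulD (ad k A M ∘ₗ ι) (altOn ι ψ) := by
  ext y
  rw [koszulD_altOn, altOn_apply]
  simp only [d_apply, smul_add, Finset.sum_add_distrib, LinearMap.comp_apply, ad_apply, smul_sub,
    Finset.sum_sub_distrib]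
  -- Exchanging the two merged arguments reverses the sign of the permutation and, `A` being
  -- commutative, leaves the value unchanged; the inner faces cancel in pairs.
  have hinner : ∑ σ : Equiv.Perm (Fin (n + 1)), Equiv.Perm.sign σ • ∑ j : Fin n,
      (-1 : k) ^ ((j : ℕ) + 1) • ψ (Fin.contractNth j.castSucc (· * ·)
        fun p => ι (y (σ p))) = 0 := by
    simp only [Finset.smul_sum]
    rw [Finset.sum_comm]
    refine Finset.sum_eq_zero fun j _ => ?_
    refine Finset.sum_involution (fun σ _ => σ * Equiv.swap j.castSucc j.succ) ?_ ?_ ?_ ?_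
    · intro σ _
      have : Fin.contractNth j.castSucc (· * ·) (fun p => ι (y ((σ * Equiv.swap j.castSucc j.succ) p)))
          = Fin.contractNth j.castSucc (· * ·) (fun p => ι (y (σ p))) := by
        funext q
        rcases lt_trichotomy (q : ℕ) j with h | h | h
        · rw [Fin.contractNth_apply_of_lt _ _ _ _ h, Fin.contractNth_apply_of_lt _ _ _ _ h,
            Equiv.Perm.mul_apply, Equiv.swap_apply_of_ne_of_ne]
          · exact fun h' => by simp [Fin.ext_iff] at h'; omega
          · exact fun h' => by simp [Fin.ext_iff] at h'; omega
        · obtain rfl : q = j := Fin.ext h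
          rw [Fin.contractNth_apply_of_eq _ _ _ _ rfl, Fin.contractNth_apply_of_eq _ _ _ _ rfl,
            Equiv.Perm.mul_apply, Equiv.Perm.mul_apply, Equiv.swap_apply_left,
            Equiv.swap_apply_right, mul_comm]
        · rw [Fin.contractNth_apply_of_gt _ _ _ _ h, Fin.contractNth_apply_of_gt _ _ _ _ h,
            Equiv.Perm.mul_apply, Equiv.swap_apply_of_ne_of_ne]
          · exact fun h' => by simp [Fin.ext_iff] at h'; omega
          · exact fun h' => by simp [Fin.ext_iff] at h'; omega
      rw [this, map_mul, Equiv.Perm.sign_swap (Fin.castSucc_lt_succ).ne]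
      simp
    · intro σ _ _ h
      have h1 : Equiv.swap j.castSucc j.succ = 1 := mul_left_cancel (h.trans (mul_one σ).symm)
      exact (Fin.castSucc_lt_succ (i := j)).ne (Equiv.swap_eq_one_iff.1 h1)
    · intro σ _; simp
    · intro σ _; simp [mul_assoc]
  -- Rotating the arguments brings the last one to the front. The sign `(-1)^n` of the rotation and
  -- the factor `(-1)^(n+1)` of the last face combine to `-1`, so the two outer faces form a
  -- commutator.
  have hlast : ∑ σ : Equiv.Perm (Fin (n + 1)), Equiv.Perm.sign σ • (-1 : k) ^ (n + 1) •
      (op (ι (y (σ (Fin.last n)))) • ψ (Fin.init fun p => ι (y (σ p)))) =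
      -∑ σ : Equiv.Perm (Fin (n + 1)), Equiv.Perm.sign σ •
        (op (ι (y (σ 0))) • ψ fun p => ι (y (σ p.succ))) := by
    rw [← Finset.sum_neg_distrib]
    refine (Fintype.sum_equiv (Equiv.mulRight (finRotate (n + 1))) _ _ fun σ => ?_).symm
    have h1 : (σ * finRotate (n + 1)) (Fin.last n) = σ 0 := by simp
    have h2 : ∀ p : Fin n, (σ * finRotate (n + 1)) p.castSucc = σ p.succ := fun p => by
      rw [Equiv.Perm.mul_apply, finRotate_apply]
      simp
    simp only [Equiv.coe_mulRight, h1]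
    have h3 : (Fin.init fun p => ι (y ((σ * finRotate (n + 1)) p))) =
        fun p : Fin n => ι (y (σ p.succ)) := by
      funext p
      simp only [Fin.init, h2]
    rw [h3, map_mul, sign_finRotate, mul_smul]
    rcases Nat.even_or_odd n with hn | hn
    · simp [hn.neg_one_pow, pow_succ]
    · simp [hn.neg_one_pow, pow_succ]
  rw [hinner, hlast, add_zero, ← sub_eq_add_neg]
  rfl

end Alternation

end Hochschild

/-! ### Comparison of Hochschild and Koszul cohomology of a polynomial algebra. -/

namespace Hochschild

open MulOpposite Koszul

section Comparison

universe u v w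

/-- Data exhibiting `A` as the polynomial algebra on a basis of `E`. -/
structure PolyGenerators (k : Type v) (A : Type u) (E : Type w) [Field k] [CommRing A]
    [Algebra k A] [AddCommGroup E] [Module k E] (N : ℕ) where
  /-- the inclusion of the space of generators -/
  ι : E →ₗ[k] A
  /-- the generators -/
  gen : Fin N → E
  span_gen : Submodule.span k (Set.range gen) = ⊤
  /-- the monomials -/
  mon : Module.Basis (Fin N →₀ ℕ) k A
  mon_zero : mon 0 = 1
  mon_add : ∀ m i, mon (m + Finsupp.single i 1) = mon m * ι (gen i)

variable {k : Type v} {A : Type u} {E : Type w} [Field k] [CommRing A] [Algebra k A]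
  [AddCommGroup E] [Module k E] {N : ℕ} (P : PolyGenerators k A E N)

include P in
theorem PolyGenerators.eq_top (S : Submodule k A) (h1 : 1 ∈ S)
    (hmul : ∀ a ∈ S, ∀ y, a * P.ι y ∈ S) : S = ⊤ := by
  rw [eq_top_iff, ← P.mon.span_eq, Submodule.span_le]
  rintro _ ⟨m, rfl⟩
  refine Finsupp.induction m (by rw [P.mon_zero]; exact h1) fun i c f _ _ hf => ?_
  clear * - hmul hf
  induction c with
  | zero => simpa using hf
  | succ c ih =>
    rw [Finsupp.single_add, add_right_comm, P.mon_add]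
    exact hmul _ ih _

section Coinduced

variable {M : Type*} [AddCommGroup M] [Module k M] [Module A M] [Module Aᵐᵒᵖ M]
  [IsScalarTower k A M] [IsScalarTower k Aᵐᵒᵖ M]

theorem ad_coind_apply (a x : A) (f : Coind k A M) :
    ad k A (Coind k A M) a f x = f (x * a) - op a • f x := rfl

/-- On monomials the equation for `h` is the recurrence `h (m y_j) = h m · y_j + f m`. It is solved
along powers of `y_j`, starting from zero on the monomials free of `y_j`; the other generators `i <
j` pass through the solution because they commute with `f`. -/
theorem exists_ad_coind_eq (j : Fin N) (f : Coind k A M)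
    (hf : ∀ i < j, ad k A (Coind k A M) (P.ι (P.gen i)) f = 0) :
    ∃ h, (∀ i < j, ad k A (Coind k A M) (P.ι (P.gen i)) h = 0) ∧
      ad k A (Coind k A M) (P.ι (P.gen j)) h = f := by
  let y := fun i => P.ι (P.gen i)
  let h : Coind k A M := (Coind.toHom k A M).symm (P.mon.constr k fun m =>
    ∑ c ∈ Finset.range (m j), op (y j ^ c) • f (P.mon (m - Finsupp.single j (c + 1))))
  have hh : ∀ m, h (P.mon m) =
      ∑ c ∈ Finset.range (m j), op (y j ^ c) • f (P.mon (m - Finsupp.single j (c + 1))) :=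
    fun m => P.mon.constr_basis k _ m
  have hext : ∀ u w : Coind k A M, (∀ m, u (P.mon m) = w (P.mon m)) → u = w := fun u w huw =>
    P.mon.ext (f₁ := Coind.toHom k A M u) (f₂ := Coind.toHom k A M w) huw
  refine ⟨h, fun i hi => hext _ _ fun m => ?_, hext _ _ fun m => ?_⟩
  · rw [ad_coind_apply, ← P.mon_add, hh, hh, Coind.zero_apply, sub_eq_zero, Finset.smul_sum]
    have hij : i ≠ j := hi.ne
    refine Finset.sum_congr (by simp [hij]) fun c _ => ?_
    have : m + Finsupp.single i 1 - Finsupp.single j (c + 1) =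
        m - Finsupp.single j (c + 1) + Finsupp.single i 1 := by
      ext l
      by_cases hl : j = l
      · subst hl; simp [hij]
      · simp [Finsupp.single_apply, hl]
    have hfi := congrArg (fun u : Coind k A M => u (P.mon (m - Finsupp.single j (c + 1)))) (hf i hi)
    simp only [ad_coind_apply, Coind.zero_apply, sub_eq_zero] at hfi
    rw [this, P.mon_add, hfi, smul_smul, smul_smul, ← op_mul, ← op_mul, mul_comm]
  · rw [ad_coind_apply, ← P.mon_add, hh, hh, Finsupp.add_apply, Finsupp.single_eq_same,
      Finset.sum_range_succ', Finset.smul_sum]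
    have : ∀ c, m + Finsupp.single j 1 - Finsupp.single j (c + 1 + 1) =
        m - Finsupp.single j (c + 1) := fun c => by
      ext l
      by_cases hl : j = l
      · subst hl; simp
      · simp [hl]
    simp only [this, pow_succ (y j), op_mul, mul_smul]
    simp [y]

theorem exists_koszulD_coind_eq {n : ℕ} (α : E [⋀^Fin (n + 1)]→ₗ[k] Coind k A M)
    (hα : koszulD (ad k A (Coind k A M) ∘ₗ P.ι) α = 0) :
    ∃ β, koszulD (ad k A (Coind k A M) ∘ₗ P.ι) β = α :=
  exists_koszulD_eq _ (fun _ _ m => ad_ad _ _ m) P.gen P.span_gen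
    (fun j m hm => exists_ad_coind_eq P j m hm) α hα

end Coinduced

section Bimodule

variable {M : Type*} [AddCommGroup M] [Module k M] [Module A M] [Module Aᵐᵒᵖ M]
  [IsScalarTower k A M] [IsScalarTower k Aᵐᵒᵖ M] {M' : Type*} [AddCommGroup M'] [Module k M']
  [Module A M'] [Module Aᵐᵒᵖ M'] [IsScalarTower k A M'] [IsScalarTower k Aᵐᵒᵖ M']

theorem altOn_compMultilinearMap (ι : E →ₗ[k] A) (F : M →ₗ[k] M') {n : ℕ} (φ : Cochain k A M n) :
    altOn ι (F.compMultilinearMap φ) = F.compAlternatingMap (altOn ι φ) := by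
  ext y
  rw [LinearMap.compAlternatingMap_apply, compAlternatingMap_altOn, altOn_apply]
  rfl

theorem compAlternatingMap_koszulD_ad (ι : E →ₗ[k] A) (F : M →ₗ[k] M')
    (hl : ∀ (a : A) m, F (a • m) = a • F m) (hr : ∀ (a : A) m, F (op a • m) = op a • F m) {n : ℕ}
    (α : E [⋀^Fin n]→ₗ[k] M) : F.compAlternatingMap (koszulD (ad k A M ∘ₗ ι) α) =
      koszulD (ad k A M' ∘ₗ ι) (F.compAlternatingMap α) :=
  compAlternatingMap_koszulD _ _ F (fun y m => by simp [ad_apply, hl, hr]) α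

-- A cocycle of degree one is a derivation, so its zero set contains `1` and is stable under
-- multiplication by generators.
include P in
theorem eq_zero_of_derivation (φ : Cochain k A M 1) (hφ : d k A M 1 φ = 0)
    (h : ∀ y, φ (fun _ => P.ι y) = 0) : φ = 0 := by
  have hmul : ∀ a b, φ (fun _ => a * b) = a • φ (fun _ => b) + op b • φ (fun _ => a) := by
    intro a b
    have h1 := congrArg (fun f : Cochain k A M 2 => f ![a, b]) hφ
    simp only [d_apply, zero_apply] at h1
    have e1 : Fin.tail ![a, b] = fun _ => b := by funext i; fin_cases i; rfl
    have e2 : Fin.init ![a, b] = fun _ => a := by funext i; fin_cases i; rfl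
    have e3 : Fin.contractNth (Fin.castSucc (0 : Fin 1)) (· * ·) ![a, b] = fun _ => a * b := by
      funext i; fin_cases i; rfl
    simp only [Finset.univ_unique, Fin.default_eq_zero, Finset.sum_singleton, e1, e2, e3] at h1
    simp at h1
    rw [add_assoc, add_comm, add_assoc, neg_add_eq_zero] at h1
    rw [h1, add_comm]
  let S : Submodule k A :=
    { carrier := {a | φ (fun _ => a) = 0}
      add_mem' := fun {a b} ha hb => by
        have := φ.map_update_add (fun _ => 0) 0 a b
        have e : ∀ c : A, Function.update (fun _ : Fin 1 => (0 : A)) 0 c = fun _ => c := fun c => by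
          funext i; fin_cases i; rfl
        simp only [e] at this
        exact this.trans (by rw [ha, hb, add_zero])
      zero_mem' := φ.map_zero
      smul_mem' := fun c a ha => by
        have := φ.map_update_smul (fun _ => 0) 0 c a
        have e : ∀ c : A, Function.update (fun _ : Fin 1 => (0 : A)) 0 c = fun _ => c := fun c => by
          funext i; fin_cases i; rfl
        simp only [e] at this
        exact this.trans (by rw [ha, smul_zero]) }
  have hS : S = ⊤ := P.eq_top S (by
      have := hmul 1 1
      simpa [S] using this)
    (fun a ha y => by
      change φ _ = 0
      rw [hmul, h, show φ (fun _ => a) = 0 from ha, smul_zero, smul_zero, add_zero])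
  ext a
  have : a 0 ∈ S := hS ▸ Submodule.mem_top
  have ea : a = fun _ => a 0 := by funext i; fin_cases i; rfl
  rw [ea]
  exact this

include P in
theorem ad_eq_zero_of_generators [SMulCommClass A Aᵐᵒᵖ M] (m : M)
    (h : ∀ y, ad k A M (P.ι y) m = 0) (a : A) : ad k A M a m = 0 := by
  have hS : LinearMap.ker ((ad k A M).flip m) = ⊤ := P.eq_top _ (by simp [ad_apply])
    (fun a ha y => by
      simp only [LinearMap.mem_ker, LinearMap.flip_apply, ad_apply, sub_eq_zero] at ha h ⊢
      rw [mul_smul, h y, smul_comm, ha, op_mul, mul_smul])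
  exact LinearMap.congr_fun (LinearMap.ker_eq_top.1 hS) a

end Bimodule

/-- A Hochschild cocycle whose alternation is a Koszul coboundary is a coboundary. -/
theorem exists_d_eq (n : ℕ) : ∀ (M : Type u) [AddCommGroup M] [Module k M] [Module A M]
    [Module Aᵐᵒᵖ M] [IsScalarTower k A M] [IsScalarTower k Aᵐᵒᵖ M] [SMulCommClass A Aᵐᵒᵖ M]
    (φ : Cochain k A M (n + 1)) (_ : d k A M (n + 1) φ = 0) (β : E [⋀^Fin n]→ₗ[k] M)
    (_ : altOn P.ι φ = koszulD (ad k A M ∘ₗ P.ι) β), ∃ ψ, d k A M n ψ = φ := by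
  induction n with
  | zero =>
    intro M _ _ _ _ _ _ _ φ hφ β hβ
    let ψ : Cochain k A M 0 := MultilinearMap.constOfIsEmpty k _ (β default)
    refine ⟨ψ, (sub_eq_zero.1 ?_).symm⟩
    refine eq_zero_of_derivation P _ (by rw [map_sub, hφ, d_comp_d, sub_zero]) fun y => ?_
    have h := congrArg (fun f => f fun _ => y) hβ
    simp only [altOn_apply, koszulD_apply] at h
    simp at h
    rw [sub_apply, d_zero_apply _ _ default, h, sub_eq_zero]
    exact congrArg _ (congrArg β (Subsingleton.elim _ _))
  | succ n ih =>
    intro M _ _ _ _ _ _ _ φ hφ β hβ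
    -- Dimension shift: `φ` bounds `curry φ` in the coinduced bimodule, so its class is the image of
    -- the class of the projection of `curry φ`, one degree lower.
    have hcurry : d k A _ _ (curry φ) = (Coind.emb k A M).compMultilinearMap φ := by
      have := curry_d φ
      rw [hφ] at this
      have h0 : curry (0 : Cochain k A M (n + 1 + 1 + 1)) = 0 := by ext; rfl
      rw [h0] at this
      exact (sub_eq_zero.1 this.symm).symm
    -- The alternation of `curry φ` and the image of `β` have the same Koszul boundary; by
    -- acyclicity they differ by a boundary.
    obtain ⟨γ, hγ⟩ := exists_koszulD_coind_eq P
      (altOn P.ι (curry φ) - (Coind.emb k A M).compAlternatingMap β) (by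
        rw [map_sub, ← altOn_d, hcurry, altOn_compMultilinearMap, hβ,
          ← compAlternatingMap_koszulD_ad _ _ Coind.emb_smul Coind.emb_op_smul, sub_self])
    have hpe : ∀ {m : ℕ} (χ : Cochain k A M m), (CoindQuot.proj k A M).compMultilinearMap
        ((Coind.emb k A M).compMultilinearMap χ) = 0 := fun χ => by ext; simp
    obtain ⟨η, hη⟩ := ih (CoindQuot k A M) ((CoindQuot.proj k A M).compMultilinearMap (curry φ))
      (by rw [← compMultilinearMap_d _ CoindQuot.proj_smul CoindQuot.proj_op_smul, hcurry, hpe])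
      ((CoindQuot.proj k A M).compAlternatingMap γ) (by
        rw [← compAlternatingMap_koszulD_ad _ _ CoindQuot.proj_smul CoindQuot.proj_op_smul, hγ,
          altOn_compMultilinearMap]
        ext; simp)
    -- `incl` is not a bimodule map, but `proj ∘ incl = id` is enough: `θ` projects to zero, hence
    -- takes values in the copy of `M`, and its value at `1` is the desired primitive.
    let θ := curry φ - d k A _ _ ((CoindQuot.incl k A M).compMultilinearMap η)
    have hθ : (Coind.emb k A M).compMultilinearMap ((Coind.eval k A M 1).compMultilinearMap θ) =
        θ := by
      ext1 a
      refine CoindQuot.emb_eval_one_of_proj_eq_zero (f := θ a) ?_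
      have h1 := compMultilinearMap_d (CoindQuot.proj k A M) CoindQuot.proj_smul
        CoindQuot.proj_op_smul ((CoindQuot.incl k A M).compMultilinearMap η)
      have h2 : (CoindQuot.proj k A M).compMultilinearMap
          ((CoindQuot.incl k A M).compMultilinearMap η) = η := by ext1; simp
      rw [h2, hη] at h1
      have h3 := congrArg (fun f => f a) h1
      simp only [LinearMap.compMultilinearMap_apply] at h3
      simp only [θ, sub_apply, map_sub, h3, sub_self]
    refine ⟨(Coind.eval k A M 1).compMultilinearMap θ, ?_⟩
    have h4 : (Coind.emb k A M).compMultilinearMap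
        (d k A M (n + 1) ((Coind.eval k A M 1).compMultilinearMap θ)) =
        (Coind.emb k A M).compMultilinearMap φ := by
      rw [compMultilinearMap_d _ Coind.emb_smul Coind.emb_op_smul, hθ, map_sub, d_comp_d, hcurry,
        sub_zero]
    ext a
    simpa using congrArg (fun f => f a 1) h4

variable (k A) in
/-- Koszul coboundaries. -/
def koszulCoboundaries (ι : E →ₗ[k] A) (M : Type*) [AddCommGroup M] [Module k M] [Module A M]
    [Module Aᵐᵒᵖ M] [IsScalarTower k A M] [IsScalarTower k Aᵐᵒᵖ M] :
    (n : ℕ) → Submodule k (E [⋀^Fin n]→ₗ[k] M)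
  | 0 => ⊥
  | _ + 1 => LinearMap.range (koszulD (ad k A M ∘ₗ ι))

/-- Every Koszul cocycle is cohomologous to the alternation of a Hochschild cocycle. -/
theorem exists_altOn_sub_mem (n : ℕ) : ∀ (M : Type u) [AddCommGroup M] [Module k M] [Module A M]
    [Module Aᵐᵒᵖ M] [IsScalarTower k A M] [IsScalarTower k Aᵐᵒᵖ M] [SMulCommClass A Aᵐᵒᵖ M]
    (α : E [⋀^Fin n]→ₗ[k] M) (_ : koszulD (ad k A M ∘ₗ P.ι) α = 0),
    ∃ φ, d k A M n φ = 0 ∧ α - altOn P.ι φ ∈ koszulCoboundaries k A P.ι M n := by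
  induction n with
  | zero =>
    intro M _ _ _ _ _ _ _ α hα
    refine ⟨MultilinearMap.constOfIsEmpty k _ (α default), ?_, ?_⟩
    · ext a
      rw [d_zero_apply _ _ default]
      refine ad_eq_zero_of_generators P _ (fun y => ?_) _
      have h := congrArg (fun f => f fun _ => y) hα
      simp only [koszulD_apply] at h
      simp at h
      rw [Subsingleton.elim (Fin.tail _) default] at h
      exact h
    · change _ = _
      ext y
      simp [altOn_apply, Subsingleton.elim y default]
  | succ n ih =>
    intro M _ _ _ _ _ _ _ α hα
    -- The same shift for surjectivity: `α` becomes the boundary of `β`, and the projection of `β`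
    -- is a Koszul cocycle one degree lower, which induction compares with a Hochschild cocycle `ψ`.
    obtain ⟨β, hβ⟩ := exists_koszulD_coind_eq P ((Coind.emb k A M).compAlternatingMap α) (by
      rw [← compAlternatingMap_koszulD_ad _ _ Coind.emb_smul Coind.emb_op_smul, hα]
      ext; simp)
    obtain ⟨ψ, hψ, hδ⟩ := ih (CoindQuot k A M) ((CoindQuot.proj k A M).compAlternatingMap β) (by
      rw [← compAlternatingMap_koszulD_ad _ _ CoindQuot.proj_smul CoindQuot.proj_op_smul, hβ]
      ext; simp)
    -- The discrepancy in the quotient is a boundary there; lifting its primitive and taking the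
    -- boundary again gives a closed lift. In degree zero there is no discrepancy.
    obtain ⟨δ, hδ0, hδ1⟩ : ∃ δ : E [⋀^Fin n]→ₗ[k] Coind k A M,
        koszulD (ad k A (Coind k A M) ∘ₗ P.ι) δ = 0 ∧ (CoindQuot.proj k A M).compAlternatingMap δ =
          (CoindQuot.proj k A M).compAlternatingMap β - altOn P.ι ψ := by
      cases n with
      | zero => exact ⟨0, map_zero _, by rw [show _ = _ from hδ]; ext; simp⟩
      | succ n =>
        obtain ⟨γ, hγ⟩ := hδ
        refine ⟨koszulD _ ((CoindQuot.incl k A M).compAlternatingMap γ),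
          koszulD_koszulD _ (fun _ _ m => ad_ad _ _ m) _, ?_⟩
        rw [compAlternatingMap_koszulD_ad _ _ CoindQuot.proj_smul CoindQuot.proj_op_smul, ← hγ]
        congr 1
        ext1; simp
    let ψ' := (CoindQuot.incl k A M).compMultilinearMap ψ
    have hpψ : (CoindQuot.proj k A M).compMultilinearMap ψ' = ψ := by ext1; simp [ψ']
    have hdψ : (Coind.emb k A M).compMultilinearMap
        ((Coind.eval k A M 1).compMultilinearMap (d k A _ n ψ')) = d k A _ n ψ' := by
      ext1 a
      refine CoindQuot.emb_eval_one_of_proj_eq_zero (f := d k A _ n ψ' a) ?_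
      have h1 := compMultilinearMap_d (CoindQuot.proj k A M) CoindQuot.proj_smul
        CoindQuot.proj_op_smul ψ'
      rw [hpψ, hψ] at h1
      exact congrArg (fun f => f a) h1
    -- After both corrections `β` takes values in `M`, and its value at `1` is the primitive of `α`
    -- minus the alternation of the connecting cocycle.
    let ε := β - altOn P.ι ψ' - δ
    have hε : (Coind.emb k A M).compAlternatingMap ((Coind.eval k A M 1).compAlternatingMap ε) =
        ε := by
      ext1 y
      refine CoindQuot.emb_eval_one_of_proj_eq_zero (f := ε y) ?_
      have h1 := altOn_compMultilinearMap P.ι (CoindQuot.proj k A M) ψ'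
      rw [hpψ] at h1
      rw [h1] at hδ1
      have h2 := congrArg (fun f => f y) hδ1
      simp only [LinearMap.compAlternatingMap_apply, AlternatingMap.sub_apply] at h2
      simp only [ε, AlternatingMap.sub_apply, map_sub, h2, sub_self]
    refine ⟨(Coind.eval k A M 1).compMultilinearMap (d k A _ n ψ'), ?_,
      (Coind.eval k A M 1).compAlternatingMap ε, ?_⟩
    · have h : (Coind.emb k A M).compMultilinearMap (d k A M (n + 1)
          ((Coind.eval k A M 1).compMultilinearMap (d k A _ n ψ'))) = 0 := by
        rw [compMultilinearMap_d _ Coind.emb_smul Coind.emb_op_smul, hdψ, d_comp_d]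
      ext a
      simpa using congrArg (fun f => f a 1) h
    · have h : (Coind.emb k A M).compAlternatingMap (koszulD (ad k A M ∘ₗ P.ι)
          ((Coind.eval k A M 1).compAlternatingMap ε)) = (Coind.emb k A M).compAlternatingMap
          (α - altOn P.ι ((Coind.eval k A M 1).compMultilinearMap (d k A _ n ψ'))) := by
        have h1 : (Coind.emb k A M).compAlternatingMap
          (α - altOn P.ι ((Coind.eval k A M 1).compMultilinearMap (d k A _ n ψ'))) =
          (Coind.emb k A M).compAlternatingMap α - (Coind.emb k A M).compAlternatingMap
            (altOn P.ι ((Coind.eval k A M 1).compMultilinearMap (d k A _ n ψ'))) := by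
          ext; simp
        rw [compAlternatingMap_koszulD_ad _ _ Coind.emb_smul Coind.emb_op_smul, hε, h1,
          ← altOn_compMultilinearMap, hdψ, altOn_d, map_sub, map_sub, hβ, hδ0, sub_zero]
      ext y
      simpa using congrArg (fun f => f y 1) h

end Comparison

end Hochschild

/-! ### Elimination of one coordinate from a Koszul cocycle over a domain. -/

namespace Koszul

section Domain

variable {k E A A' : Type*} [Field k] [AddCommGroup E] [Module k E] [CommRing A] [IsDomain A]
  [Algebra k A] [CommRing A'] [IsDomain A'] [Algebra k A'] {n : ℕ}

variable (k A) in
/-- Multiplication operators `T y a = t y * a`. -/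
def mulOp (t : E →ₗ[k] A) : E →ₗ[k] A →ₗ[k] A := (LinearMap.mul k A) ∘ₗ t

@[simp] theorem mulOp_apply (t : E →ₗ[k] A) (y : E) (a : A) : mulOp k A t y a = t y * a := rfl

/-- Scalar operators `T y m = l y • m`; their Koszul differential is the wedge product
with `l`. -/
def scalOp (M : Type*) [AddCommGroup M] [Module k M] (l : E →ₗ[k] k) : E →ₗ[k] M →ₗ[k] M :=
  LinearMap.lsmul k M ∘ₗ l

@[simp] theorem scalOp_apply {M : Type*} [AddCommGroup M] [Module k M] (l : E →ₗ[k] k) (y : E)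
    (m : M) : scalOp M l y m = l y • m := rfl

theorem exists_linear_div (e : A) (he : e ≠ 0) (F : A →ₗ[k] A) (h : ∀ a, e ∣ F a) :
    ∃ S : A →ₗ[k] A, ∀ a, e * S a = F a := by
  choose S hS using h
  refine ⟨⟨⟨S, fun a b => ?_⟩, fun c a => ?_⟩, fun a => (hS a).symm⟩
  · apply mul_left_cancel₀ he
    rw [← hS, map_add, mul_add, ← hS, ← hS]
  · apply mul_left_cancel₀ he
    simp only [RingHom.id_apply]
    rw [← hS, map_smul, mul_smul_comm, ← hS]

/-- The homotopy is contraction with `y₀` followed by the divided difference `S a = (a - P a) / e`.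
It replaces the cocycle by a cohomologous one whose values lie in the image of `P`, that is, no
longer involve the coordinate `e`. -/
theorem exists_koszulD_mulOp_eq (P : A →ₐ[k] A) {e : A} (he : e ≠ 0) (hP : ∀ a, e ∣ a - P a)
    (hPe : P e = 0) (t : E →ₗ[k] A) (l : E →ₗ[k] k) (ht : ∀ y, t y - P (t y) = l y • e) {y₀ : E}
    {c : k} (hc : c ≠ 0) (hy₀ : t y₀ = c • e) (α : E [⋀^Fin (n + 1)]→ₗ[k] A)
    (hα : koszulD (mulOp k A t) α = 0) :
    ∃ γ, koszulD (mulOp k A t) γ = α -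
      c⁻¹ • koszulD (scalOp A l) (P.toLinearMap.compAlternatingMap (α.curryLeft y₀)) := by
  obtain ⟨S, hS⟩ := exists_linear_div e he (LinearMap.id - P.toLinearMap) (by simpa using hP)
  simp only [LinearMap.sub_apply, LinearMap.id_apply, AlgHom.toLinearMap_apply] at hS
  have hSe : ∀ a, S (e * a) = a := fun a => by
    apply mul_left_cancel₀ he
    rw [hS, map_mul, hPe, zero_mul, sub_zero]
  -- The twisted Leibniz rule of the divided difference; its defect `l y • P a` produces the
  -- remaining term of the homotopy formula.
  have hST : ∀ y a, t y * S a = S (t y * a) - l y • P a := by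
    intro y a
    apply mul_left_cancel₀ he
    rw [mul_sub, hS, mul_left_comm, hS, map_mul, mul_smul_comm, ← smul_mul_assoc, ← ht]
    ring
  have h1 := curryLeft_koszulD (mulOp k A t) α y₀
  rw [hα] at h1
  have h2 : ∀ v, t y₀ * α v = koszulD (mulOp k A t) (α.curryLeft y₀) v := fun v => by
    have := congrArg (fun f => f v) h1
    exact (sub_eq_zero.1 this.symm)
  refine ⟨c⁻¹ • S.compAlternatingMap (α.curryLeft y₀), ?_⟩
  ext v
  have h3 : koszulD (mulOp k A t) (S.compAlternatingMap (α.curryLeft y₀)) v =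
      S (koszulD (mulOp k A t) (α.curryLeft y₀) v) -
        koszulD (scalOp A l) (P.toLinearMap.compAlternatingMap (α.curryLeft y₀)) v := by
    simp only [koszulD_apply, LinearMap.compAlternatingMap_apply, mulOp_apply, hST, smul_sub,
      Finset.sum_sub_distrib, map_sum, map_zsmul, scalOp_apply, AlgHom.toLinearMap_apply]
  rw [map_smul, AlternatingMap.smul_apply, h3, ← h2, hy₀, smul_mul_assoc, map_smul, hSe,
    smul_sub, smul_smul, inv_mul_cancel₀ hc, one_smul]
  rfl

/-- After applying `P` every coefficient of the cocycle equation is a multiple of the same nonzero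
`e`, which cancels in a domain. -/
theorem koszulD_scalOp_comp_eq_zero (P : A →ₐ[k] A') {e : A'} (he : e ≠ 0) (t : E →ₗ[k] A)
    (l : E →ₗ[k] k) (ht : ∀ y, P (t y) = l y • e) (α : E [⋀^Fin n]→ₗ[k] A)
    (hα : koszulD (mulOp k A t) α = 0) :
    koszulD (scalOp A' l) (P.toLinearMap.compAlternatingMap α) = 0 := by
  ext v
  have h := congrArg (fun f => P (f v)) hα
  simp only [koszulD_apply, map_sum, map_zsmul, mulOp_apply, map_mul, ht, smul_mul_assoc,
    AlternatingMap.zero_apply, map_zero] at h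
  apply mul_left_cancel₀ he
  simpa [koszulD_apply, Finset.mul_sum, mul_left_comm] using h

end Domain

end Koszul

/-! ### Polynomial functions and restriction to coordinate subspaces. -/

namespace Symplectic

open Koszul Module

section PolyFun

variable {k V : Type*} [Field k] [AddCommGroup V] [Module k V]

@[simp] theorem pullback_ι {W : Type*} [AddCommGroup W] [Module k W] (f : V →ₗ[k] W)
    (y : Dual k W) : pullback f (SymmetricAlgebra.ι k _ y) = SymmetricAlgebra.ι k _ (y ∘ₗ f) := by
  simp [pullback]
  rfl

theorem pullback_id (a : PolyFun k V) : pullback LinearMap.id a = a := by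
  have : pullback (LinearMap.id : V →ₗ[k] V) = AlgHom.id k _ := by
    apply SymmetricAlgebra.algHom_ext
    ext x
    simp
  rw [this]
  rfl

theorem ι_ne_zero {y : Dual k V} (hy : y ≠ 0) : SymmetricAlgebra.ι k (Dual k V) y ≠ 0 := by
  obtain ⟨v, hv⟩ : ∃ v, y v ≠ 0 := by
    by_contra! h
    exact hy (LinearMap.ext h)
  intro h
  have := congrArg (SymmetricAlgebra.lift (LinearMap.applyₗ (R := k) (M₂ := k) v)) h
  rw [SymmetricAlgebra.lift_ι_apply, map_zero] at this
  exact hv this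

theorem ι_injective : Function.Injective (SymmetricAlgebra.ι k (Dual k V)) := by
  rw [injective_iff_map_eq_zero]
  intro y hy
  by_contra h
  exact ι_ne_zero h hy

variable (k) in
/-- A basis of `V` presents `k[V]` as a polynomial algebra. -/
def polyGenerators {N : ℕ} (b : Basis (Fin N) k V) :
    Hochschild.PolyGenerators k (PolyFun k V) (Dual k V) N where
  ι := SymmetricAlgebra.ι k (Dual k V)
  gen := b.dualBasis
  span_gen := b.dualBasis.span_eq
  mon := b.dualBasis.symmetricAlgebra
  mon_zero := by
    simp only [Basis.symmetricAlgebra, Basis.map_apply, MvPolynomial.coe_basisMonomials]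
    exact map_one (SymmetricAlgebra.equivMvPolynomial b.dualBasis).symm
  mon_add m i := by
    simp only [Basis.symmetricAlgebra, Basis.map_apply, MvPolynomial.coe_basisMonomials,
      AlgEquiv.toLinearEquiv_apply]
    rw [← SymmetricAlgebra.equivMvPolynomial_symm_X, ← map_mul, MvPolynomial.X,
      MvPolynomial.monomial_mul, mul_one]

/-- The projection of `V` killing the `l`-th vector of a basis. -/
def killCoord {ι : Type*} (b : Basis ι k V) (l : ι) : V →ₗ[k] V :=
  LinearMap.id - (b.coord l).smulRight (b l)

theorem killCoord_apply {ι : Type*} (b : Basis ι k V) (l : ι) (v : V) :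
    killCoord b l v = v - b.coord l v • b l := rfl

theorem comp_killCoord {ι : Type*} (b : Basis ι k V) (l : ι) (y : Dual k V) :
    y ∘ₗ killCoord b l = y - y (b l) • b.coord l := by
  ext v
  simp [killCoord_apply, mul_comm]

theorem dvd_sub_pullback_killCoord {ι : Type*} (b : Basis ι k V) (l : ι) (a : PolyFun k V) :
    SymmetricAlgebra.ι k _ (b.coord l) ∣ a - pullback (killCoord b l) a := by
  induction a using SymmetricAlgebra.induction with
  | algebraMap r => simp
  | ι y =>
    rw [pullback_ι, comp_killCoord, map_sub, sub_sub_cancel, map_smul]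
    exact ⟨algebraMap k _ (y (b l)), by rw [mul_comm, Algebra.smul_def]⟩
  | mul a a' ha hb =>
    rw [map_mul]
    have := dvd_add (ha.mul_right a') (hb.mul_left (pullback (killCoord b l) a))
    convert this using 1
    ring
  | add a b ha hb =>
    rw [map_add, add_sub_add_comm]
    exact dvd_add ha hb

/-- The composition of the projections killing the vectors of a basis with index in a list. -/
def killCoords {ι : Type*} (b : Basis ι k V) (L : List ι) : V →ₗ[k] V :=
  L.foldr (fun l q => killCoord b l ∘ₗ q) LinearMap.id

theorem coord_killCoords {ι : Type*} [DecidableEq ι] (b : Basis ι k V) (L : List ι) (v : V)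
    (i : ι) : b.coord i (killCoords b L v) = if i ∈ L then 0 else b.coord i v := by
  induction L with
  | nil => simp [killCoords]
  | cons l L ih =>
    have : killCoords b (l :: L) v = killCoord b l (killCoords b L v) := rfl
    rw [this, killCoord_apply, map_sub, ih, map_smul]
    by_cases h : i = l
    · subst h
      simp [ih]
    · simp [h]

/-- Koszul cocycles vanishing on the common zero locus of coordinates with nonzero weight are
coboundaries. -/
theorem mem_range_koszulD_of_killCoords {ι : Type*} {n : ℕ} (b : Basis ι k V) (c : ι → k)
    (t : Dual k V →ₗ[k] Dual k V) (ht : ∀ l, t (b.coord l) = c l • b.coord l)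
    (ht' : ∀ y l, t y (b l) = c l * y (b l)) (L : List ι)
    (hL : ∀ l ∈ L, c l ≠ 0) (α : Dual k V [⋀^Fin (n + 1)]→ₗ[k] PolyFun k V)
    (hα : koszulD (mulOp k _ (SymmetricAlgebra.ι k _ ∘ₗ t)) α = 0)
    (h0 : ∀ y, pullback (killCoords b L) (α y) = 0) :
    ∃ β, koszulD (mulOp k _ (SymmetricAlgebra.ι k _ ∘ₗ t)) β = α := by
  induction L generalizing α with
  | nil =>
    refine ⟨0, ?_⟩
    ext y
    simpa [killCoords, pullback_id, eq_comm] using h0 y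
  | cons l L ih =>
    have hl : b.coord l ≠ 0 := fun h => by simpa using congrArg (fun f => f (b l)) h
    have hcl := hL l (by simp)
    have hkc : ∀ y : Dual k V, y - y ∘ₗ killCoord b l = y (b l) • b.coord l := fun y => by
      rw [comp_killCoord, sub_sub_cancel]
    obtain ⟨γ, hγ⟩ := exists_koszulD_mulOp_eq (pullback (killCoord b l)) (ι_ne_zero hl)
      (dvd_sub_pullback_killCoord b l)
      (by rw [pullback_ι, comp_killCoord]; simp) (SymmetricAlgebra.ι k _ ∘ₗ t)
      (c l • LinearMap.applyₗ (b l)) (fun y => by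
        rw [LinearMap.comp_apply, pullback_ι, ← map_sub, hkc, map_smul, ht']; rfl)
      (y₀ := b.coord l) hcl (by rw [LinearMap.comp_apply, ht, map_smul]) α hα
    -- The values of `α'` are pulled back along `killCoord b l`, so killing the coordinates of `L`
    -- alone already makes them vanish and the induction hypothesis applies.
    set α' := (c l)⁻¹ • koszulD (scalOp (PolyFun k V) (c l • LinearMap.applyₗ (b l)))
      ((pullback (killCoord b l)).toLinearMap.compAlternatingMap (α.curryLeft (b.coord l))) with hα'
    obtain ⟨β, hβ⟩ := ih (fun l hl => hL l (List.mem_cons_of_mem _ hl)) α' (by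
        have := congrArg (koszulD (mulOp k _ (SymmetricAlgebra.ι k _ ∘ₗ t))) hγ
        rwa [koszulD_koszulD _ (fun y y' m => by simp [mul_left_comm]), map_sub, hα, zero_sub,
          eq_comm, neg_eq_zero] at this) (fun y => by
        have h1 : ∀ y, pullback (killCoords b L) (pullback (killCoord b l) (α y)) = 0 := fun y => by
          rw [← pullback_comp_apply]
          exact h0 y
        simp [hα', koszulD_apply, map_sum, h1, AlternatingMap.curryLeft_apply_apply])
    exact ⟨γ + β, by rw [map_add, hγ, hβ, sub_add_cancel]⟩

end PolyFun

end Symplectic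

/-! ### Eigenbases and the Koszul complex of `k[V]g`. -/

namespace Symplectic

open Koszul Module Hochschild MulOpposite

section Eigen

variable {k V G : Type*} [Field k] [AddCommGroup V] [Module k V] [Group G]
  (ρ : Representation k G V)

/-- A basis of eigenvectors of `ρ g`. -/
structure EigenBasis (g : G) (N : ℕ) where
  /-- the basis -/
  b : Basis (Fin N) k V
  /-- the eigenvalues -/
  μ : Fin N → k
  apply_b : ∀ l, ρ g (b l) = μ l • b l

/-- `ρ g` is a root of `X^m - 1` with `m` the order of `g`; this polynomial is separable because `m`
is invertible, so `ρ g` is diagonalizable. -/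
theorem nonempty_eigenBasis [IsAlgClosed k] [FiniteDimensional k V] (g : G)
    (hg : (orderOf g : k) ≠ 0) : Nonempty (EigenBasis ρ g (finrank k V)) := by
  classical
  have hss : Module.End.IsSemisimple (ρ g) := by
    refine Module.End.isSemisimple_of_squarefree_aeval_eq_zero
      (p := Polynomial.X ^ orderOf g - 1) ?_ ?_
    · exact (Polynomial.separable_X_pow_sub_C 1 hg one_ne_zero).squarefree
    · rw [map_sub, map_pow, Polynomial.aeval_X, map_one]
      change (ρ g) ^ orderOf g - 1 = 0
      rw [← map_pow, pow_orderOf_eq_one, map_one, sub_self]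
  let D := DirectSum.isInternal_submodule_of_iSupIndep_of_iSup_eq_top
    (Module.End.eigenspaces_iSupIndep (ρ g)) hss.iSup_eigenspace_eq_top
  let v := D.collectedBasis fun μ => finBasis k (Module.End.eigenspace (ρ g) μ)
  let e := v.indexEquiv (finBasis k V)
  exact ⟨⟨v.reindex e, fun l => (e.symm l).1, fun l => by
    rw [Basis.reindex_apply]
    exact Module.End.mem_eigenspace_iff.mp (D.collectedBasis_mem _ (e.symm l))⟩⟩

variable {ρ} {g : G} {N : ℕ} (B : EigenBasis ρ g N)

namespace EigenBasis

theorem μ_ne_zero (l : Fin N) : B.μ l ≠ 0 := fun h => by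
  have h1 := B.apply_b l
  rw [h, zero_smul] at h1
  have h2 : ρ g⁻¹ (ρ g (B.b l)) = B.b l := by
    rw [← Module.End.mul_apply, ← map_mul, inv_mul_cancel, map_one, Module.End.one_apply]
  rw [h1, map_zero] at h2
  exact B.b.ne_zero l h2.symm

theorem apply_inv_b (l : Fin N) : ρ g⁻¹ (B.b l) = (B.μ l)⁻¹ • B.b l := by
  have h2 : ρ g⁻¹ (ρ g (B.b l)) = B.b l := by
    rw [← Module.End.mul_apply, ← map_mul, inv_mul_cancel, map_one, Module.End.one_apply]
  rw [B.apply_b, map_smul] at h2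
  rw [eq_inv_smul_iff₀ (B.μ_ne_zero l), h2]

theorem coord_apply (l : Fin N) (v : V) : B.b.coord l (ρ g v) = B.μ l * B.b.coord l v := by
  have : B.b.coord l ∘ₗ ρ g = B.μ l • B.b.coord l := by
    refine B.b.ext fun i => ?_
    simp only [LinearMap.comp_apply, B.apply_b, map_smul, LinearMap.smul_apply, smul_eq_mul,
      Basis.coord_apply, Basis.repr_self, Finsupp.single_apply]
    split_ifs with h
    · rw [h]
    · simp
  exact LinearMap.congr_fun this v

theorem mem_fixedSpace {v : V} :
    v ∈ fixedSpace ρ g ↔ ∀ l, B.μ l ≠ 1 → B.b.coord l v = 0 := by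
  change ρ g v = v ↔ _
  constructor
  · intro h l hl
    have h1 := B.coord_apply l v
    rw [h] at h1
    have : (B.μ l - 1) * B.b.coord l v = 0 := by rw [sub_mul, ← h1]; ring
    exact (mul_eq_zero.1 this).resolve_left (sub_ne_zero.2 hl)
  · intro h
    refine B.b.ext_elem fun l => ?_
    have h1 := B.coord_apply l v
    rw [Basis.coord_apply, Basis.coord_apply] at h1
    by_cases hl : B.μ l = 1
    · rw [h1, hl, one_mul]
    · have := h l hl
      rw [Basis.coord_apply] at this
      rw [h1, this, mul_zero]

theorem b_mem_movingSpace {l : Fin N} (hl : B.μ l ≠ 1) : B.b l ∈ movingSpace ρ g :=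
  Submodule.mem_iSup_of_mem (B.μ l) <| Submodule.mem_iSup_of_mem hl <|
    Module.End.mem_eigenspace_iff.2 (B.apply_b l)

theorem mem_movingSpace {v : V} :
    v ∈ movingSpace ρ g ↔ ∀ l, B.μ l = 1 → B.b.coord l v = 0 := by
  constructor
  · intro hv l hl
    have : movingSpace ρ g ≤ LinearMap.ker (B.b.coord l) := by
      refine iSup₂_le fun c hc w hw => ?_
      rw [Module.End.mem_eigenspace_iff] at hw
      have h1 := B.coord_apply l w
      rw [hw, hl, one_mul, map_smul, smul_eq_mul] at h1
      have : (c - 1) * B.b.coord l w = 0 := by rw [sub_mul, h1]; ring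
      exact (mul_eq_zero.1 this).resolve_left (sub_ne_zero.2 hc)
    exact this hv
  · intro h
    rw [← B.b.sum_repr v]
    refine Submodule.sum_mem _ fun l _ => ?_
    by_cases hl : B.μ l = 1
    · have := h l hl
      rw [Basis.coord_apply] at this
      rw [this, zero_smul]
      exact zero_mem _
    · exact Submodule.smul_mem _ _ (B.b_mem_movingSpace hl)

/-- The weights of the operators `y - y^g` on the dual basis. -/
def weight (l : Fin N) : k := 1 - (B.μ l)⁻¹

theorem weight_ne_zero {l : Fin N} : B.weight l ≠ 0 ↔ B.μ l ≠ 1 := by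
  rw [weight, sub_ne_zero, ne_comm, Ne, Ne, inv_eq_one]

/-- The indices of the eigenvectors with eigenvalue different from `1`. -/
def moving : List (Fin N) := by
  classical exact (Finset.univ.filter fun l => B.μ l ≠ 1).toList

@[simp] theorem mem_moving {l : Fin N} : l ∈ B.moving ↔ B.μ l ≠ 1 := by
  simp [moving]

theorem killCoords_mem_fixedSpace (v : V) : killCoords B.b B.moving v ∈ fixedSpace ρ g := by
  classical
  rw [B.mem_fixedSpace]
  intro l hl
  rw [coord_killCoords, if_pos (B.mem_moving.2 hl)]

theorem killCoords_of_mem_fixedSpace {L : List (Fin N)} (hL : ∀ l ∈ L, B.μ l ≠ 1) {v : V}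
    (hv : v ∈ fixedSpace ρ g) : killCoords B.b L v = v := by
  classical
  refine B.b.ext_elem fun l => ?_
  have := coord_killCoords B.b L v l
  rw [Basis.coord_apply, Basis.coord_apply] at this
  rw [this]
  split_ifs with h
  · exact (B.mem_fixedSpace.1 hv l (hL l h)).symm
  · rfl

end EigenBasis

end Eigen

section Component

variable {k V G : Type*} [Field k] [AddCommGroup V] [Module k V] [Group G]
  (ρ : Representation k G V)

instance (g : G) : SMulCommClass (PolyFun k V) (PolyFun k V)ᵐᵒᵖ (Component ρ g) where
  smul_comm a b m := by
    apply (coeff ρ g).injective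
    induction b using MulOpposite.rec' with
    | h b => simp only [coeff_smul, coeff_op_smul, mul_assoc]

/-- The map `y ↦ y - y^g` on linear forms. -/
def subAct (g : G) : Dual k V →ₗ[k] Dual k V := LinearMap.id - (ρ g⁻¹).dualMap

@[simp] theorem subAct_apply (g : G) (y : Dual k V) (v : V) :
    subAct ρ g y v = y v - y (ρ g⁻¹ v) := rfl

theorem coeff_ad (g : G) (y : Dual k V) (m : Component ρ g) :
    coeff ρ g (ad k _ _ (SymmetricAlgebra.ι k _ y) m) =
      SymmetricAlgebra.ι k _ (subAct ρ g y) * coeff ρ g m := by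
  rw [ad_apply, map_sub, coeff_smul, coeff_op_smul, polyAct, pullback_ι, mul_comm _ (coeff ρ g m),
    ← mul_sub, ← map_sub, mul_comm]
  rfl

/-- The Koszul operators of the bimodule `k[V]g`, on coefficients. -/
abbrev koszulOp (g : G) : Dual k V →ₗ[k] PolyFun k V →ₗ[k] PolyFun k V :=
  mulOp k (PolyFun k V) (SymmetricAlgebra.ι k _ ∘ₗ subAct ρ g)

/-- The coefficients of the alternation of a cochain on linear forms. -/
def altCoeff (g : G) {n : ℕ} : Cochain k (PolyFun k V) (Component ρ g) n →ₗ[k]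
    Dual k V [⋀^Fin n]→ₗ[k] PolyFun k V :=
  LinearMap.compAlternatingMapₗ k (coeff ρ g).toLinearMap ∘ₗ
    altOn (SymmetricAlgebra.ι k _)

theorem altCoeff_apply (g : G) {n : ℕ} (φ : Cochain k (PolyFun k V) (Component ρ g) n)
    (y : Fin n → Dual k V) : altCoeff ρ g φ y = ∑ σ : Equiv.Perm (Fin n), Equiv.Perm.sign σ •
      coeff ρ g (φ fun p => SymmetricAlgebra.ι k _ (y (σ p))) :=
  compAlternatingMap_altOn (SymmetricAlgebra.ι k (Dual k V)) (coeff ρ g).toLinearMap φ y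

theorem compAlternatingMap_koszulD_coeff (g : G) {n : ℕ}
    (α : Dual k V [⋀^Fin n]→ₗ[k] Component ρ g) :
    (coeff ρ g).toLinearMap.compAlternatingMap
      (koszulD (ad k _ (Component ρ g) ∘ₗ SymmetricAlgebra.ι k _) α) =
      koszulD (koszulOp ρ g) ((coeff ρ g).toLinearMap.compAlternatingMap α) :=
  compAlternatingMap_koszulD _ _ _ (fun y m => coeff_ad ρ g y m) α

theorem altCoeff_d (g : G) {n : ℕ} (φ : Cochain k (PolyFun k V) (Component ρ g) n) :
    altCoeff ρ g (d k _ _ n φ) = koszulD (koszulOp ρ g) (altCoeff ρ g φ) := by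
  rw [altCoeff, LinearMap.comp_apply, altOn_d]
  exact compAlternatingMap_koszulD_coeff ρ g _

/-- `altEval` as an alternating map. -/
def altEvalMap (g : G) {n : ℕ} : Cochain k (PolyFun k V) (Component ρ g) n →ₗ[k]
    Dual k V [⋀^Fin n]→ₗ[k] PolyFun k (fixedSpace ρ g) :=
  LinearMap.compAlternatingMapₗ k (pullback (fixedSpace ρ g).subtype).toLinearMap ∘ₗ
    altCoeff ρ g

theorem altEvalMap_eq (g : G) {n : ℕ} (φ : Cochain k (PolyFun k V) (Component ρ g) n) :
    altEvalMap ρ g φ =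
      (pullback (fixedSpace ρ g).subtype).toLinearMap.compAlternatingMap (altCoeff ρ g φ) := rfl

theorem altEvalMap_apply (g : G) {n : ℕ} (φ : Cochain k (PolyFun k V) (Component ρ g) n)
    (y : Fin n → Dual k V) : altEvalMap ρ g φ y = altEval ρ g φ y := by
  have : altEvalMap ρ g φ y =
      ((pullback (fixedSpace ρ g).subtype).toLinearMap ∘ₗ (coeff ρ g).toLinearMap)
        (altOn (SymmetricAlgebra.ι k _) φ y) := rfl
  rw [this, compAlternatingMap_altOn]
  rfl

theorem pullback_subAct (g : G) (y : Dual k V) :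
    pullback (fixedSpace ρ g).subtype (SymmetricAlgebra.ι k _ (subAct ρ g y)) = 0 := by
  rw [pullback_ι]
  suffices h : subAct ρ g y ∘ₗ (fixedSpace ρ g).subtype = 0 by rw [h, map_zero]
  ext v
  have hv : ρ g (v : V) = v := v.2
  have h2 : ρ g⁻¹ (ρ g (v : V)) = v := by
    rw [← Module.End.mul_apply, ← map_mul, inv_mul_cancel, map_one, Module.End.one_apply]
  rw [hv] at h2
  simp [h2]

theorem pullback_koszulD (g : G) {n : ℕ} (α : Dual k V [⋀^Fin n]→ₗ[k] PolyFun k V) :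
    (pullback (fixedSpace ρ g).subtype).toLinearMap.compAlternatingMap
      (koszulD (koszulOp ρ g) α) = 0 := by
  ext y
  have h : ∀ y, pullback (fixedSpace ρ g).subtype
    ((SymmetricAlgebra.ι k (Dual k V)) ((subAct ρ g) y)) = 0 := pullback_subAct ρ g
  simp [koszulD_apply, map_sum, h]

theorem altEvalMap_eq_zero_of_mem_coboundaries (g : G) {n : ℕ}
    {φ : Cochain k (PolyFun k V) (Component ρ g) n} (hφ : φ ∈ coboundaries k _ _ n) :
    altEvalMap ρ g φ = 0 := by
  cases n with
  | zero =>
    rw [coboundaries, Submodule.mem_bot] at hφ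
    rw [hφ, map_zero]
  | succ n =>
    obtain ⟨ψ, rfl⟩ := hφ
    rw [altEvalMap_eq, altCoeff_d, pullback_koszulD]

theorem ad_comp_koszulD_eq_zero_iff (g : G) {n : ℕ} (α : Dual k V [⋀^Fin n]→ₗ[k] PolyFun k V) :
    koszulD (ad k _ (Component ρ g) ∘ₗ SymmetricAlgebra.ι k _)
      ((coeff ρ g).symm.toLinearMap.compAlternatingMap α) =
    (coeff ρ g).symm.toLinearMap.compAlternatingMap (koszulD (koszulOp ρ g) α) := by
  have h1 := compAlternatingMap_koszulD_coeff ρ g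
    ((coeff ρ g).symm.toLinearMap.compAlternatingMap α)
  have h2 : (coeff ρ g).toLinearMap.compAlternatingMap
    ((coeff ρ g).symm.toLinearMap.compAlternatingMap α) = α := by ext; simp
  rw [h2] at h1
  rw [← h1]
  ext y
  simp

variable {ρ} {g : G} {N : ℕ} (B : EigenBasis ρ g N)

theorem subAct_coord (l : Fin N) : subAct ρ g (B.b.coord l) = B.weight l • B.b.coord l := by
  refine B.b.ext fun i => ?_
  rw [subAct_apply, B.apply_inv_b, map_smul, EigenBasis.weight, LinearMap.smul_apply]
  simp only [Basis.coord_apply, Basis.repr_self, Finsupp.single_apply, smul_eq_mul]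
  split_ifs with h
  · rw [h]; ring
  · simp

theorem subAct_apply_b (y : Dual k V) (l : Fin N) :
    subAct ρ g y (B.b l) = B.weight l * y (B.b l) := by
  rw [subAct_apply, B.apply_inv_b, map_smul, EigenBasis.weight, smul_eq_mul]
  ring

-- Killing all moving coordinates factors through restriction to `V^g`, so the Koszul cocycle is a
-- coboundary by elimination of coordinates, and the comparison theorem transfers this to Hochschild
-- cochains.
include B in
theorem mem_coboundaries_of_altEvalMap_eq_zero {n : ℕ}
    {φ : Cochain k (PolyFun k V) (Component ρ g) n} (hφ : φ ∈ cocycles k _ _ n)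
    (h : altEvalMap ρ g φ = 0) : φ ∈ coboundaries k _ _ n := by
  have hcl : koszulD (koszulOp ρ g) (altCoeff ρ g φ) = 0 := by
    rw [← altCoeff_d, show d k _ _ n φ = 0 from hφ, map_zero]
  have hkill : ∀ y, pullback (killCoords B.b B.moving) (altCoeff ρ g φ y) = 0 := fun y => by
    have hq : killCoords B.b B.moving = (fixedSpace ρ g).subtype ∘ₗ
        (killCoords B.b B.moving).codRestrict (fixedSpace ρ g) B.killCoords_mem_fixedSpace := rfl
    rw [hq, pullback_comp_apply]
    have := congrArg (fun f => f y) h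
    rw [altEvalMap_eq] at this
    rw [show pullback (fixedSpace ρ g).subtype (altCoeff ρ g φ y) = 0 from this, map_zero]
  cases n with
  | zero =>
    rw [coboundaries, Submodule.mem_bot]
    have h0 : altCoeff ρ g φ default = 0 := by
      -- Without moving coordinates the restriction is the identity; otherwise a cocycle of degree
      -- zero is annihilated by a nonzero multiple of a coordinate.
      rcases hL : B.moving with _ | ⟨l, L⟩
      · have := hkill default
        rw [hL] at this
        simpa [killCoords, pullback_id] using this
      · have h1 := congrArg (fun f => f fun _ => B.b.coord l) hcl
        have hl : B.μ l ≠ 1 := B.mem_moving.1 (hL ▸ List.mem_cons_self)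
        simp only [koszulD_apply] at h1
        simp [subAct_coord, B.weight_ne_zero.2 hl] at h1
        rcases h1 with h1 | h1
        · exact absurd h1 (ι_ne_zero fun h => by simpa using congrArg (fun f => f (B.b l)) h)
        · rwa [Subsingleton.elim (Fin.tail _) default] at h1
    ext a
    apply (coeff ρ g).injective
    have h2 : altCoeff ρ g φ default = coeff ρ g (φ default) := by
      rw [altCoeff_apply, Fintype.sum_subsingleton _ 1, Equiv.Perm.sign_one, one_smul]
      exact congrArg _ (congrArg φ (Subsingleton.elim _ _))
    rw [Subsingleton.elim a default, ← h2, h0]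
    simp
  | succ n =>
    obtain ⟨β, hβ⟩ := mem_range_koszulD_of_killCoords B.b B.weight (subAct ρ g) (subAct_coord B)
      (fun y l => subAct_apply_b B y l) B.moving
      (fun l hl => B.weight_ne_zero.2 (B.mem_moving.1 hl)) _ hcl hkill
    refine exists_d_eq (polyGenerators k B.b) n (Component ρ g) φ hφ
      ((coeff ρ g).symm.toLinearMap.compAlternatingMap β) ?_
    change _ = koszulD (ad k _ (Component ρ g) ∘ₗ SymmetricAlgebra.ι k _) _
    rw [ad_comp_koszulD_eq_zero_iff, show koszulD (koszulOp ρ g) β = _ from hβ]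
    ext y
    simp [altCoeff]
    rfl

-- For a moving basis vector `b l`, kill the other moving coordinates. Every `y - y^g` then becomes
-- `y (b l)` times one nonzero multiple of the coordinate of `b l`, which can be cancelled before
-- restricting to `V^g`. This annihilation property forces the factor `s_g`.
include B in
theorem koszulD_scalOp_altEvalMap {n : ℕ} {φ : Cochain k (PolyFun k V) (Component ρ g) n}
    (hφ : φ ∈ cocycles k _ _ n) {v : V} (hv : v ∈ movingSpace ρ g) :
    koszulD (scalOp _ (LinearMap.applyₗ v)) (altEvalMap ρ g φ) = 0 := by
  classical
  have hcl : koszulD (koszulOp ρ g) (altCoeff ρ g φ) = 0 := by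
    rw [← altCoeff_d, show d k _ _ n φ = 0 from hφ, map_zero]
  have key : ∀ l, B.μ l ≠ 1 →
      koszulD (scalOp _ (LinearMap.applyₗ (B.b l))) (altEvalMap ρ g φ) = 0 := by
    intro l hl
    let L := B.moving.filter (· ≠ l)
    have hw := B.weight_ne_zero.2 hl
    have hL : ∀ m ∈ L, B.μ m ≠ 1 := fun m hm => B.mem_moving.1 (List.mem_of_mem_filter hm)
    have hne : B.b.coord l ≠ 0 := fun h => by simpa using congrArg (fun f => f (B.b l)) h
    have h1 := koszulD_scalOp_comp_eq_zero (pullback (killCoords B.b L)) (ι_ne_zero hne)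
      (SymmetricAlgebra.ι k _ ∘ₗ subAct ρ g) (B.weight l • LinearMap.applyₗ (B.b l)) (fun y => by
        rw [LinearMap.comp_apply, pullback_ι, ← map_smul]
        congr 1
        refine B.b.ext fun i => ?_
        have hi : killCoords B.b L (B.b i) = if i ∈ L then 0 else B.b i := by
          refine B.b.ext_elem fun j => ?_
          have := coord_killCoords B.b L (B.b i) j
          rw [Basis.coord_apply, Basis.coord_apply] at this
          rw [this]
          by_cases hij : i = j
          · subst hij; split_ifs <;> simp
          · split_ifs <;> simp [hij]
        rw [LinearMap.comp_apply, hi]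
        simp only [LinearMap.smul_apply, LinearMap.applyₗ_apply_apply, Basis.coord_apply,
          Basis.repr_self, Finsupp.single_apply, smul_eq_mul]
        split_ifs with h1 h2 h2
        · subst h2; simp [L] at h1
        · simp
        · subst h2; rw [subAct_apply_b]; simp
        · have : B.weight i = 0 := by
            by_contra h
            exact h1 (by simp [L, h2, B.weight_ne_zero.1 h])
          rw [subAct_apply_b, this]
          simp) _ hcl
    ext y
    have h2 := congrArg (fun f => pullback (fixedSpace ρ g).subtype (f y)) h1
    have h3 : ∀ a, pullback (fixedSpace ρ g).subtype (pullback (killCoords B.b L) a) =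
        pullback (fixedSpace ρ g).subtype a := fun a => by
      rw [← pullback_comp_apply]
      congr 2
      ext v
      exact B.killCoords_of_mem_fixedSpace hL v.2
    simp only [koszulD_apply, map_sum, map_zsmul, scalOp_apply, map_smul,
      LinearMap.compAlternatingMap_apply, AlgHom.toLinearMap_apply, h3, LinearMap.smul_apply,
      smul_assoc, AlternatingMap.zero_apply, map_zero] at h2
    simp only [smul_comm _ (B.weight l), ← Finset.smul_sum] at h2
    rw [koszulD_apply]
    exact (smul_eq_zero.1 h2).resolve_left hw
  rw [B.mem_movingSpace] at hv
  ext y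
  rw [← B.b.sum_repr v]
  have h4 : ∀ y : Dual k V, y (∑ i, B.b.repr v i • B.b i) = ∑ i, B.b.repr v i * y (B.b i) :=
    fun y => by simp only [map_sum, map_smul, smul_eq_mul]
  simp only [koszulD_apply, scalOp_apply, LinearMap.applyₗ_apply_apply, h4, Finset.sum_smul,
    mul_smul, Finset.smul_sum]
  rw [Finset.sum_comm]
  refine Finset.sum_eq_zero fun l _ => ?_
  simp only [smul_comm _ (B.b.repr v l), ← Finset.smul_sum]
  by_cases hl : B.μ l = 1
  · have := hv l hl
    rw [Basis.coord_apply] at this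
    rw [this, zero_smul]
  · have h5 := congrArg (fun f => f y) (key l hl)
    simp only [koszulD_apply, scalOp_apply, LinearMap.applyₗ_apply_apply] at h5
    rw [h5]
    simp

/-- A linear projection of polynomials onto linear forms extends `β` to a cochain; its alternation
repeats `β` once per permutation. -/
theorem exists_altOn_eq {n : ℕ} (hn : (n.factorial : k) ≠ 0)
    (β : Dual k V [⋀^Fin n]→ₗ[k] Component ρ g) :
    ∃ χ : Cochain k (PolyFun k V) (Component ρ g) n, altOn (SymmetricAlgebra.ι k _) χ = β := by
  obtain ⟨p, hp⟩ := (SymmetricAlgebra.ι k (Dual k V)).exists_leftInverse_of_injective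
    (LinearMap.ker_eq_bot.2 ι_injective)
  refine ⟨(n.factorial : k)⁻¹ • β.toMultilinearMap.compLinearMap fun _ => p, ?_⟩
  have hp' : ∀ y, p (SymmetricAlgebra.ι k (Dual k V) y) = y := LinearMap.congr_fun hp
  ext y
  rw [map_smul, AlternatingMap.smul_apply, altOn_apply]
  simp only [MultilinearMap.compLinearMap_apply, hp']
  have : ∀ σ : Equiv.Perm (Fin n), Equiv.Perm.sign σ • β.toMultilinearMap (fun p => y (σ p)) =
      β y := fun σ => by
    have := β.map_perm y σ
    rw [show β.toMultilinearMap (fun p => y (σ p)) = β (y ∘ σ) from rfl, this, smul_smul]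
    simp
  simp only [this]
  rw [Finset.sum_const, Finset.card_univ, Fintype.card_perm, Fintype.card_fin,
    ← Nat.cast_smul_eq_nsmul k, smul_smul, inv_mul_cancel₀ hn, one_smul]

theorem alternatingMap_eq_zero_of_finrank_lt [FiniteDimensional k V] {n : ℕ} {M : Type*}
    [AddCommGroup M] [Module k M] (hn : finrank k V < n) (β : Dual k V [⋀^Fin n]→ₗ[k] M) :
    β = 0 := by
  ext y
  refine β.map_linearDependent y fun h => ?_
  have := h.fintype_card_le_finrank
  rw [Fintype.card_fin, Subspace.dual_finrank_eq] at this
  omega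

/-- Every Koszul cocycle is the alternation of a Hochschild cocycle. -/
theorem exists_altCoeff_eq [FiniteDimensional k V]
    (hfac : ∀ m ≤ finrank k V, (m.factorial : k) ≠ 0) (B : EigenBasis ρ g (finrank k V)) {n : ℕ}
    (α : Dual k V [⋀^Fin n]→ₗ[k] PolyFun k V) (hα : koszulD (koszulOp ρ g) α = 0) :
    ∃ φ ∈ cocycles k (PolyFun k V) (Component ρ g) n, altCoeff ρ g φ = α := by
  have hcc : ∀ {m} (β : Dual k V [⋀^Fin m]→ₗ[k] PolyFun k V),
      (coeff ρ g).toLinearMap.compAlternatingMap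
        ((coeff ρ g).symm.toLinearMap.compAlternatingMap β) = β := fun β => by ext; simp
  obtain ⟨φ, hφ, hm⟩ := exists_altOn_sub_mem (polyGenerators k B.b) n (Component ρ g)
    ((coeff ρ g).symm.toLinearMap.compAlternatingMap α) (by
      refine (ad_comp_koszulD_eq_zero_iff ρ g α).trans ?_
      rw [hα]; ext; simp)
  suffices h : ∃ ψ : Cochain k (PolyFun k V) (Component ρ g) n, d k _ _ n ψ = 0 ∧
      altOn (SymmetricAlgebra.ι k _) ψ =
        (coeff ρ g).symm.toLinearMap.compAlternatingMap α - altOn (SymmetricAlgebra.ι k _) φ by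
    obtain ⟨ψ, hψ, hψ'⟩ := h
    refine ⟨φ + ψ, show d k _ _ n (φ + ψ) = 0 by rw [map_add, hφ, hψ, add_zero], ?_⟩
    rw [altCoeff, LinearMap.comp_apply, map_add, hψ', add_sub_cancel]
    exact hcc α
  cases n with
  | zero => exact ⟨0, map_zero _, by rw [map_zero]; exact hm.symm⟩
  | succ n =>
    obtain ⟨β, hβ⟩ := hm
    -- The error is the boundary of some `β`; writing `β` as an alternation of `χ`, the cochain `d
    -- χ` corrects it. Above the dimension of `V`, where the factorial may vanish in `k`, `β` itself
    -- is zero.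
    obtain ⟨χ, hχ⟩ : ∃ χ : Cochain k (PolyFun k V) (Component ρ g) n,
        altOn (SymmetricAlgebra.ι k _) χ = β := by
      by_cases hn : n ≤ finrank k V
      · exact exists_altOn_eq (hfac n hn) β
      · exact ⟨0, by rw [map_zero, alternatingMap_eq_zero_of_finrank_lt (by omega) β]⟩
    exact ⟨d k _ _ n χ, d_comp_d n _ χ, by rw [altOn_d, hχ]; exact hβ⟩

end Component

end Symplectic

/-! ### Multivectors as alternating maps on linear forms. -/

namespace Symplectic

open Koszul Module Hochschild MulOpposite

section EvalForms

variable {k V : Type*} [Field k] [AddCommGroup V] [Module k V]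

/-- The multilinear map `(y₁, …, yᵢ) ↦ y₁(u₁) ⋯ yᵢ(uᵢ)`. -/
def prodForms {i : ℕ} (u : Fin i → V) : MultilinearMap k (fun _ : Fin i => Dual k V) k :=
  (MultilinearMap.mkPiAlgebra k (Fin i) k).compLinearMap fun p => LinearMap.applyₗ (u p)

@[simp] theorem prodForms_apply {i : ℕ} (u : Fin i → V) (y : Fin i → Dual k V) :
    prodForms u y = ∏ p, y p (u p) := rfl

theorem pairForms_ιMulti {i : ℕ} (y : Fin i → Dual k V) (u : Fin i → V) :
    pairForms y (ExteriorAlgebra.ιMulti k i u) = MultilinearMap.alternatization (prodForms u) y := by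
  rw [pairForms, ExteriorAlgebra.liftAlternating_apply_ιMulti, Pi.single_eq_same,
    MultilinearMap.alternatization_apply]
  change Matrix.det (Matrix.of fun p q => y q (u p)) = _
  rw [← Matrix.det_transpose, Matrix.det_apply]
  rfl

theorem pairForms_ιMulti_of_ne {i n : ℕ} (h : n ≠ i) (y : Fin i → Dual k V) (u : Fin n → V) :
    pairForms y (ExteriorAlgebra.ιMulti k n u) = 0 := by
  rw [pairForms, ExteriorAlgebra.liftAlternating_apply_ιMulti, Pi.single_eq_of_ne h]
  rfl

theorem exteriorAlgebra_ext {N : Type*} [AddCommGroup N] [Module k N]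
    {f f' : ExteriorAlgebra k V →ₗ[k] N}
    (h : ∀ n (u : Fin n → V), f (ExteriorAlgebra.ιMulti k n u) = f' (ExteriorAlgebra.ιMulti k n u)) :
    f = f' :=
  ExteriorAlgebra.lhom_ext fun n => AlternatingMap.ext fun u => h n u

/-- The pairing with `y₁ ∧ … ∧ yᵢ`, as an alternating map of `y₁, …, yᵢ`. -/
def altForms (i : ℕ) (w : ExteriorAlgebra k V) : Dual k V [⋀^Fin i]→ₗ[k] k where
  toFun y := pairForms y w
  map_update_add' {inst} y p a b := by
    refine LinearMap.congr_fun (f := pairForms (Function.update y p (a + b)))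
      (g := pairForms (Function.update y p a) + pairForms (Function.update y p b))
      (exteriorAlgebra_ext fun n u => ?_) w
    rw [LinearMap.add_apply]
    by_cases h : n = i
    · subst h
      simp only [pairForms_ιMulti]
      exact AlternatingMap.map_update_add ..
    · simp [pairForms_ιMulti_of_ne h]
  map_update_smul' {inst} y p c a := by
    refine LinearMap.congr_fun (f := pairForms (Function.update y p (c • a)))
      (g := c • pairForms (Function.update y p a))
      (exteriorAlgebra_ext fun n u => ?_) w
    rw [LinearMap.smul_apply]
    by_cases h : n = i
    · subst h
      simp only [pairForms_ιMulti]
      exact AlternatingMap.map_update_smul ..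
    · simp [pairForms_ιMulti_of_ne h]
  map_eq_zero_of_eq' y p q hpq hne := by
    refine LinearMap.congr_fun (f := pairForms y) (g := 0)
      (exteriorAlgebra_ext fun n u => ?_) w
    by_cases h : n = i
    · subst h
      simp only [pairForms_ιMulti]
      exact AlternatingMap.map_eq_zero_of_eq _ _ hpq hne
    · simp [pairForms_ιMulti_of_ne h]

theorem altForms_apply {i : ℕ} (w : ExteriorAlgebra k V) (y : Fin i → Dual k V) :
    altForms i w y = pairForms y w := rfl

variable (B : Type*) [CommRing B] [Algebra k B]

/-- Multivectors with coefficients in `B` as alternating maps on linear forms. -/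
def evalForms (i : ℕ) : ExteriorAlgebra k V ⊗[k] B →ₗ[k] Dual k V [⋀^Fin i]→ₗ[k] B :=
  TensorProduct.lift <| LinearMap.mk₂ k
    (fun w f => (LinearMap.toSpanSingleton k B f).compAlternatingMap (altForms i w))
    (fun w w' f => by ext y; simp [altForms_apply, add_smul])
    (fun c w f => by ext y; simp [altForms_apply, mul_smul])
    (fun w f f' => by ext y; simp)
    (fun c w f => by ext y; simp [smul_comm c])

variable {B}

@[simp] theorem evalForms_tmul {i : ℕ} (w : ExteriorAlgebra k V) (f : B) (y : Fin i → Dual k V) :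
    evalForms B i (w ⊗ₜ f) y = pairForms y w • f := by
  simp [evalForms, altForms_apply]

theorem evalForms_apply {i : ℕ} (z : ExteriorAlgebra k V ⊗[k] B) (y : Fin i → Dual k V) :
    evalForms B i z y = TensorProduct.lid k B (LinearMap.rTensor B (pairForms y) z) := by
  induction z with
  | zero => simp
  | tmul w f => simp
  | add a b ha hb => simp [map_add, ha, hb]

/-- Coefficient extension commutes with evaluation. -/
theorem compAlternatingMap_evalForms {B' : Type*} [CommRing B'] [Algebra k B'] (f : B →ₐ[k] B')
    {i : ℕ} (z : ExteriorAlgebra k V ⊗[k] B) :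
    f.toLinearMap.compAlternatingMap (evalForms B i z) =
      evalForms B' i (LinearMap.lTensor _ f.toLinearMap z) := by
  induction z with
  | zero => ext; simp
  | tmul w a => ext y; simp
  | add a b ha hb => rw [map_add, map_add, map_add, ← ha, ← hb]; ext y; simp

/-- Multiplication by a vector from the left. -/
def wedgeLeft (v : V) : ExteriorAlgebra k V →ₗ[k] ExteriorAlgebra k V :=
  LinearMap.mulLeft k (ExteriorAlgebra.ι k v)

@[simp] theorem wedgeLeft_apply (v : V) (w : ExteriorAlgebra k V) :
    wedgeLeft v w = ExteriorAlgebra.ι k v * w := rfl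

/-- Laplace expansion of the determinant along the row of `v`. -/
theorem pairForms_ι_mul {i : ℕ} (v : V) (y : Fin (i + 1) → Dual k V) (w : ExteriorAlgebra k V) :
    pairForms y (ExteriorAlgebra.ι k v * w) =
      ∑ j : Fin (i + 1), (-1) ^ (j : ℕ) * y j v * pairForms (j.removeNth y) w := by
  suffices h : pairForms y ∘ₗ wedgeLeft v =
      ∑ j : Fin (i + 1), ((-1) ^ (j : ℕ) * y j v) • pairForms (j.removeNth y) by
    have := LinearMap.congr_fun h w
    simpa using this
  refine exteriorAlgebra_ext fun n u => ?_
  have hn : ExteriorAlgebra.ι k v * ExteriorAlgebra.ιMulti k n u =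
      ExteriorAlgebra.ιMulti k (n + 1) (Matrix.vecCons v u) := by
    rw [ExteriorAlgebra.ιMulti_succ_apply]; rfl
  rw [LinearMap.comp_apply, wedgeLeft_apply, hn]
  simp only [LinearMap.sum_apply, LinearMap.smul_apply]
  by_cases h : n = i
  · subst h
    rw [pairForms, ExteriorAlgebra.liftAlternating_apply_ιMulti, Pi.single_eq_same]
    refine (Matrix.det_succ_row_zero (fun p q => y q (Matrix.vecCons v u p))).trans
      (Finset.sum_congr rfl fun j _ => ?_)
    rw [pairForms, ExteriorAlgebra.liftAlternating_apply_ιMulti, Pi.single_eq_same]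
    rfl
  · rw [pairForms_ιMulti_of_ne (by omega)]
    simp [pairForms_ιMulti_of_ne h]

/-- This identity translates the annihilation of a restricted cocycle by moving vectors into the
vanishing of wedge products, where divisibility in the exterior algebra applies. -/
theorem koszulD_evalForms {i : ℕ} (v : V) (z : ExteriorAlgebra k V ⊗[k] B) :
    koszulD (scalOp B (LinearMap.applyₗ v)) (evalForms B i z) =
      evalForms B (i + 1) (LinearMap.rTensor B (wedgeLeft v) z) := by
  induction z with
  | zero => simp
  | tmul w f =>
    ext y
    rw [koszulD_apply, LinearMap.rTensor_tmul, evalForms_tmul, wedgeLeft_apply, pairForms_ι_mul,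
      Finset.sum_smul]
    refine Finset.sum_congr rfl fun j _ => ?_
    rw [scalOp_apply, evalForms_tmul, mul_smul, mul_smul, LinearMap.applyₗ_apply_apply]
    rcases neg_one_pow_eq_or ℤ (j : ℕ) with h | h <;>
    rcases Nat.even_or_odd (j : ℕ) with h' | h' <;> simp [h'.neg_one_pow]
  | add a b ha hb => simp only [map_add, ha, hb]

/-- The wedge product of alternating maps. -/
def altWedge {i j : ℕ} (α : Dual k V [⋀^Fin i]→ₗ[k] B) (β : Dual k V [⋀^Fin j]→ₗ[k] B) :
    Dual k V [⋀^Fin (i + j)]→ₗ[k] B :=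
  ((LinearMap.mul' k B).compAlternatingMap (α.domCoprod β)).domDomCongr finSumFinEquiv

/-- The product of multilinear maps. -/
def mulMultilinear {i j : ℕ} (a : MultilinearMap k (fun _ : Fin i => Dual k V) B)
    (b : MultilinearMap k (fun _ : Fin j => Dual k V) B) :
    MultilinearMap k (fun _ : Fin (i + j) => Dual k V) B :=
  ((LinearMap.mul' k B).compMultilinearMap (a.domCoprod b)).domDomCongr finSumFinEquiv

theorem mulMultilinear_apply {i j : ℕ} (a : MultilinearMap k (fun _ : Fin i => Dual k V) B)
    (b : MultilinearMap k (fun _ : Fin j => Dual k V) B) (y : Fin (i + j) → Dual k V) :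
    mulMultilinear a b y = a (fun p => y (Fin.castAdd j p)) * b (fun q => y (Fin.natAdd i q)) := by
  simp [mulMultilinear, MultilinearMap.domCoprod]

/-- `altWedge` is a sum over shuffles, so the alternation, which is an unnormalized sum over all
permutations, is multiplicative without factorials. -/
theorem alternatization_mulMultilinear {i j : ℕ}
    (a : MultilinearMap k (fun _ : Fin i => Dual k V) B)
    (b : MultilinearMap k (fun _ : Fin j => Dual k V) B) :
    MultilinearMap.alternatization (mulMultilinear a b) =
      altWedge (MultilinearMap.alternatization a) (MultilinearMap.alternatization b) := by
  rw [altWedge, ← MultilinearMap.domCoprod_alternization]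
  ext y
  simp only [MultilinearMap.alternatization_apply, AlternatingMap.domDomCongr_apply,
    LinearMap.compAlternatingMap_apply, map_sum, MultilinearMap.domDomCongr_apply]
  refine (Fintype.sum_equiv finSumFinEquiv.permCongr _ _ fun σ => ?_).symm
  rw [Equiv.Perm.sign_permCongr, map_zsmul_unit]
  congr 1
  simp [mulMultilinear, Equiv.permCongr_apply]

theorem altWedge_add_left {i j : ℕ} (α α' : Dual k V [⋀^Fin i]→ₗ[k] B)
    (β : Dual k V [⋀^Fin j]→ₗ[k] B) : altWedge (α + α') β = altWedge α β + altWedge α' β := by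
  ext y
  simp only [altWedge, AlternatingMap.domDomCongr_apply, LinearMap.compAlternatingMap_apply,
    ← AlternatingMap.domCoprod'_apply, TensorProduct.add_tmul, map_add, AlternatingMap.add_apply]

theorem altWedge_add_right {i j : ℕ} (α : Dual k V [⋀^Fin i]→ₗ[k] B)
    (β β' : Dual k V [⋀^Fin j]→ₗ[k] B) : altWedge α (β + β') = altWedge α β + altWedge α β' := by
  ext y
  simp only [altWedge, AlternatingMap.domDomCongr_apply, LinearMap.compAlternatingMap_apply,
    ← AlternatingMap.domCoprod'_apply, TensorProduct.tmul_add, map_add, AlternatingMap.add_apply]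

theorem compAlternatingMap_altWedge {B' : Type*} [CommRing B'] [Algebra k B'] (f : B →ₐ[k] B')
    {i j : ℕ} (α : Dual k V [⋀^Fin i]→ₗ[k] B) (β : Dual k V [⋀^Fin j]→ₗ[k] B) :
    f.toLinearMap.compAlternatingMap (altWedge α β) =
      altWedge (f.toLinearMap.compAlternatingMap α) (f.toLinearMap.compAlternatingMap β) := by
  have h : (LinearMap.mul' k B').comp (TensorProduct.map f.toLinearMap f.toLinearMap) =
      f.toLinearMap ∘ₗ LinearMap.mul' k B := by ext; simp
  ext y
  simp only [altWedge, LinearMap.compAlternatingMap_apply, AlternatingMap.domDomCongr_apply]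
  rw [← LinearMap.comp_apply, ← h, LinearMap.comp_apply]
  congr 1
  simp only [AlternatingMap.domCoprod_apply, sum_apply, map_sum]
  refine Finset.sum_congr rfl fun σ _ => ?_
  induction σ using Quotient.inductionOn' with
  | h σ =>
    simp [AlternatingMap.domCoprod.summand_mk'']

theorem alternatingMap_sum_apply {ι κ E M : Type*} [AddCommGroup E] [Module k E]
    [AddCommGroup M] [Module k M] (s : Finset κ) (α : κ → E [⋀^ι]→ₗ[k] M) (y : ι → E) :
    (∑ t ∈ s, α t) y = ∑ t ∈ s, α t y :=
  map_sum (⟨⟨fun f => f y, rfl⟩, fun _ _ => rfl⟩ : (E [⋀^ι]→ₗ[k] M) →+ M) α s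

/-- `prodForms` with a coefficient. -/
theorem evalForms_ιMulti_tmul {i : ℕ} (u : Fin i → V) (f : B) :
    evalForms B i (ExteriorAlgebra.ιMulti k i u ⊗ₜ f) =
      MultilinearMap.alternatization
        ((LinearMap.toSpanSingleton k B f).compMultilinearMap (prodForms u)) := by
  ext y
  rw [evalForms_tmul, pairForms_ιMulti, MultilinearMap.alternatization_apply,
    MultilinearMap.alternatization_apply, Finset.sum_smul]
  refine Finset.sum_congr rfl fun σ _ => ?_
  simp [smul_assoc]

variable (B) in
/-- Multivectors of degree `n` with coefficients in `B`. -/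
def gradedPart (V : Type*) [AddCommGroup V] [Module k V] (n : ℤ) :
    Submodule k (ExteriorAlgebra k V ⊗[k] B) :=
  LinearMap.range (LinearMap.rTensor B (extPow k V n).subtype)

theorem extPow_natCast (n : ℕ) : extPow k V n = ⋀[k]^n V := by simp [extPow]

theorem extPow_of_neg {n : ℤ} (h : n < 0) : extPow k V n = ⊥ := by simp [extPow, h.not_ge]

theorem tmul_mem_gradedPart {n : ℤ} {w : ExteriorAlgebra k V} (hw : w ∈ extPow k V n) (f : B) :
    w ⊗ₜ f ∈ gradedPart B V n := ⟨⟨w, hw⟩ ⊗ₜ f, by simp⟩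

theorem ιMulti_mem_extPow {n : ℕ} (u : Fin n → V) : ExteriorAlgebra.ιMulti k n u ∈ extPow k V n := by
  rw [extPow_natCast]
  exact ExteriorAlgebra.ιMulti_range k n ⟨u, rfl⟩

theorem gradedPart_induction {n : ℕ} {p : ExteriorAlgebra k V ⊗[k] B → Prop}
    (h0 : p 0) (ha : ∀ a b, p a → p b → p (a + b))
    (h : ∀ (u : Fin n → V) f, p (ExteriorAlgebra.ιMulti k n u ⊗ₜ f)) {z}
    (hz : z ∈ gradedPart B V n) : p z := by
  obtain ⟨z, rfl⟩ := hz
  induction z with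
  | zero => simpa using h0
  | add a b hha hhb => rw [map_add]; exact ha _ _ hha hhb
  | tmul w f =>
    rw [LinearMap.rTensor_tmul, Submodule.subtype_apply]
    have hw := w.2
    generalize (w : ExteriorAlgebra k V) = w at hw ⊢
    rw [extPow_natCast, ← ExteriorAlgebra.ιMulti_span_fixedDegree] at hw
    induction hw using Submodule.span_induction generalizing f with
    | mem x hx =>
      obtain ⟨u, rfl⟩ := hx
      exact h u f
    | zero => simpa using h0
    | add x y _ _ hx hy => rw [TensorProduct.add_tmul]; exact ha _ _ (hx f) (hy f)
    | smul c x _ hx => rw [TensorProduct.smul_tmul]; exact hx _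

/-- The evaluation of a wedge product of multivectors. -/
theorem evalForms_mul {i j : ℕ} {z z' : ExteriorAlgebra k V ⊗[k] B} (hz : z ∈ gradedPart B V i)
    (hz' : z' ∈ gradedPart B V j) :
    evalForms B (i + j) (z * z') = altWedge (evalForms B i z) (evalForms B j z') := by
  have h0l : ∀ β : Dual k V [⋀^Fin j]→ₗ[k] B,
      altWedge (0 : Dual k V [⋀^Fin i]→ₗ[k] B) β = 0 := fun β => by
    have := altWedge_add_left (i := i) 0 0 β
    rwa [add_zero, left_eq_add] at this
  have h0r : ∀ α : Dual k V [⋀^Fin i]→ₗ[k] B,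
      altWedge α (0 : Dual k V [⋀^Fin j]→ₗ[k] B) = 0 := fun β => by
    have := altWedge_add_right (j := j) β 0 0
    rwa [add_zero, left_eq_add] at this
  refine gradedPart_induction
    (p := fun z => evalForms B (i + j) (z * z') = altWedge (evalForms B i z) (evalForms B j z'))
    (by simp [h0l])
    (fun a b ha hb => by rw [add_mul, map_add, ha, hb, map_add, altWedge_add_left]) ?_ hz
  intro u f
  refine gradedPart_induction (p := fun z' => evalForms B (i + j) (_ * z') =
      altWedge (evalForms B i _) (evalForms B j z')) (by simp [h0r])
    (fun a b ha hb => by rw [mul_add, map_add, ha, hb, map_add, altWedge_add_right]) ?_ hz'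
  intro u' f'
  rw [Algebra.TensorProduct.tmul_mul_tmul, ExteriorAlgebra.ιMulti_mul_ιMulti,
    evalForms_ιMulti_tmul, evalForms_ιMulti_tmul, evalForms_ιMulti_tmul,
    ← alternatization_mulMultilinear]
  congr 1
  ext y
  rw [mulMultilinear_apply]
  simp only [LinearMap.compMultilinearMap_apply, prodForms_apply, LinearMap.toSpanSingleton_apply,
    Fin.prod_univ_add, Fin.append_left, Fin.append_right]
  rw [smul_mul_smul_comm]

/-- Evaluation on increasing families of dual basis vectors reads off the coefficients in the basis
of the exterior power; no factorial has to be invertible. -/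
theorem evalForms_injOn {N : ℕ} (b : Basis (Fin N) k V) {n : ℤ} {i : ℕ} (hn : n = i)
    {z : ExteriorAlgebra k V ⊗[k] B} (hz : z ∈ gradedPart B V n) (h : evalForms B i z = 0) :
    z = 0 := by
  subst hn
  obtain ⟨z, rfl⟩ := hz
  have key : ∀ z : (⋀[k]^i V) ⊗[k] B,
      evalForms B i (LinearMap.rTensor B (⋀[k]^i V).subtype z) = 0 → z = 0 := by
    intro z hz
    obtain ⟨c, rfl⟩ := TensorProduct.eq_repr_basis_left (b.exteriorPower i) z
    suffices hc : c = 0 by simp [hc]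
    ext S
    have h1 := congrArg
      (fun f => f fun j => b.coord (Set.powersetCard.ofFinEmbEquiv.symm S j)) hz
    simp only [Finsupp.sum, map_sum, alternatingMap_sum_apply, LinearMap.rTensor_tmul,
      evalForms_tmul, Submodule.subtype_apply, AlternatingMap.zero_apply] at h1
    have h2 : ∀ T, pairForms (fun j => b.coord (Set.powersetCard.ofFinEmbEquiv.symm S j))
        ((b.exteriorPower i T : ⋀[k]^i V) : ExteriorAlgebra k V) = if T = S then 1 else 0 := by
      intro T
      have h3 : pairForms (fun j => b.coord (Set.powersetCard.ofFinEmbEquiv.symm S j)) ∘ₗ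
          (⋀[k]^i V).subtype = exteriorPower.ιMultiDual k i b S := by
        apply exteriorPower.linearMap_ext
        ext u
        simp only [LinearMap.compAlternatingMap_apply, LinearMap.comp_apply,
          Submodule.subtype_apply, exteriorPower.ιMulti_apply_coe,
          exteriorPower.ιMultiDual_apply_ιMulti]
        rw [pairForms, ExteriorAlgebra.liftAlternating_apply_ιMulti, Pi.single_eq_same]
        rfl
      refine (LinearMap.congr_fun h3 (b.exteriorPower i T)).trans ?_
      rw [exteriorPower.basis_apply]
      split_ifs with hTS
      · subst hTS; exact exteriorPower.ιMultiDual_apply_diag k i b _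
      · exact exteriorPower.ιMultiDual_apply_nondiag k i b _ _ (Ne.symm hTS)
    simp only [h2, ite_smul, one_smul, zero_smul] at h1
    rw [Finset.sum_ite_eq'] at h1
    by_contra hS
    rw [if_pos (Finsupp.mem_support_iff.2 hS)] at h1
    exact hS h1
  have e : ∀ (W : Submodule k (ExteriorAlgebra k V)) (hW : W = ⋀[k]^i V) (z : W ⊗[k] B),
      evalForms B i (LinearMap.rTensor B W.subtype z) = 0 → z = 0 := by
    rintro W rfl; exact key
  rw [e _ (extPow_natCast i) z h, map_zero]

theorem exists_evalForms_eq {N : ℕ} (b : Basis (Fin N) k V) {i : ℕ}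
    (hi : N < i ∨ (i.factorial : k) ≠ 0) (α : Dual k V [⋀^Fin i]→ₗ[k] B) :
    ∃ z ∈ gradedPart B V i, evalForms B i z = α := by
  rcases hi with hi | hi
  · have := Module.Finite.of_basis b
    refine ⟨0, zero_mem _, ?_⟩
    rw [map_zero, alternatingMap_eq_zero_of_finrank_lt _ α]
    rwa [finrank_eq_card_basis b, Fintype.card_fin]
  -- The expansion of `α` over all index families, not only increasing ones, counts each multivector
  -- `i!` times.
  · refine ⟨(i.factorial : k)⁻¹ • ∑ t : Fin i → Fin N,
      ExteriorAlgebra.ιMulti k i (b ∘ t) ⊗ₜ α (b.coord ∘ t),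
      Submodule.smul_mem _ _ (Submodule.sum_mem _ fun t _ =>
        tmul_mem_gradedPart (ιMulti_mem_extPow _) _), ?_⟩
    ext y
    rw [map_smul, map_sum, AlternatingMap.smul_apply, alternatingMap_sum_apply]
    simp only [evalForms_tmul, pairForms_ιMulti, MultilinearMap.alternatization_apply,
      MultilinearMap.domDomCongr_apply, prodForms_apply, Finset.sum_smul]
    rw [Finset.sum_comm]
    have : ∀ σ : Equiv.Perm (Fin i), (∑ t : Fin i → Fin N, (Equiv.Perm.sign σ •
        ∏ p, y (σ p) ((b ∘ t) p)) • α (b.coord ∘ t)) = α y := by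
      intro σ
      have hy : (y ∘ σ) = fun p => ∑ l, y (σ p) (b l) • b.coord l := by
        funext p
        refine b.ext fun m => ?_
        simp
      have h1 := α.map_perm y σ
      rw [hy] at h1
      have h2 := α.toMultilinearMap.map_sum fun p l => y (σ p) (b l) • b.coord l
      rw [show (α fun p => ∑ l, y (σ p) (b l) • b.coord l) = _ from h2] at h1
      have h3 : ∀ t : Fin i → Fin N, α (fun p => y (σ p) (b (t p)) • b.coord (t p)) =
          (∏ p, y (σ p) (b (t p))) • α (b.coord ∘ t) := fun t =>
        α.toMultilinearMap.map_smul_univ (fun p => y (σ p) (b (t p))) (b.coord ∘ t)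
      replace h1 := (Finset.sum_congr rfl fun t _ => h3 t).symm.trans h1
      simp only [smul_assoc, Function.comp_apply]
      rw [← Finset.smul_sum, h1, smul_smul]
      simp
    rw [Finset.sum_congr rfl fun σ _ => this σ, Finset.sum_const, Finset.card_univ,
      Fintype.card_perm, Fintype.card_fin, ← Nat.cast_smul_eq_nsmul k, smul_smul,
      inv_mul_cancel₀ hi, one_smul]

end EvalForms

end Symplectic

/-! ### Contraction, parity and divisibility in the exterior algebra. -/

namespace Symplectic

open Koszul Module Hochschild MulOpposite

section Exterior

variable {k V W : Type*} [Field k] [AddCommGroup V] [Module k V] [AddCommGroup W] [Module k W]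

@[elab_as_elim]
theorem extPow_induction {n : ℕ} {p : ExteriorAlgebra k V → Prop} (h0 : p 0)
    (ha : ∀ a b, p a → p b → p (a + b)) (hs : ∀ (c : k) a, p a → p (c • a))
    (h : ∀ u : Fin n → V, p (ExteriorAlgebra.ιMulti k n u)) {w} (hw : w ∈ extPow k V n) : p w := by
  rw [extPow_natCast, ← ExteriorAlgebra.ιMulti_span_fixedDegree] at hw
  induction hw using Submodule.span_induction with
  | mem x hx =>
    obtain ⟨u, rfl⟩ := hx
    exact h u
  | zero => exact h0
  | add x y _ _ hx hy => exact ha _ _ hx hy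
  | smul c x _ hx => exact hs _ _ hx

theorem mul_mem_extPow {m : ℤ} {n : ℕ} {w w' : ExteriorAlgebra k V} (hw : w ∈ extPow k V m)
    (hw' : w' ∈ extPow k V n) : w * w' ∈ extPow k V (m + n) := by
  rcases lt_or_ge m 0 with h | h
  · rw [extPow_of_neg h, Submodule.mem_bot] at hw
    rw [hw, zero_mul]
    exact zero_mem _
  · lift m to ℕ using h
    rw [extPow_natCast] at hw hw'
    rw [← Nat.cast_add, extPow_natCast, ExteriorAlgebra.exteriorPower, pow_add]
    exact Submodule.mul_mem_mul hw hw'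

theorem map_mem_extPow (f : V →ₗ[k] W) {n : ℤ} {w : ExteriorAlgebra k V} (hw : w ∈ extPow k V n) :
    ExteriorAlgebra.map f w ∈ extPow k W n := by
  rcases lt_or_ge n 0 with h | h
  · rw [extPow_of_neg h, Submodule.mem_bot] at hw
    rw [hw, map_zero]
    exact zero_mem _
  · lift n to ℕ using h
    refine extPow_induction (by simp) (fun a b ha hb => by rw [map_add]; exact add_mem ha hb)
      (fun c a ha => by rw [map_smul]; exact Submodule.smul_mem _ _ ha) (fun u => ?_) hw
    rw [ExteriorAlgebra.map_apply_ιMulti]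
    exact ιMulti_mem_extPow _

theorem ι_mem_extPow (v : V) : ExteriorAlgebra.ι k v ∈ extPow k V (1 : ℕ) := by
  rw [extPow_natCast, ExteriorAlgebra.exteriorPower, pow_one]
  exact ⟨v, rfl⟩

theorem one_mem_extPow : (1 : ExteriorAlgebra k V) ∈ extPow k V (0 : ℕ) := by
  rw [extPow_natCast, ExteriorAlgebra.exteriorPower, pow_zero]
  exact Submodule.mem_one.2 ⟨1, map_one _⟩

/-- Contraction of multivectors with a linear form. -/
def contract (e : Dual k V) : ExteriorAlgebra k V →ₗ[k] ExteriorAlgebra k V :=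
  CliffordAlgebra.contractLeft (Q := (0 : QuadraticForm k V)) e

theorem contract_ι_mul (e : Dual k V) (v : V) (w : ExteriorAlgebra k V) :
    contract e (ExteriorAlgebra.ι k v * w) = e v • w - ExteriorAlgebra.ι k v * contract e w :=
  CliffordAlgebra.contractLeft_ι_mul e v w

theorem contract_one (e : Dual k V) : contract e (1 : ExteriorAlgebra k V) = 0 :=
  CliffordAlgebra.contractLeft_one (Q := (0 : QuadraticForm k V)) e

theorem contract_mem_extPow (e : Dual k V) {n : ℤ} {w : ExteriorAlgebra k V}
    (hw : w ∈ extPow k V n) : contract e w ∈ extPow k V (n - 1) := by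
  rcases lt_or_ge n 0 with h | h
  · rw [extPow_of_neg h, Submodule.mem_bot] at hw
    rw [hw, map_zero]
    exact zero_mem _
  · lift n to ℕ using h
    induction n generalizing w with
    | zero =>
      rw [extPow_natCast, ExteriorAlgebra.exteriorPower, pow_zero, Submodule.mem_one] at hw
      obtain ⟨r, rfl⟩ := hw
      rw [Algebra.algebraMap_eq_smul_one, map_smul, contract_one, smul_zero]
      exact zero_mem _
    | succ n ih =>
      refine extPow_induction (n := n + 1)
        (p := fun w => contract e w ∈ extPow k V (((n + 1 : ℕ) : ℤ) - 1)) (by simp)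
        (fun a b ha hb => by rw [map_add]; exact add_mem ha hb)
        (fun c a ha => by rw [map_smul]; exact Submodule.smul_mem _ _ ha) (fun u => ?_) hw
      rw [ExteriorAlgebra.ιMulti_succ_apply, contract_ι_mul]
      rw [show ((n + 1 : ℕ) : ℤ) - 1 = n by push_cast; ring]
      refine sub_mem (Submodule.smul_mem _ _ (ιMulti_mem_extPow _)) ?_
      have h1 := ih (ιMulti_mem_extPow (Matrix.vecTail u))
      cases n with
      | zero =>
        rw [extPow_of_neg (by norm_num), Submodule.mem_bot] at h1
        rw [show contract e _ = 0 from h1, mul_zero]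
        exact zero_mem _
      | succ n =>
        rw [show ((n + 1 : ℕ) : ℤ) - 1 = n by push_cast; ring] at h1
        have := mul_mem_extPow (ι_mem_extPow (k := k) (u 0)) h1
        rw [Nat.cast_one, add_comm] at this
        exact_mod_cast this

/-- The parity automorphism of the exterior algebra. -/
def parity : ExteriorAlgebra k V →ₐ[k] ExteriorAlgebra k V :=
  CliffordAlgebra.involute (Q := (0 : QuadraticForm k V))

@[simp] theorem parity_ι (v : V) : parity (ExteriorAlgebra.ι k v) = -ExteriorAlgebra.ι k v :=
  CliffordAlgebra.involute_ι v

theorem ι_mul_eq_parity_mul (v : V) (w : ExteriorAlgebra k V) :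
    ExteriorAlgebra.ι k v * w = parity w * ExteriorAlgebra.ι k v := by
  induction w using ExteriorAlgebra.induction with
  | algebraMap r => rw [AlgHom.commutes, Algebra.commutes]
  | ι u => rw [parity_ι, neg_mul, eq_neg_iff_add_eq_zero, ExteriorAlgebra.ι_add_mul_swap]
  | mul a b ha hb => rw [map_mul, ← mul_assoc, ha, mul_assoc, hb, mul_assoc]
  | add a b ha hb => rw [map_add, mul_add, add_mul, ha, hb]

theorem parity_of_mem {n : ℕ} {w : ExteriorAlgebra k V} (hw : w ∈ extPow k V n) :
    parity w = (-1 : k) ^ n • w := by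
  induction n generalizing w with
  | zero =>
    rw [extPow_natCast, ExteriorAlgebra.exteriorPower, pow_zero, Submodule.mem_one] at hw
    obtain ⟨r, rfl⟩ := hw
    rw [AlgHom.commutes, pow_zero, one_smul]
  | succ n ih =>
    refine extPow_induction (n := n + 1) (p := fun w => parity w = (-1 : k) ^ (n + 1) • w) (by simp)
      (fun a b ha hb => by rw [map_add, ha, hb, smul_add])
      (fun c a ha => by rw [map_smul, ha, smul_comm]) (fun u => ?_) hw
    rw [ExteriorAlgebra.ιMulti_succ_apply, map_mul, parity_ι, ih (ιMulti_mem_extPow _)]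
    rw [mul_smul_comm, neg_mul, smul_neg, pow_succ, mul_neg_one, neg_smul]

theorem mul_comm_of_mem {m n : ℕ} {w w' : ExteriorAlgebra k V} (hw : w ∈ extPow k V m)
    (hw' : w' ∈ extPow k V n) : w * w' = (-1 : k) ^ (m * n) • (w' * w) := by
  induction m generalizing w with
  | zero =>
    rw [extPow_natCast, ExteriorAlgebra.exteriorPower, pow_zero, Submodule.mem_one] at hw
    obtain ⟨r, rfl⟩ := hw
    rw [Algebra.commutes, zero_mul, pow_zero, one_smul]
  | succ m ih =>
    refine extPow_induction (n := m + 1)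
      (p := fun w => w * w' = (-1 : k) ^ ((m + 1) * n) • (w' * w)) (by simp)
      (fun a b ha hb => by rw [add_mul, mul_add, ha, hb, smul_add])
      (fun c a ha => by rw [smul_mul_assoc, ha, mul_smul_comm, smul_comm]) (fun u => ?_) hw
    rw [ExteriorAlgebra.ιMulti_succ_apply, mul_assoc, ih (ιMulti_mem_extPow _), mul_smul_comm,
      ← mul_assoc, ι_mul_eq_parity_mul, parity_of_mem hw', smul_mul_assoc, smul_mul_assoc,
      smul_smul, ← pow_add,
      mul_assoc]
    rw [show m * n + n = (m + 1) * n by ring]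

/-- A multivector annihilated by `v` stays annihilated after inserting a factor in between. -/
theorem ι_mul_mul_eq_zero {v : V} {s : ExteriorAlgebra k V} (h : ExteriorAlgebra.ι k v * s = 0)
    (w : ExteriorAlgebra k V) : ExteriorAlgebra.ι k v * (w * s) = 0 := by
  rw [← mul_assoc, ι_mul_eq_parity_mul, mul_assoc, h, mul_zero]

/-- The factor `v` moves to the left up to parity until it meets `s`. This kills products whose two
factors share a moving vector. -/
theorem mul_ι_mul_eq_zero {v : V} {s : ExteriorAlgebra k V} (h : ExteriorAlgebra.ι k v * s = 0)
    (x t : ExteriorAlgebra k V) : s * x * (ExteriorAlgebra.ι k v * t) = 0 := by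
  have h1 : ExteriorAlgebra.ι k v * parity s = 0 := by
    have := congrArg parity h
    rw [map_mul, parity_ι, map_zero, neg_mul, neg_eq_zero] at this
    exact this
  have h2 : ∀ w : ExteriorAlgebra k V, w * ExteriorAlgebra.ι k v =
      ExteriorAlgebra.ι k v * parity w := fun w => by
    rw [ι_mul_eq_parity_mul, parity, CliffordAlgebra.involute_involute]
  rw [← mul_assoc, h2, map_mul, ← mul_assoc, h1, zero_mul, zero_mul]

/-- Modifying vectors by vectors annihilating `s` does not change the product with `s`. -/
theorem map_mul_eq {s : ExteriorAlgebra k V} (f : V →ₗ[k] V)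
    (h : ∀ v, ExteriorAlgebra.ι k (f v - v) * s = 0) (w : ExteriorAlgebra k V) :
    ExteriorAlgebra.map f w * s = w * s := by
  induction w using CliffordAlgebra.left_induction with
  | algebraMap r => rw [AlgHom.commutes]
  | add x y hx hy => rw [map_add, add_mul, add_mul, hx, hy]
  | ι_mul x m hx =>
    rw [map_mul, show ExteriorAlgebra.map f (CliffordAlgebra.ι 0 m) = ExteriorAlgebra.ι k (f m)
      from ExteriorAlgebra.map_apply_ι f m, mul_assoc, hx, mul_assoc]
    rw [← sub_eq_zero, ← sub_mul, ← map_sub (ExteriorAlgebra.ι k)]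
    exact ι_mul_mul_eq_zero (h m) x

/-- The product of the basis vectors in a list. -/
def basisProd {ι : Type*} (b : Basis ι k V) (L : List ι) : ExteriorAlgebra k V :=
  (L.map fun l => ExteriorAlgebra.ι k (b l)).prod

@[simp] theorem basisProd_cons {ι : Type*} (b : Basis ι k V) (l : ι) (L : List ι) :
    basisProd b (l :: L) = ExteriorAlgebra.ι k (b l) * basisProd b L := rfl

theorem basisProd_mem {ι : Type*} (b : Basis ι k V) (L : List ι) :
    basisProd b L ∈ extPow k V L.length := by
  induction L with
  | nil => exact one_mem_extPow
  | cons l L ih =>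
    have := mul_mem_extPow (ι_mem_extPow (k := k) (b l)) ih
    rw [basisProd_cons, List.length_cons, add_comm, Nat.cast_add]
    exact this

theorem contract_basisProd_mul {ι : Type*} (b : Basis ι k V) {e : Dual k V} (L : List ι)
    (he : ∀ l ∈ L, e (b l) = 0) {x : ExteriorAlgebra k V} (hx : contract e x = 0) :
    contract e (basisProd b L * x) = 0 := by
  induction L with
  | nil => simpa [basisProd] using hx
  | cons l L ih =>
    rw [List.forall_mem_cons] at he
    rw [basisProd_cons, mul_assoc, contract_ι_mul, he.1, zero_smul,
      show contract e _ = 0 from ih he.2, mul_zero, sub_zero]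

/-- Contraction with the coordinate of the leading basis vector strips it off, because it kills the
other vectors of the list and `x`. -/
theorem eq_zero_of_basisProd_mul {ι : Type*} (b : Basis ι k V) (L : List ι) (hL : L.Nodup)
    {x : ExteriorAlgebra k V} (hx : ∀ l ∈ L, contract (b.coord l) x = 0)
    (h : basisProd b L * x = 0) : x = 0 := by
  classical
  induction L with
  | nil => simpa [basisProd] using h
  | cons l L ih =>
    rw [List.nodup_cons] at hL
    rw [List.forall_mem_cons] at hx
    refine ih hL.2 hx.2 ?_
    rw [basisProd_cons, mul_assoc] at h
    have h1 := congrArg (contract (b.coord l)) h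
    rw [contract_ι_mul, map_zero, show contract (b.coord l) _ = 0 from
      contract_basisProd_mul b L (fun m hm => by
        have : m ≠ l := fun h => hL.1 (h ▸ hm)
        simp [this]) hx.1] at h1
    simpa using h1

theorem contract_map_eq_zero (f : W →ₗ[k] V) {e : Dual k V} (he : ∀ w, e (f w) = 0)
    (x : ExteriorAlgebra k W) : contract e (ExteriorAlgebra.map f x) = 0 := by
  induction x using CliffordAlgebra.left_induction with
  | algebraMap r =>
    rw [AlgHom.commutes, Algebra.algebraMap_eq_smul_one, map_smul, contract_one, smul_zero]
  | add x y hx hy => rw [map_add, map_add, hx, hy, add_zero]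
  | ι_mul x m hx =>
    rw [map_mul, show ExteriorAlgebra.map f (CliffordAlgebra.ι 0 m) = ExteriorAlgebra.ι k (f m)
      from ExteriorAlgebra.map_apply_ι f m, contract_ι_mul, he, hx, zero_smul, mul_zero, sub_zero]

variable {B : Type*} [CommRing B] [Algebra k B]

theorem rTensor_mem_gradedPart {f : ExteriorAlgebra k V →ₗ[k] ExteriorAlgebra k W} {m n : ℤ}
    (hf : ∀ w, w ∈ extPow k V m → f w ∈ extPow k W n) {z : ExteriorAlgebra k V ⊗[k] B}
    (hz : z ∈ gradedPart B V m) : LinearMap.rTensor B f z ∈ gradedPart B W n := by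
  obtain ⟨z, rfl⟩ := hz
  induction z with
  | zero => simp
  | add a b ha hb => rw [map_add, map_add]; exact add_mem ha hb
  | tmul w a =>
    rw [LinearMap.rTensor_tmul, LinearMap.rTensor_tmul]
    exact tmul_mem_gradedPart (hf _ w.2) a

theorem gradedPart_of_neg {n : ℤ} (h : n < 0) : gradedPart (k := k) B V n = ⊥ := by
  rw [eq_bot_iff]
  rintro _ ⟨z, rfl⟩
  induction z with
  | zero => simp
  | add a b ha hb => rw [map_add]; exact add_mem ha hb
  | tmul w a =>
    have hw : (w : ExteriorAlgebra k V) ∈ (⊥ : Submodule k (ExteriorAlgebra k V)) :=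
      (extPow_of_neg (k := k) (V := V) h).le w.2
    rw [LinearMap.rTensor_tmul, Submodule.subtype_apply,
      show (w : ExteriorAlgebra k V) = 0 from hw, TensorProduct.zero_tmul]
    exact Submodule.zero_mem (⊥ : Submodule k (ExteriorAlgebra k V ⊗[k] B))

/-- If `v ∧ z = 0` and `e v = 1`, contracting `v ∧ z` with `e` gives `z = v ∧ contract e z`. The
contraction is still annihilated by the remaining vectors of the list, so the argument repeats. -/
theorem exists_eq_basisProd_mul {ι : Type*} (b : Basis ι k V) (L : List ι) (hL : L.Nodup) {n : ℤ}
    {z : ExteriorAlgebra k V ⊗[k] B} (hz : z ∈ gradedPart B V n)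
    (h : ∀ l ∈ L, LinearMap.rTensor B (wedgeLeft (b l)) z = 0) :
    ∃ x ∈ gradedPart B V (n - L.length),
      z = LinearMap.rTensor B (LinearMap.mulLeft k (basisProd b L)) x := by
  induction L generalizing n z with
  | nil =>
    refine ⟨z, by simpa using hz, ?_⟩
    have : LinearMap.mulLeft k (basisProd b []) = LinearMap.id := by
      ext; simp [basisProd]
    rw [this, LinearMap.rTensor_id]
    rfl
  | cons l L ih =>
    rw [List.nodup_cons] at hL
    rw [List.forall_mem_cons] at h
    have key : ∀ e : Dual k V, ∀ v : V, contract e ∘ₗ wedgeLeft v =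
        e v • LinearMap.id - wedgeLeft v ∘ₗ contract e := fun e v => by
      refine LinearMap.ext fun w => ?_
      simp only [LinearMap.comp_apply, wedgeLeft_apply, contract_ι_mul, LinearMap.sub_apply,
        LinearMap.smul_apply, LinearMap.id_apply]
    have key' : ∀ (e : Dual k V) (v : V) (z : ExteriorAlgebra k V ⊗[k] B),
        LinearMap.rTensor B (contract e) (LinearMap.rTensor B (wedgeLeft v) z) =
          e v • z - LinearMap.rTensor B (wedgeLeft v) (LinearMap.rTensor B (contract e) z) := by
      intro e v z
      rw [← LinearMap.rTensor_comp_apply, key, LinearMap.rTensor_sub, LinearMap.rTensor_smul,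
        LinearMap.rTensor_id, LinearMap.rTensor_comp]
      rfl
    have h1 := key' (b.coord l) (b l) z
    rw [h.1, map_zero] at h1
    simp only [Basis.coord_apply, Basis.repr_self, Finsupp.single_eq_same, one_smul] at h1
    rw [eq_comm, sub_eq_zero] at h1
    obtain ⟨x, hx, hx'⟩ := ih hL.2
      (rTensor_mem_gradedPart (fun w => contract_mem_extPow (b.coord l)) hz) (fun m hm => by
        have h2 := key' (b.coord l) (b m) z
        have hne : m ≠ l := fun h => hL.1 (h ▸ hm)
        rw [h.2 m hm, map_zero] at h2
        simpa [hne] using h2.symm)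
    refine ⟨x, ?_, ?_⟩
    · rw [List.length_cons]
      convert hx using 2
      push_cast; ring
    · rw [h1, hx', ← LinearMap.rTensor_comp_apply]
      congr 2
      ext w
      simp

end Exterior

end Symplectic

/-! ### The isomorphism between cohomology and multivector fields. -/

namespace Symplectic

open Koszul Module Hochschild MulOpposite

section Quotient

variable {k C D A : Type*} [Field k] [AddCommGroup C] [Module k C] [AddCommMonoid D] [Module k D]
  [AddCommGroup A] [Module k A]

/-- The quotient of `C` by the kernel of `p` is isomorphic to any `D` embedded as `range p`. -/
def quotEquivOfRangeEq (K : Submodule k C) (p : C →ₗ[k] A) (q : D →ₗ[k] A)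
    (hp : LinearMap.ker p = K) (hq : Function.Injective q)
    (h : LinearMap.range p = LinearMap.range q) : (C ⧸ K) ≃ₗ[k] D :=
  (Submodule.quotEquivOfEq _ _ hp.symm).trans <| p.quotKerEquivRange.trans <|
    (LinearEquiv.ofEq _ _ h).trans (LinearEquiv.ofInjective q hq).symm

theorem quotEquivOfRangeEq_mk (K : Submodule k C) (p : C →ₗ[k] A) (q : D →ₗ[k] A)
    (hp : LinearMap.ker p = K) (hq : Function.Injective q)
    (h : LinearMap.range p = LinearMap.range q) (c : C) :
    q (quotEquivOfRangeEq K p q hp hq h (Submodule.Quotient.mk c)) = p c := by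
  have h1 : LinearEquiv.ofInjective q hq
      (quotEquivOfRangeEq K p q hp hq h (Submodule.Quotient.mk c)) =
      LinearEquiv.ofEq _ _ h (p.quotKerEquivRange (Submodule.quotEquivOfEq _ _
        hp.symm (Submodule.Quotient.mk c))) := by
    rw [quotEquivOfRangeEq, LinearEquiv.trans_apply, LinearEquiv.trans_apply,
      LinearEquiv.trans_apply, LinearEquiv.apply_symm_apply]
  exact congrArg Subtype.val h1

end Quotient

section Moving

variable {k V G : Type*} [Field k] [AddCommGroup V] [Module k V] [Group G]
  {ρ : Representation k G V} {g : G} {N : ℕ} (B : EigenBasis ρ g N)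

namespace EigenBasis

theorem moving_nodup : B.moving.Nodup := by
  classical
  exact Finset.nodup_toList _

include B in
theorem isCompl : IsCompl (fixedSpace ρ g) (movingSpace ρ g) := by
  constructor
  · rw [Submodule.disjoint_def]
    intro v hv hv'
    rw [B.mem_fixedSpace] at hv
    rw [B.mem_movingSpace] at hv'
    refine B.b.ext_elem fun l => ?_
    by_cases h : B.μ l = 1
    · simpa using hv' l h
    · simpa using hv l h
  · rw [codisjoint_iff, eq_top_iff, ← B.b.span_eq, Submodule.span_le]
    rintro _ ⟨l, rfl⟩
    by_cases h : B.μ l = 1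
    · refine Submodule.mem_sup_left ?_
      change ρ g (B.b l) = B.b l
      rw [B.apply_b, h, one_smul]
    · exact Submodule.mem_sup_right (B.b_mem_movingSpace h)

theorem finrank_movingSpace : finrank k (movingSpace ρ g) = B.moving.length := by
  classical
  have h : movingSpace ρ g =
      Submodule.span k (Set.range fun l : {l // B.μ l ≠ 1} => B.b l) := by
    refine le_antisymm (fun v hv => ?_) ?_
    · rw [B.mem_movingSpace] at hv
      rw [← B.b.sum_repr v]
      refine Submodule.sum_mem _ fun l _ => ?_
      by_cases hl : B.μ l = 1
      · have := hv l hl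
        rw [Basis.coord_apply] at this
        rw [this, zero_smul]
        exact zero_mem _
      · exact Submodule.smul_mem _ _ (Submodule.subset_span ⟨⟨l, hl⟩, rfl⟩)
    · rw [Submodule.span_le]
      rintro _ ⟨l, rfl⟩
      exact B.b_mem_movingSpace l.2
  rw [h, finrank_span_eq_card (b := fun l : {l // B.μ l ≠ 1} => B.b l)
    (B.b.linearIndependent.comp _ Subtype.val_injective), EigenBasis.moving,
    Finset.length_toList, Fintype.card_subtype]

theorem codim_eq : codim ρ g = B.moving.length := by
  rw [codim, ← B.finrank_movingSpace]
  exact (Submodule.quotientEquivOfIsCompl _ _ B.isCompl).finrank_eq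

include B in
theorem finrank_movingSpace_eq_codim : finrank k (movingSpace ρ g) = codim ρ g := by
  rw [B.finrank_movingSpace, B.codim_eq]

theorem exists_map_eq_basisProd (L : List (Fin N)) (hL : ∀ l ∈ L, B.μ l ≠ 1) :
    ∃ p ∈ extPow k (movingSpace ρ g) L.length,
      ExteriorAlgebra.map (movingSpace ρ g).subtype p = basisProd B.b L := by
  induction L with
  | nil => exact ⟨1, one_mem_extPow, map_one _⟩
  | cons l L ih =>
    rw [List.forall_mem_cons] at hL
    obtain ⟨p, hp, hp'⟩ := ih hL.2
    refine ⟨ExteriorAlgebra.ι k ⟨B.b l, B.b_mem_movingSpace hL.1⟩ * p, ?_, ?_⟩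
    · rw [List.length_cons, add_comm, Nat.cast_add]
      exact mul_mem_extPow (ι_mem_extPow _) hp
    · rw [map_mul, hp', basisProd_cons, ExteriorAlgebra.map_apply_ι]
      rfl

theorem basisProd_ne_zero (L : List (Fin N)) (hL : L.Nodup) : basisProd B.b L ≠ 0 := fun h => by
  have := eq_zero_of_basisProd_mul B.b L hL (x := 1) (fun l _ => contract_one _)
    (by rw [h, zero_mul])
  exact one_ne_zero this

/-- The top exterior power of the moving space is a line, generated by the product of the moving
basis vectors. -/
theorem exists_movingToExt_eq [FiniteDimensional k V]
    (s : ⋀[k]^(codim ρ g) (movingSpace ρ g)) (hs : s ≠ 0) :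
    ∃ c : k, c ≠ 0 ∧ movingToExt ρ g s = c • basisProd B.b B.moving := by
  obtain ⟨p, hp, hp'⟩ := B.exists_map_eq_basisProd B.moving fun l hl => B.mem_moving.1 hl
  rw [extPow_natCast, ← B.codim_eq] at hp
  have h1 : finrank k (⋀[k]^(codim ρ g) (movingSpace ρ g)) = 1 := by
    rw [exteriorPower.finrank_eq, B.finrank_movingSpace_eq_codim, Nat.choose_self]
  have hp0 : (⟨p, hp⟩ : ⋀[k]^(codim ρ g) (movingSpace ρ g)) ≠ 0 := fun h => by
    have h2 : p = 0 := congrArg Subtype.val h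
    rw [h2, map_zero] at hp'
    exact B.basisProd_ne_zero _ B.moving_nodup hp'.symm
  obtain ⟨c, hc⟩ := exists_smul_eq_of_finrank_eq_one h1 hp0 s
  refine ⟨c, fun h => hs (by rw [← hc, h, zero_smul]), ?_⟩
  rw [movingToExt, ← hc, ← hp', ← map_smul]
  rfl

-- The product lies in an exterior power of the moving space beyond the top one.
include B in
theorem ι_mul_movingToExt [FiniteDimensional k V] (s : ⋀[k]^(codim ρ g) (movingSpace ρ g))
    {v : V} (hv : v ∈ movingSpace ρ g) : ExteriorAlgebra.ι k v * movingToExt ρ g s = 0 := by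
  have h0 : finrank k (⋀[k]^(codim ρ g + 1) (movingSpace ρ g)) = 0 := by
    rw [exteriorPower.finrank_eq, B.finrank_movingSpace_eq_codim, Nat.choose_succ_self]
  have h1 : ExteriorAlgebra.ι k (⟨v, hv⟩ : movingSpace ρ g) * s ∈
      ⋀[k]^(codim ρ g + 1) (movingSpace ρ g) := by
    have := mul_mem_extPow (n := codim ρ g) (ι_mem_extPow (k := k) (⟨v, hv⟩ : movingSpace ρ g))
      (by rw [extPow_natCast]; exact s.2)
    rwa [← Nat.cast_add, extPow_natCast, add_comm] at this
  rw [finrank_zero_iff] at h0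
  have h2 := congrArg Subtype.val (Subsingleton.elim (⟨_, h1⟩ : ⋀[k]^(codim ρ g + 1) _) 0)
  have h3 := congrArg (ExteriorAlgebra.map (movingSpace ρ g).subtype) h2
  rw [map_mul, ExteriorAlgebra.map_apply_ι] at h3
  exact h3.trans (map_zero _)

end EigenBasis

theorem symmetrization_of_mem (hg : (orderOf g : k) ≠ 0) (v : fixedSpace ρ g) :
    symmetrization ρ g v = v := by
  ext
  change ((orderOf g : k)⁻¹ • ∑ i ∈ Finset.range (orderOf g), ρ (g ^ (i + 1))) (v : V) = v
  have hv : ρ g (v : V) = v := v.2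
  have h : ∀ i : ℕ, ρ (g ^ i) (v : V) = v := fun i => by
    induction i with
    | zero => simp
    | succ i ih => rw [pow_succ, map_mul, Module.End.mul_apply, hv, ih]
  rw [LinearMap.smul_apply, LinearMap.sum_apply]
  simp only [h]
  rw [Finset.sum_const, Finset.card_range, ← Nat.cast_smul_eq_nsmul k, smul_smul,
    inv_mul_cancel₀ hg, one_smul]

theorem symmetrization_apply_self (v : V) : symmetrization ρ g (ρ g v) = symmetrization ρ g v := by
  ext
  change ((orderOf g : k)⁻¹ • ∑ i ∈ Finset.range (orderOf g), ρ (g ^ (i + 1))) (ρ g v) =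
    ((orderOf g : k)⁻¹ • ∑ i ∈ Finset.range (orderOf g), ρ (g ^ (i + 1))) v
  rw [LinearMap.smul_apply, LinearMap.smul_apply, LinearMap.sum_apply, LinearMap.sum_apply]
  congr 1
  have h : ∀ i, ρ (g ^ (i + 1)) (ρ g v) = ρ (g ^ (i + 2)) v := fun i => by
    rw [← Module.End.mul_apply, ← map_mul, ← pow_succ]
  simp only [h]
  have h1 := Finset.sum_range_succ (fun i => ρ (g ^ (i + 1)) v) (orderOf g)
  have h2 := Finset.sum_range_succ' (fun i => ρ (g ^ (i + 1)) v) (orderOf g)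
  rw [h1] at h2
  rw [pow_succ, pow_orderOf_eq_one, one_mul, zero_add, pow_one] at h2
  exact (add_right_cancel h2).symm

theorem symmetrization_of_mem_movingSpace {v : V} (hv : v ∈ movingSpace ρ g) :
    symmetrization ρ g v = 0 := by
  have : movingSpace ρ g ≤ LinearMap.ker (symmetrization ρ g) := by
    refine iSup₂_le fun c hc w hw => ?_
    rw [Module.End.mem_eigenspace_iff] at hw
    have h1 := symmetrization_apply_self (ρ := ρ) (g := g) w
    rw [hw, map_smul, ← sub_eq_zero] at h1
    have h2 : (c - 1) • symmetrization ρ g w = 0 := by rw [sub_smul, one_smul, h1]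
    exact (smul_eq_zero.1 h2).resolve_left (sub_ne_zero.2 hc)
  exact this hv

-- `π^g` is the projection onto `V^g` along the moving space, so it changes vectors only by
-- something that `s_g` annihilates.
include B in
theorem symmetrization_sub_mem (hg : (orderOf g : k) ≠ 0) (v : V) :
    (symmetrization ρ g v : V) - v ∈ movingSpace ρ g := by
  obtain ⟨a, b, rfl⟩ : ∃ (a : fixedSpace ρ g) (b : movingSpace ρ g), v = a + b := by
    have : v ∈ fixedSpace ρ g ⊔ movingSpace ρ g := B.isCompl.sup_eq_top ▸ Submodule.mem_top
    obtain ⟨a, ha, b, hb, rfl⟩ := Submodule.mem_sup.1 this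
    exact ⟨⟨a, ha⟩, ⟨b, hb⟩, rfl⟩
  rw [map_add, symmetrization_of_mem hg, symmetrization_of_mem_movingSpace b.2, add_zero,
    sub_add_cancel_left]
  exact neg_mem b.2

/-- The multivector fields determine alternating maps on linear forms. -/
def alternation (g : G) (s : ExteriorAlgebra k V) (i : ℕ) :
    extPow k (fixedSpace ρ g) ((i : ℤ) - codim ρ g) ⊗[k] PolyFun k (fixedSpace ρ g) →ₗ[k]
      Dual k V [⋀^Fin i]→ₗ[k] PolyFun k (fixedSpace ρ g) :=
  evalForms _ i ∘ₗ wedgeWith ρ g s ∘ₗ toMultiVec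

theorem alternation_apply (s : ExteriorAlgebra k V) (i : ℕ)
    (z : extPow k (fixedSpace ρ g) ((i : ℤ) - codim ρ g) ⊗[k] PolyFun k (fixedSpace ρ g)) :
    alternation g s i z = evalForms _ i (wedgeWith ρ g s (toMultiVec z)) := rfl

theorem movingToExt_mem (s : ⋀[k]^(codim ρ g) (movingSpace ρ g)) :
    movingToExt ρ g s ∈ extPow k V (codim ρ g) := by
  refine map_mem_extPow _ ?_
  rw [extPow_natCast]
  exact s.2

theorem wedgeWith_mem (s : ⋀[k]^(codim ρ g) (movingSpace ρ g)) {n : ℤ}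
    {z : MultiVec k (fixedSpace ρ g)} (hz : z ∈ gradedPart (PolyFun k (fixedSpace ρ g)) _ n) :
    wedgeWith ρ g (movingToExt ρ g s) z ∈
      gradedPart (PolyFun k (fixedSpace ρ g)) V (n + codim ρ g) :=
  rTensor_mem_gradedPart
    (fun _ hw => mul_mem_extPow (map_mem_extPow _ hw) (movingToExt_mem s)) hz

-- `s_g` is a multiple of the product of the moving basis vectors. Moved to the left at the cost of
-- parity twists, it is stripped off by contractions with moving coordinates, which kill
-- multivectors of `V^g`.
include B in
theorem wedgeWith_injective [FiniteDimensional k V] {s : ⋀[k]^(codim ρ g) (movingSpace ρ g)}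
    (hs : s ≠ 0) : Function.Injective (wedgeWith ρ g (movingToExt ρ g s)) := by
  refine Module.Flat.rTensor_preserves_injective_linearMap _ ?_
  obtain ⟨c, hc, hcs⟩ := B.exists_movingToExt_eq s hs
  rw [injective_iff_map_eq_zero]
  intro x hx
  have hx : ExteriorAlgebra.map (fixedSpace ρ g).subtype x * movingToExt ρ g s = 0 := hx
  rw [hcs, mul_smul_comm, smul_eq_zero_iff_right hc] at hx
  have hcomm : ∀ (L : List (Fin N)) (w : ExteriorAlgebra k V),
      w * basisProd B.b L = basisProd B.b L * parity^[L.length] w := by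
    intro L
    induction L with
    | nil => intro w; simp [basisProd]
    | cons l L ih =>
      intro w
      have : w * ExteriorAlgebra.ι k (B.b l) = ExteriorAlgebra.ι k (B.b l) * parity w := by
        rw [ι_mul_eq_parity_mul, parity, CliffordAlgebra.involute_involute]
      rw [basisProd_cons, ← mul_assoc, this, mul_assoc, ih, mul_assoc]
      rfl
  have hmap : ∀ (n : ℕ), parity^[n] (ExteriorAlgebra.map (fixedSpace ρ g).subtype x) =
      ExteriorAlgebra.map (fixedSpace ρ g).subtype (parity^[n] x) := by
    have h1 : ∀ y : ExteriorAlgebra k (fixedSpace ρ g),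
        parity (ExteriorAlgebra.map (fixedSpace ρ g).subtype y) =
          ExteriorAlgebra.map (fixedSpace ρ g).subtype (parity y) := by
      intro y
      have : (parity.comp (ExteriorAlgebra.map (fixedSpace ρ g).subtype)) =
          (ExteriorAlgebra.map (fixedSpace ρ g).subtype).comp parity := by
        apply ExteriorAlgebra.hom_ext
        ext v
        simp
      exact DFunLike.congr_fun this y
    intro n
    induction n with
    | zero => rfl
    | succ n ih => rw [Function.iterate_succ_apply', Function.iterate_succ_apply', ih, h1]
  rw [hcomm, hmap] at hx
  have h2 := eq_zero_of_basisProd_mul B.b B.moving B.moving_nodup (fun l hl =>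
    contract_map_eq_zero _ (fun w => (B.mem_fixedSpace.1 w.2) l (B.mem_moving.1 hl)) _) hx
  rw [← map_zero (ExteriorAlgebra.map (fixedSpace ρ g).subtype)] at h2
  have h3 := ExteriorAlgebra.map_injective_field (Submodule.ker_subtype _) h2
  have hpar : ∀ (n : ℕ) (y : ExteriorAlgebra k (fixedSpace ρ g)), parity^[n] y = 0 → y = 0 := by
    intro n
    induction n with
    | zero => intro y h; exact h
    | succ n ih =>
      intro y h
      have h4 := congrArg parity (ih (parity y) h)
      rwa [parity, CliffordAlgebra.involute_involute, map_zero] at h4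
  exact hpar _ _ h3

include B in
theorem alternation_injective [FiniteDimensional k V] {s : ⋀[k]^(codim ρ g) (movingSpace ρ g)}
    (hs : s ≠ 0) (i : ℕ) :
    Function.Injective (alternation (ρ := ρ) g (movingToExt ρ g s) i) := by
  rw [injective_iff_map_eq_zero]
  intro z hz
  rw [alternation_apply] at hz
  have h1 := evalForms_injOn B.b (n := (i : ℤ) - codim ρ g + codim ρ g) (by ring)
    (wedgeWith_mem s ⟨z, rfl⟩) hz
  rw [← map_zero (wedgeWith ρ g (movingToExt ρ g s))] at h1
  have h2 := wedgeWith_injective B hs h1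
  rw [← map_zero toMultiVec] at h2
  exact Module.Flat.rTensor_preserves_injective_linearMap _ (Submodule.subtype_injective _) h2

theorem wedgeLeft_wedgeWith (s : ⋀[k]^(codim ρ g) (movingSpace ρ g)) {v : V}
    (hv : ExteriorAlgebra.ι k v * movingToExt ρ g s = 0) (z : MultiVec k (fixedSpace ρ g)) :
    LinearMap.rTensor _ (wedgeLeft v) (wedgeWith ρ g (movingToExt ρ g s) z) = 0 := by
  rw [wedgeWith, ← LinearMap.rTensor_comp_apply]
  have : wedgeLeft v ∘ₗ LinearMap.mulRight k (movingToExt ρ g s) ∘ₗ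
      (ExteriorAlgebra.map (fixedSpace ρ g).subtype).toLinearMap = 0 := by
    refine LinearMap.ext fun w => ?_
    exact ι_mul_mul_eq_zero hv _
  rw [this, LinearMap.rTensor_zero, LinearMap.zero_apply]

include B in
/-- Alternating maps annihilated by the moving vectors come from multivector fields. -/
theorem mem_range_alternation [FiniteDimensional k V] (hg : (orderOf g : k) ≠ 0)
    (hfac : ∀ m ≤ N, (m.factorial : k) ≠ 0)
    {s : ⋀[k]^(codim ρ g) (movingSpace ρ g)} (hs : s ≠ 0) {i : ℕ}
    (α : Dual k V [⋀^Fin i]→ₗ[k] PolyFun k (fixedSpace ρ g))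
    (hα : ∀ v ∈ movingSpace ρ g, koszulD (scalOp _ (LinearMap.applyₗ v)) α = 0) :
    α ∈ LinearMap.range (alternation (ρ := ρ) g (movingToExt ρ g s) i) := by
  obtain ⟨z, hz, rfl⟩ := exists_evalForms_eq B.b
    (or_iff_not_imp_left.2 fun h => hfac i (not_lt.1 h)) α
  have h1 : ∀ l ∈ B.moving, LinearMap.rTensor (PolyFun k (fixedSpace ρ g))
      (wedgeLeft (B.b l)) z = 0 := fun l hl => by
    have h2 := hα _ (B.b_mem_movingSpace (B.mem_moving.1 hl))
    rw [koszulD_evalForms] at h2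
    exact evalForms_injOn B.b (n := i + 1) (by push_cast; ring)
      (rTensor_mem_gradedPart (fun w hw => by
        have := mul_mem_extPow (ι_mem_extPow (k := k) (B.b l)) hw
        rw [add_comm] at this
        exact_mod_cast this) hz) h2
  -- Since every moving basis vector annihilates `z`, their product divides it.
  obtain ⟨x, hx, rfl⟩ := exists_eq_basisProd_mul B.b B.moving B.moving_nodup hz h1
  rw [← B.codim_eq] at hx
  obtain ⟨c, hc, hcs⟩ := B.exists_movingToExt_eq s hs
  rcases lt_or_ge ((i : ℤ) - codim ρ g) 0 with h | h
  · rw [gradedPart_of_neg h, Submodule.mem_bot] at hx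
    rw [hx, map_zero, map_zero]
    exact zero_mem _
  obtain ⟨n, hn⟩ := Int.eq_ofNat_of_zero_le h
  rw [hn] at hx
  -- The cofactor `x` still lives on `V`. Projecting it by `π^g` does not change its product with
  -- `s`; the sign moves the product of moving vectors to the right, and `c⁻¹` accounts for the
  -- normalization of `s`.
  have h3 : LinearMap.rTensor _ (LinearMap.mulLeft k (basisProd B.b B.moving)) x =
      wedgeWith ρ g (movingToExt ρ g s) (((-1 : k) ^ (codim ρ g * n) * c⁻¹) •
        LinearMap.rTensor _ (ExteriorAlgebra.map (symmetrization ρ g)).toLinearMap x) := by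
    refine gradedPart_induction (p := fun x =>
      LinearMap.rTensor _ (LinearMap.mulLeft k (basisProd B.b B.moving)) x =
      wedgeWith ρ g (movingToExt ρ g s) (((-1 : k) ^ (codim ρ g * n) * c⁻¹) •
        LinearMap.rTensor _ (ExteriorAlgebra.map (symmetrization ρ g)).toLinearMap x))
      (by simp) (fun a b ha hb => by simp only [map_add, smul_add, ha, hb]) (fun u f => ?_) hx
    rw [map_smul, LinearMap.rTensor_tmul, LinearMap.rTensor_tmul, wedgeWith,
      LinearMap.rTensor_tmul]
    simp only [LinearMap.mulLeft_apply, LinearMap.comp_apply, AlgHom.toLinearMap_apply,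
      LinearMap.mulRight_apply]
    have h4 : ExteriorAlgebra.map (fixedSpace ρ g).subtype
        (ExteriorAlgebra.map (symmetrization ρ g) (ExteriorAlgebra.ιMulti k n u)) *
        movingToExt ρ g s = ExteriorAlgebra.ιMulti k n u * movingToExt ρ g s := by
      rw [← AlgHom.comp_apply, ExteriorAlgebra.map_comp_map]
      exact map_mul_eq _ (fun v => B.ι_mul_movingToExt s (symmetrization_sub_mem B hg v)) _
    rw [h4, hcs, mul_smul_comm, TensorProduct.smul_tmul', smul_smul, mul_assoc,
      inv_mul_cancel₀ hc, mul_one, B.codim_eq]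
    rw [mul_comm_of_mem (basisProd_mem B.b B.moving) (ιMulti_mem_extPow u)]
  rw [h3]
  have h5 : ((-1 : k) ^ (codim ρ g * n) * c⁻¹) •
      LinearMap.rTensor _ (ExteriorAlgebra.map (symmetrization ρ g)).toLinearMap x ∈
        gradedPart (PolyFun k (fixedSpace ρ g)) (fixedSpace ρ g) ((i : ℤ) - codim ρ g) := by
    rw [hn]
    exact Submodule.smul_mem _ _ (rTensor_mem_gradedPart (fun w => map_mem_extPow _) hx)
  obtain ⟨y, hy⟩ := h5
  exact ⟨y, by rw [alternation_apply, ← hy]; rfl⟩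

include B in
/-- Extending the coefficients of a multivector field along the projection to `V^g` gives a
Koszul cocycle. -/
theorem koszulD_koszulOp_evalForms (i : ℕ) (z : ExteriorAlgebra k V ⊗[k] PolyFun k V)
    (hz : ∀ l, B.μ l ≠ 1 → LinearMap.rTensor _ (wedgeLeft (B.b l)) z = 0) :
    koszulD (koszulOp ρ g) (evalForms _ i z) = 0 := by
  -- In the eigenbasis the differential is the sum over `l` of the weight times the coordinate times
  -- the wedge with `b l`. Fixed vectors have weight zero and moving ones annihilate `z`.
  have h1 : ∀ y, SymmetricAlgebra.ι k (Dual k V) (subAct ρ g y) =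
      ∑ l, y (B.b l) • (B.weight l • SymmetricAlgebra.ι k (Dual k V) (B.b.coord l)) := by
    intro y
    simp only [← map_smul, ← map_sum]
    congr 1
    refine B.b.ext fun i => ?_
    rw [subAct_apply_b, LinearMap.sum_apply, Finset.sum_eq_single i]
    · simp [mul_comm]
    · intro l _ hl
      simp [hl]
    · simp
  ext y
  rw [koszulD_apply]
  simp only [mulOp_apply, LinearMap.comp_apply, h1, Finset.sum_mul, Finset.smul_sum]
  rw [Finset.sum_comm]
  refine Finset.sum_eq_zero fun l _ => ?_
  by_cases hl : B.μ l = 1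
  · have : B.weight l = 0 := by rw [EigenBasis.weight, hl]; simp
    simp [this]
  · have h2 := congrArg (fun f => f y) (koszulD_evalForms (i := i) (B.b l) z)
    rw [hz l hl, map_zero, koszulD_apply] at h2
    have h3 := congrArg (fun a => B.weight l • SymmetricAlgebra.ι k (Dual k V) (B.b.coord l) * a) h2
    simp only [Finset.mul_sum, scalOp_apply, LinearMap.applyₗ_apply_apply,
      AlternatingMap.zero_apply, mul_zero] at h3
    rw [← h3]
    refine Finset.sum_congr rfl fun j _ => ?_
    rw [mul_smul_comm, mul_smul_comm, smul_mul_assoc]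

theorem pullback_symmetrization (hg : (orderOf g : k) ≠ 0) (a : PolyFun k (fixedSpace ρ g)) :
    pullback (fixedSpace ρ g).subtype (pullback (symmetrization ρ g) a) = a := by
  rw [← pullback_comp_apply]
  have : symmetrization ρ g ∘ₗ (fixedSpace ρ g).subtype = LinearMap.id :=
    LinearMap.ext fun v => symmetrization_of_mem hg v
  rw [this, pullback_id]

/-- Every multivector field is represented by a cocycle whose alternation is constant along the
fibers of the projection to `V^g`. -/
theorem exists_altCoeff_eq_evalForms [FiniteDimensional k V] (hg : (orderOf g : k) ≠ 0)
    (hfac : ∀ m ≤ finrank k V, (m.factorial : k) ≠ 0) (B : EigenBasis ρ g (finrank k V))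
    (s : ⋀[k]^(codim ρ g) (movingSpace ρ g)) (i : ℕ)
    (z : extPow k (fixedSpace ρ g) ((i : ℤ) - codim ρ g) ⊗[k] PolyFun k (fixedSpace ρ g)) :
    ∃ φ ∈ cocycles k (PolyFun k V) (Component ρ g) i,
      altCoeff ρ g φ = evalForms _ i (LinearMap.lTensor _ (pullback (symmetrization ρ g)).toLinearMap
        (wedgeWith ρ g (movingToExt ρ g s) (toMultiVec z))) ∧
      altEvalMap ρ g φ = alternation g (movingToExt ρ g s) i z := by
  obtain ⟨φ, hφ, h⟩ := exists_altCoeff_eq hfac B _ (koszulD_koszulOp_evalForms B i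
    (LinearMap.lTensor _ (pullback (symmetrization ρ g)).toLinearMap
        (wedgeWith ρ g (movingToExt ρ g s) (toMultiVec z))) (fun l hl => by
      rw [← LinearMap.comp_apply, LinearMap.rTensor_comp_lTensor, ← LinearMap.lTensor_comp_rTensor,
        LinearMap.comp_apply, wedgeLeft_wedgeWith s
          (B.ι_mul_movingToExt s (B.b_mem_movingSpace hl)), map_zero]))
  refine ⟨φ, hφ, h, ?_⟩
  rw [altEvalMap_eq, h, compAlternatingMap_evalForms, ← LinearMap.lTensor_comp_apply]
  have : (pullback (fixedSpace ρ g).subtype).toLinearMap ∘ₗ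
      (pullback (symmetrization ρ g)).toLinearMap = LinearMap.id :=
    LinearMap.ext fun a => pullback_symmetrization hg a
  rw [this, LinearMap.lTensor_id]
  rfl

section Iso

variable [FiniteDimensional k V]

/-- `altEvalMap` on cocycles. -/
def cocycleEval (ρ : Representation k G V) (g : G) (i : ℕ) :
    cocycles k (PolyFun k V) (Component ρ g) i →ₗ[k]
    Dual k V [⋀^Fin i]→ₗ[k] PolyFun k (fixedSpace ρ g) :=
  altEvalMap ρ g ∘ₗ (cocycles k (PolyFun k V) (Component ρ g) i).subtype

include B in
theorem ker_cocycleEval (i : ℕ) : LinearMap.ker (cocycleEval ρ g i) =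
    (coboundaries k (PolyFun k V) (Component ρ g) i).submoduleOf
      (cocycles k (PolyFun k V) (Component ρ g) i) := by
  ext φ
  rw [LinearMap.mem_ker, Submodule.submoduleOf, Submodule.mem_comap]
  exact ⟨fun h => mem_coboundaries_of_altEvalMap_eq_zero B φ.2 h,
    fun h => altEvalMap_eq_zero_of_mem_coboundaries ρ g h⟩

theorem range_cocycleEval (hg : (orderOf g : k) ≠ 0)
    (hfac : ∀ m ≤ finrank k V, (m.factorial : k) ≠ 0) (B : EigenBasis ρ g (finrank k V))
    {s : ⋀[k]^(codim ρ g) (movingSpace ρ g)} (hs : s ≠ 0) (i : ℕ) :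
    LinearMap.range (cocycleEval ρ g i) =
      LinearMap.range (alternation (ρ := ρ) g (movingToExt ρ g s) i) := by
  apply le_antisymm
  · rintro _ ⟨φ, rfl⟩
    exact mem_range_alternation B hg hfac hs _ fun v hv => koszulD_scalOp_altEvalMap B φ.2 hv
  · rintro _ ⟨z, rfl⟩
    obtain ⟨φ, hφ, -, h⟩ := exists_altCoeff_eq_evalForms hg hfac B s i z
    exact ⟨⟨φ, hφ⟩, h⟩

/-- The isomorphism of cohomology with multivector fields. -/
def cohomologyEquiv (hg : (orderOf g : k) ≠ 0)
    (hfac : ∀ m ≤ finrank k V, (m.factorial : k) ≠ 0) (B : EigenBasis ρ g (finrank k V))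
    {s : ⋀[k]^(codim ρ g) (movingSpace ρ g)} (hs : s ≠ 0) (i : ℕ) :
    Cohomology k (PolyFun k V) (Component ρ g) i ≃ₗ[k]
      extPow k (fixedSpace ρ g) ((i : ℤ) - codim ρ g) ⊗[k] PolyFun k (fixedSpace ρ g) :=
  quotEquivOfRangeEq _ (cocycleEval ρ g i) (alternation g (movingToExt ρ g s) i)
    (ker_cocycleEval B i) (alternation_injective B hs i) (range_cocycleEval hg hfac B hs i)

theorem alternation_cohomologyEquiv (hg : (orderOf g : k) ≠ 0)
    (hfac : ∀ m ≤ finrank k V, (m.factorial : k) ≠ 0) (B : EigenBasis ρ g (finrank k V))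
    {s : ⋀[k]^(codim ρ g) (movingSpace ρ g)} (hs : s ≠ 0) (i : ℕ)
    (φ : cocycles k (PolyFun k V) (Component ρ g) i) :
    alternation g (movingToExt ρ g s) i (cohomologyEquiv hg hfac B hs i (cls φ)) =
      altEvalMap ρ g φ.1 :=
  quotEquivOfRangeEq_mk _ _ _ _ _ _ φ

end Iso

end Moving

end Symplectic

/-! ### Cup products, and transversality of fixed spaces. -/

namespace Symplectic

open Koszul Module Hochschild MulOpposite

section Cup

variable {k V G : Type*} [Field k] [AddCommGroup V] [Module k V] [Group G]
  {ρ : Representation k G V} {g h : G}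

theorem altCoeff_eq_alternatization {n : ℕ} (φ : Cochain k (PolyFun k V) (Component ρ g) n) :
    altCoeff ρ g φ = MultilinearMap.alternatization
      (((coeff ρ g).toLinearMap.compMultilinearMap φ).compLinearMap
        fun _ => SymmetricAlgebra.ι k (Dual k V)) := by
  ext y
  rw [altCoeff_apply, MultilinearMap.alternatization_apply]
  rfl

/-- On coefficients the cup product multiplies values in separate blocks of arguments, so its
alternation is a wedge; the twist of the second factor by `g` comes from the crossed product. -/
theorem altCoeff_cupCochain {i j : ℕ} (φ : Cochain k (PolyFun k V) (Component ρ g) i)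
    (ψ : Cochain k (PolyFun k V) (Component ρ h) j) :
    altCoeff ρ (g * h) (cupCochain (componentMul ρ g h) i j φ ψ) =
      altWedge (altCoeff ρ g φ)
        ((polyAct ρ g).toLinearMap.compAlternatingMap (altCoeff ρ h ψ)) := by
  rw [altCoeff_eq_alternatization, altCoeff_eq_alternatization, altCoeff_eq_alternatization,
    ← LinearMap.compMultilinearMap_alternatization, ← alternatization_mulMultilinear]
  rfl

theorem pullback_polyAct {W : Submodule k V} (hW : W ≤ fixedSpace ρ g) (a : PolyFun k V) :
    pullback W.subtype (polyAct ρ g a) = pullback W.subtype a := by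
  rw [polyAct, ← pullback_comp_apply]
  congr 2
  ext v
  have hv : ρ g (v : V) = v := hW v.2
  have h2 : ρ g⁻¹ (ρ g (v : V)) = v := by
    rw [← Module.End.mul_apply, ← map_mul, inv_mul_cancel, map_one, Module.End.one_apply]
  rwa [hv] at h2

/-- The twist by `g` is invisible on `V^(gh)`, since this is contained in `V^g`. -/
theorem altEvalMap_cupCochain (hg : fixedSpace ρ (g * h) ≤ fixedSpace ρ g)
    (hh : fixedSpace ρ (g * h) ≤ fixedSpace ρ h) {i j : ℕ}
    (φ : Cochain k (PolyFun k V) (Component ρ g) i)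
    (ψ : Cochain k (PolyFun k V) (Component ρ h) j) :
    altEvalMap ρ (g * h) (cupCochain (componentMul ρ g h) i j φ ψ) =
      altWedge
        ((pullback (Submodule.inclusion hg)).toLinearMap.compAlternatingMap (altEvalMap ρ g φ))
        ((pullback (Submodule.inclusion hh)).toLinearMap.compAlternatingMap (altEvalMap ρ h ψ)) := by
  rw [altEvalMap_eq, altCoeff_cupCochain, compAlternatingMap_altWedge]
  congr 1
  · ext y
    exact pullback_comp_apply (Submodule.inclusion hg) (fixedSpace ρ g).subtype _
  · ext y
    exact (pullback_polyAct hg _).trans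
      (pullback_comp_apply (Submodule.inclusion hh) (fixedSpace ρ h).subtype _)

theorem lTensor_mem_gradedPart {A A' : Type*} [CommRing A] [Algebra k A] [CommRing A'] [Algebra k A']
    (f : A →ₗ[k] A') {n : ℤ} {z : ExteriorAlgebra k V ⊗[k] A} (hz : z ∈ gradedPart A V n) :
    LinearMap.lTensor _ f z ∈ gradedPart A' V n := by
  obtain ⟨z, rfl⟩ := hz
  induction z with
  | zero => simp
  | add a b ha hb => rw [map_add, map_add]; exact add_mem ha hb
  | tmul w a =>
    rw [LinearMap.rTensor_tmul, LinearMap.lTensor_tmul]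
    exact tmul_mem_gradedPart w.2 _

theorem mul_mem_gradedPart {A : Type*} [CommRing A] [Algebra k A] {m n : ℤ}
    {z z' : ExteriorAlgebra k V ⊗[k] A} (hz : z ∈ gradedPart A V m) (hz' : z' ∈ gradedPart A V n) :
    z * z' ∈ gradedPart A V (m + n) := by
  rcases lt_or_ge n 0 with hn | hn
  · rw [gradedPart_of_neg hn, Submodule.mem_bot] at hz'
    rw [hz', mul_zero]
    exact zero_mem _
  lift n to ℕ using hn
  obtain ⟨z, rfl⟩ := hz
  obtain ⟨z', rfl⟩ := hz'
  induction z with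
  | zero => simp
  | add a b ha hb => rw [map_add, add_mul]; exact add_mem ha hb
  | tmul w a =>
    induction z' with
    | zero => simp
    | add a b ha hb => rw [map_add, mul_add]; exact add_mem ha hb
    | tmul w' a' =>
      rw [LinearMap.rTensor_tmul, LinearMap.rTensor_tmul, Algebra.TensorProduct.tmul_mul_tmul]
      exact tmul_mem_gradedPart (mul_mem_extPow w.2 w'.2) _

theorem restrictMultiVec_mem {u : G} (hu : fixedSpace ρ u ≤ fixedSpace ρ g) {n : ℤ}
    {z : MultiVec k (fixedSpace ρ g)} (hz : z ∈ gradedPart (PolyFun k (fixedSpace ρ g)) _ n) :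
    restrictMultiVec ρ hu z ∈ gradedPart (PolyFun k (fixedSpace ρ u)) (fixedSpace ρ u) n := by
  obtain ⟨z, rfl⟩ := hz
  induction z with
  | zero => simp
  | add a b ha hb => rw [map_add, map_add]; exact add_mem ha hb
  | tmul w a =>
    rw [LinearMap.rTensor_tmul, restrictMultiVec, Algebra.TensorProduct.map_tmul]
    exact tmul_mem_gradedPart (map_mem_extPow _ w.2) _

/-- In `ξ_g s_g ξ_h s_h` the factor `s_g` is moved past `ξ_h`, which gives the sign. Then `s_g s_h =
s_gh` stands on the right and absorbs the difference between multivectors and their projections to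
`V^(gh)`. -/
theorem wedgeWith_mul {N : ℕ} [FiniteDimensional k V] (B : EigenBasis ρ (g * h) N)
    (ho : (orderOf (g * h) : k) ≠ 0)
    (hg : fixedSpace ρ (g * h) ≤ fixedSpace ρ g) (hh : fixedSpace ρ (g * h) ≤ fixedSpace ρ h)
    (sg : ⋀[k]^(codim ρ g) (movingSpace ρ g)) (sh : ⋀[k]^(codim ρ h) (movingSpace ρ h))
    (sgh : ⋀[k]^(codim ρ (g * h)) (movingSpace ρ (g * h)))
    (hs : movingToExt ρ (g * h) sgh = movingToExt ρ g sg * movingToExt ρ h sh) {m n : ℤ}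
    {z : MultiVec k (fixedSpace ρ g)} (hz : z ∈ gradedPart (PolyFun k (fixedSpace ρ g)) _ m)
    {z' : MultiVec k (fixedSpace ρ h)} (hz' : z' ∈ gradedPart (PolyFun k (fixedSpace ρ h)) _ n) :
    LinearMap.lTensor _ (pullback (Submodule.inclusion hg)).toLinearMap
        (wedgeWith ρ g (movingToExt ρ g sg) z) *
      LinearMap.lTensor _ (pullback (Submodule.inclusion hh)).toLinearMap
        (wedgeWith ρ h (movingToExt ρ h sh) z') =
    wedgeWith ρ (g * h) (movingToExt ρ (g * h) sgh)
      ((-1 : k) ^ ((codim ρ g : ℤ) * n) • (restrictMultiVec ρ hg z * restrictMultiVec ρ hh z')) := by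
  rcases lt_or_ge n 0 with hn | hn
  · rw [gradedPart_of_neg hn, Submodule.mem_bot] at hz'
    rw [hz']
    simp
  lift n to ℕ using hn
  obtain ⟨z, rfl⟩ := hz
  obtain ⟨z', rfl⟩ := hz'
  induction z with
  | zero => simp
  | add a b ha hb => simp only [map_add, add_mul, smul_add, ha, hb]
  | tmul w a =>
    induction z' with
    | zero => simp
    | add a b ha hb => simp only [map_add, mul_add, smul_add, ha, hb]
    | tmul w' a' =>
      have hcomm := mul_comm_of_mem (movingToExt_mem sg)
        (map_mem_extPow (fixedSpace ρ h).subtype w'.2)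
      have hT : ∀ x : ExteriorAlgebra k V,
          ExteriorAlgebra.map ((fixedSpace ρ (g * h)).subtype ∘ₗ symmetrization ρ (g * h)) x *
            movingToExt ρ (g * h) sgh = x * movingToExt ρ (g * h) sgh :=
        map_mul_eq _ fun v => B.ι_mul_movingToExt sgh (symmetrization_sub_mem B ho v)
      have hmap : ∀ {u : G} (x : ExteriorAlgebra k (fixedSpace ρ u)),
          ExteriorAlgebra.map (fixedSpace ρ (g * h)).subtype (ExteriorAlgebra.map
            (symmetrization ρ (g * h) ∘ₗ (fixedSpace ρ u).subtype) x) =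
          ExteriorAlgebra.map ((fixedSpace ρ (g * h)).subtype ∘ₗ symmetrization ρ (g * h))
            (ExteriorAlgebra.map (fixedSpace ρ u).subtype x) := fun x => by
        rw [← AlgHom.comp_apply, ← AlgHom.comp_apply, ExteriorAlgebra.map_comp_map,
          ExteriorAlgebra.map_comp_map, LinearMap.comp_assoc]
      rw [LinearMap.rTensor_tmul, LinearMap.rTensor_tmul, restrictMultiVec, restrictMultiVec,
        Algebra.TensorProduct.map_tmul, Algebra.TensorProduct.map_tmul,
        Algebra.TensorProduct.tmul_mul_tmul, map_smul]
      simp only [wedgeWith, LinearMap.rTensor_tmul, LinearMap.lTensor_tmul,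
        Algebra.TensorProduct.tmul_mul_tmul, LinearMap.comp_apply, LinearMap.mulRight_apply,
        AlgHom.toLinearMap_apply, map_mul, hmap, TensorProduct.smul_tmul', Submodule.subtype_apply]
      congr 1
      rw [← map_mul, hT, hs, ← Nat.cast_mul, zpow_natCast]
      simp only [mul_assoc]
      rw [← mul_assoc (movingToExt ρ g sg), hcomm, smul_mul_assoc, mul_smul_comm, mul_assoc]

section Product

variable [FiniteDimensional k V]

/-- Both sides have the same image under the alternation map of `gh`, which is injective. Additivity
of the codimensions ensures that the right-hand side has the degree required there. -/
theorem toMultiVec_cup {N : ℕ} (B : EigenBasis ρ (g * h) N)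
    (ho : (orderOf (g * h) : k) ≠ 0)
    (hg : fixedSpace ρ (g * h) ≤ fixedSpace ρ g) (hh : fixedSpace ρ (g * h) ≤ fixedSpace ρ h)
    (hd : codim ρ (g * h) = codim ρ g + codim ρ h)
    {sg : ⋀[k]^(codim ρ g) (movingSpace ρ g)} {sh : ⋀[k]^(codim ρ h) (movingSpace ρ h)}
    {sgh : ⋀[k]^(codim ρ (g * h)) (movingSpace ρ (g * h))} (hsgh : sgh ≠ 0)
    (hs : movingToExt ρ (g * h) sgh = movingToExt ρ g sg * movingToExt ρ h sh) {i j : ℕ}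
    {φ : Cochain k (PolyFun k V) (Component ρ g) i} {ψ : Cochain k (PolyFun k V) (Component ρ h) j}
    {z : extPow k (fixedSpace ρ g) ((i : ℤ) - codim ρ g) ⊗[k] PolyFun k (fixedSpace ρ g)}
    {z' : extPow k (fixedSpace ρ h) ((j : ℤ) - codim ρ h) ⊗[k] PolyFun k (fixedSpace ρ h)}
    {z'' : extPow k (fixedSpace ρ (g * h)) (((i + j : ℕ) : ℤ) - codim ρ (g * h)) ⊗[k]
      PolyFun k (fixedSpace ρ (g * h))}
    (hz : alternation g (movingToExt ρ g sg) i z = altEvalMap ρ g φ)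
    (hz' : alternation h (movingToExt ρ h sh) j z' = altEvalMap ρ h ψ)
    (hz'' : alternation (g * h) (movingToExt ρ (g * h) sgh) (i + j) z'' =
      altEvalMap ρ (g * h) (cupCochain (componentMul ρ g h) i j φ ψ)) :
    toMultiVec z'' = (-1 : k) ^ ((codim ρ g : ℤ) * ((j : ℤ) - codim ρ h)) •
      (restrictMultiVec ρ hg (toMultiVec z) * restrictMultiVec ρ hh (toMultiVec z')) := by
  have hmem := mul_mem_gradedPart (restrictMultiVec_mem hg ⟨z, rfl⟩)
    (restrictMultiVec_mem hh ⟨z', rfl⟩)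
  rw [show (i : ℤ) - codim ρ g + ((j : ℤ) - codim ρ h) =
    ((i + j : ℕ) : ℤ) - codim ρ (g * h) by rw [hd]; push_cast; ring] at hmem
  obtain ⟨y, hy⟩ := Submodule.smul_mem _
    ((-1 : k) ^ ((codim ρ g : ℤ) * ((j : ℤ) - codim ρ h))) hmem
  refine Eq.trans ?_ hy
  refine congrArg toMultiVec (alternation_injective B hsgh (i + j) ?_)
  have hm : ∀ {u : G} (s : ⋀[k]^(codim ρ u) (movingSpace ρ u)) {n : ℕ}
      (z : extPow k (fixedSpace ρ u) ((n : ℤ) - codim ρ u) ⊗[k] PolyFun k (fixedSpace ρ u)),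
      wedgeWith ρ u (movingToExt ρ u s) (toMultiVec z) ∈
        gradedPart (PolyFun k (fixedSpace ρ u)) V n := fun {u} s n z => by
    have := wedgeWith_mem s (z := toMultiVec z) ⟨z, rfl⟩
    rwa [sub_add_cancel] at this
  have h1 : toMultiVec y = _ := hy
  have h2 := wedgeWith_mul B ho hg hh sg sh sgh hs (z := toMultiVec z) ⟨z, rfl⟩
    (z' := toMultiVec z') ⟨z', rfl⟩
  rw [hz'', altEvalMap_cupCochain hg hh, ← hz, ← hz', alternation_apply, alternation_apply,
    alternation_apply, h1, compAlternatingMap_evalForms, compAlternatingMap_evalForms,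
    ← evalForms_mul (lTensor_mem_gradedPart _ (hm sg z)) (lTensor_mem_gradedPart _ (hm sh z')), h2]
  rfl

/-- If `V^g` and `V^h` do not meet transversally, all products vanish. -/
theorem altCoeff_cupCochain_eq_zero {N : ℕ} (Bg : EigenBasis ρ g N) (Bh : EigenBasis ρ h N)
    {v : V} (hv : v ≠ 0) (hvg : v ∈ movingSpace ρ g) (hvh : v ∈ movingSpace ρ h)
    (sg : ⋀[k]^(codim ρ g) (movingSpace ρ g)) (sh : ⋀[k]^(codim ρ h) (movingSpace ρ h)) {i j : ℕ}
    {φ : Cochain k (PolyFun k V) (Component ρ g) i} {ψ : Cochain k (PolyFun k V) (Component ρ h) j}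
    {z : extPow k (fixedSpace ρ g) ((i : ℤ) - codim ρ g) ⊗[k] PolyFun k (fixedSpace ρ g)}
    {z' : extPow k (fixedSpace ρ h) ((j : ℤ) - codim ρ h) ⊗[k] PolyFun k (fixedSpace ρ h)}
    (hφ : altCoeff ρ g φ = evalForms _ i (LinearMap.lTensor _
      (pullback (symmetrization ρ g)).toLinearMap
        (wedgeWith ρ g (movingToExt ρ g sg) (toMultiVec z))))
    (hψ : altCoeff ρ h ψ = evalForms _ j (LinearMap.lTensor _
      (pullback (symmetrization ρ h)).toLinearMap
        (wedgeWith ρ h (movingToExt ρ h sh) (toMultiVec z')))) :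
    altCoeff ρ (g * h) (cupCochain (componentMul ρ g h) i j φ ψ) = 0 := by
  rw [altCoeff_cupCochain, hφ, hψ, compAlternatingMap_evalForms]
  have hm : ∀ {u : G} (s : ⋀[k]^(codim ρ u) (movingSpace ρ u)) {n : ℕ}
      (z : extPow k (fixedSpace ρ u) ((n : ℤ) - codim ρ u) ⊗[k] PolyFun k (fixedSpace ρ u)),
      wedgeWith ρ u (movingToExt ρ u s) (toMultiVec z) ∈
        gradedPart (PolyFun k (fixedSpace ρ u)) V n := fun {u} s n z => by
    have := wedgeWith_mem s (z := toMultiVec z) ⟨z, rfl⟩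
    rwa [sub_add_cancel] at this
  rw [← evalForms_mul (lTensor_mem_gradedPart _ (hm sg z))
    (lTensor_mem_gradedPart _ (lTensor_mem_gradedPart _ (hm sh z')))]
  -- Contracting `v ∧ s_h = 0` with a form of value `1` at `v` exhibits `v` as a factor of `s_h`.
  have hsv : ∃ t, movingToExt ρ h sh = ExteriorAlgebra.ι k v * t := by
    obtain ⟨e, he⟩ : ∃ e : Dual k V, e v = 1 := by
      obtain ⟨e, he⟩ := not_forall.1 fun h => hv ((Module.forall_dual_apply_eq_zero_iff k v).1 h)
      exact ⟨(e v)⁻¹ • e, by rw [LinearMap.smul_apply, smul_eq_mul, inv_mul_cancel₀ he]⟩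
    have h1 := congrArg (contract e) (Bh.ι_mul_movingToExt sh hvh)
    rw [contract_ι_mul, he, one_smul, map_zero, sub_eq_zero] at h1
    exact ⟨_, h1⟩
  obtain ⟨t, ht⟩ := hsv
  suffices H : ∀ (x : MultiVec k (fixedSpace ρ g)) (x' : MultiVec k (fixedSpace ρ h)),
      LinearMap.lTensor _ (pullback (symmetrization ρ g)).toLinearMap
          (wedgeWith ρ g (movingToExt ρ g sg) x) *
        LinearMap.lTensor _ (polyAct ρ g).toLinearMap
          (LinearMap.lTensor _ (pullback (symmetrization ρ h)).toLinearMap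
            (wedgeWith ρ h (movingToExt ρ h sh) x')) = 0 by
    rw [H, map_zero]
  intro x x'
  induction x using TensorProduct.induction_on with
  | zero => simp
  | add a b ha hb => simp only [map_add, add_mul, ha, hb, add_zero]
  | tmul w a =>
    induction x' using TensorProduct.induction_on with
    | zero => simp
    | add a b ha hb => simp only [map_add, mul_add, ha, hb, add_zero]
    | tmul w' a' =>
      simp only [wedgeWith, LinearMap.rTensor_tmul, LinearMap.lTensor_tmul,
        Algebra.TensorProduct.tmul_mul_tmul, LinearMap.comp_apply, LinearMap.mulRight_apply,
        AlgHom.toLinearMap_apply]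
      have h0 := mul_ι_mul_eq_zero (Bg.ι_mul_movingToExt sg hvg)
        (ExteriorAlgebra.map (fixedSpace ρ h).subtype w') t
      rw [ht, mul_assoc, ← mul_assoc (movingToExt ρ g sg), h0, mul_zero, TensorProduct.zero_tmul]

end Product

end Cup

section Transversality

variable {k V G : Type*} [Field k] [AddCommGroup V] [Module k V] [Group G]
  {ρ : Representation k G V} {g h : G} {N : ℕ}

theorem EigenBasis.range_sub (B : EigenBasis ρ g N) :
    LinearMap.range (ρ g - LinearMap.id) = movingSpace ρ g := by
  apply le_antisymm
  · rintro _ ⟨v, rfl⟩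
    rw [B.mem_movingSpace]
    intro l hl
    rw [LinearMap.sub_apply, map_sub, B.coord_apply, hl, one_mul, LinearMap.id_apply, sub_self]
  · intro v hv
    rw [B.mem_movingSpace] at hv
    rw [← B.b.sum_repr v]
    refine Submodule.sum_mem _ fun l _ => ?_
    by_cases hl : B.μ l = 1
    · have := hv l hl
      rw [Basis.coord_apply] at this
      rw [this, zero_smul]
      exact zero_mem _
    · refine Submodule.smul_mem _ _ ⟨(B.μ l - 1)⁻¹ • B.b l, ?_⟩
      rw [map_smul, LinearMap.sub_apply, B.apply_b, LinearMap.id_apply,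
        show B.μ l • B.b l - B.b l = (B.μ l - 1) • B.b l by rw [sub_smul, one_smul], smul_smul,
        inv_mul_cancel₀ (sub_ne_zero.2 hl), one_smul]

theorem apply_sub_mem_movingSpace (B : EigenBasis ρ g N) (v : V) : ρ g v - v ∈ movingSpace ρ g := by
  rw [← B.range_sub]
  exact ⟨v, rfl⟩

theorem movingSpace_mul_le (Bg : EigenBasis ρ g N) (Bh : EigenBasis ρ h N)
    (Bgh : EigenBasis ρ (g * h) N) :
    movingSpace ρ (g * h) ≤ movingSpace ρ g ⊔ movingSpace ρ h := by
  rw [← Bgh.range_sub]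
  rintro _ ⟨v, rfl⟩
  have : (ρ (g * h) - LinearMap.id : V →ₗ[k] V) v = (ρ g (ρ h v) - ρ h v) + (ρ h v - v) := by
    rw [map_mul, LinearMap.sub_apply, Module.End.mul_apply, LinearMap.id_apply]
    abel
  rw [this]
  exact Submodule.add_mem_sup (apply_sub_mem_movingSpace Bg _) (apply_sub_mem_movingSpace Bh _)

/-- If `g h v = v`, then `h v - v` is the negative of `g (h v) - h v`, hence lies in both moving
spaces. -/
theorem fixedSpace_mul_eq (Bg : EigenBasis ρ g N) (Bh : EigenBasis ρ h N)
    (hd : Disjoint (movingSpace ρ g) (movingSpace ρ h)) :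
    fixedSpace ρ (g * h) = fixedSpace ρ g ⊓ fixedSpace ρ h := by
  apply le_antisymm
  · intro v hv
    have hv : ρ (g * h) v = v := hv
    rw [map_mul, Module.End.mul_apply] at hv
    have h1 := apply_sub_mem_movingSpace Bg (ρ h v)
    rw [hv] at h1
    have h2 := apply_sub_mem_movingSpace Bh v
    have h3 : ρ h v - v = 0 := Submodule.disjoint_def.1 hd _ (by rw [← neg_sub]; exact neg_mem h1) h2
    have h4 : ρ h v = v := sub_eq_zero.1 h3
    rw [h4] at hv
    exact ⟨hv, h4⟩
  · rintro v ⟨hv, hv'⟩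
    have hv : ρ g v = v := hv
    have hv' : ρ h v = v := hv'
    change ρ (g * h) v = v
    rw [map_mul, Module.End.mul_apply, hv', hv]

variable {ω : LinearMap.BilinForm k V}

theorem EigenBasis.apply_eq_zero (B : EigenBasis ρ g N)
    (hρ : ∀ (g : G) (v w : V), ω (ρ g v) (ρ g w) = ω v w)
    {v w : V} (hv : v ∈ movingSpace ρ g) (hw : w ∈ fixedSpace ρ g) : ω v w = 0 := by
  rw [← B.range_sub] at hv
  obtain ⟨u, rfl⟩ := hv
  have hw : ρ g w = w := hw
  have := hρ g u w
  rw [hw] at this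
  rw [LinearMap.sub_apply, map_sub, LinearMap.sub_apply, this, LinearMap.id_apply, sub_self]

/-- Moving vectors are orthogonal to fixed ones by invariance. So the fixed component of `v` is
orthogonal to both summands of `V` and vanishes: the moving space is the whole symplectic complement
of `V^g`. -/
theorem EigenBasis.mem_movingSpace_of_forall (B : EigenBasis ρ g N) (hω_alt : ω.IsAlt)
    (hω_nondeg : ω.Nondegenerate) (hρ : ∀ (g : G) (v w : V), ω (ρ g v) (ρ g w) = ω v w)
    {v : V} (hv : ∀ w ∈ fixedSpace ρ g, ω v w = 0) : v ∈ movingSpace ρ g := by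
  have hsup : ∀ v, ∃ a ∈ fixedSpace ρ g, ∃ b ∈ movingSpace ρ g, a + b = v := fun v =>
    Submodule.mem_sup.1 (B.isCompl.sup_eq_top ▸ Submodule.mem_top)
  obtain ⟨a, ha, b, hb, rfl⟩ := hsup v
  suffices h : a = 0 by rwa [h, zero_add]
  refine hω_nondeg.1 a fun w => ?_
  obtain ⟨a', ha', b', hb', rfl⟩ := hsup w
  have h1 := hv a' ha'
  rw [map_add, LinearMap.add_apply, B.apply_eq_zero hρ hb ha', add_zero] at h1
  have h2 := hω_alt.neg_eq b' a
  rw [B.apply_eq_zero hρ hb' ha, neg_zero] at h2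
  rw [map_add, h1, ← h2, add_zero]

/-- The nontrivial inclusion comes from passing to symplectic complements in `V^(gh) = V^g ∩ V^h`.
-/
theorem movingSpace_mul_eq (Bg : EigenBasis ρ g N) (Bh : EigenBasis ρ h N)
    (Bgh : EigenBasis ρ (g * h) N) (hω_alt : ω.IsAlt) (hω_nondeg : ω.Nondegenerate)
    (hρ : ∀ (g : G) (v w : V), ω (ρ g v) (ρ g w) = ω v w)
    (hd : Disjoint (movingSpace ρ g) (movingSpace ρ h)) :
    movingSpace ρ (g * h) = movingSpace ρ g ⊔ movingSpace ρ h := by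
  refine le_antisymm (movingSpace_mul_le Bg Bh Bgh) ?_
  have hf := fixedSpace_mul_eq Bg Bh hd
  refine sup_le (fun v hv => ?_) fun v hv => ?_
  · exact Bgh.mem_movingSpace_of_forall hω_alt hω_nondeg hρ fun w hw =>
      Bg.apply_eq_zero hρ hv (hf.le hw).1
  · exact Bgh.mem_movingSpace_of_forall hω_alt hω_nondeg hρ fun w hw =>
      Bh.apply_eq_zero hρ hv (hf.le hw).2

theorem codim_mul_eq [FiniteDimensional k V] (Bg : EigenBasis ρ g N) (Bh : EigenBasis ρ h N)
    (Bgh : EigenBasis ρ (g * h) N) (hω_alt : ω.IsAlt) (hω_nondeg : ω.Nondegenerate)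
    (hρ : ∀ (g : G) (v w : V), ω (ρ g v) (ρ g w) = ω v w)
    (hd : Disjoint (movingSpace ρ g) (movingSpace ρ h)) :
    codim ρ (g * h) = codim ρ g + codim ρ h := by
  rw [← Bgh.finrank_movingSpace_eq_codim, ← Bg.finrank_movingSpace_eq_codim,
    ← Bh.finrank_movingSpace_eq_codim, movingSpace_mul_eq Bg Bh Bgh hω_alt hω_nondeg hρ hd,
    ← Submodule.finrank_sup_add_finrank_inf_eq, hd.eq_bot, finrank_bot, add_zero]

/-- The moving space of `gh` lies in the sum of the other two, so its dimension can reach `d_g +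
d_h` only if the sum is direct. -/
theorem disjoint_of_codim_mul_eq [FiniteDimensional k V] (Bg : EigenBasis ρ g N)
    (Bh : EigenBasis ρ h N) (Bgh : EigenBasis ρ (g * h) N)
    (hd : codim ρ (g * h) = codim ρ g + codim ρ h) :
    Disjoint (movingSpace ρ g) (movingSpace ρ h) := by
  rw [← Bgh.finrank_movingSpace_eq_codim, ← Bg.finrank_movingSpace_eq_codim,
    ← Bh.finrank_movingSpace_eq_codim] at hd
  have h1 := Submodule.finrank_sup_add_finrank_inf_eq (movingSpace ρ g) (movingSpace ρ h)
  have h2 := Submodule.finrank_mono (movingSpace_mul_le Bg Bh Bgh)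
  rw [disjoint_iff, ← Submodule.finrank_eq_zero (R := k)]
  omega

end Transversality

end Symplectic

/-! ### Vanishing of products over intersecting moving spaces. -/

namespace Symplectic

open Koszul Module Hochschild MulOpposite

section Main

variable {k V G : Type*} [Field k] [AddCommGroup V] [Module k V] [Group G]
  {ρ : Representation k G V} [FiniteDimensional k V]

theorem factorial_ne_zero_of_lt_ringChar {n : ℕ} (h : ringChar k = 0 ∨ n < ringChar k) :
    ∀ m ≤ n, (m.factorial : k) ≠ 0 := by
  intro m hm h0
  have h1 := (ringChar.spec k _).1 h0
  rcases h with h | h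
  · rw [h, zero_dvd_iff] at h1
    exact m.factorial_ne_zero h1
  · have hp : (ringChar k).Prime := by
      rcases CharP.char_is_prime_or_zero k (ringChar k) with h' | h'
      · exact h'
      · omega
    have := (hp.dvd_factorial).1 h1
    omega

theorem orderOf_ne_zero_of_lt_ringChar [Finite G] (h : ringChar k = 0 ∨ Nat.card G < ringChar k)
    (g : G) : (orderOf g : k) ≠ 0 := by
  intro h0
  have h1 := (ringChar.spec k _).1 h0
  have h2 := orderOf_pos g
  rcases h with h | h
  · rw [h, zero_dvd_iff] at h1
    omega
  · have h3 := Nat.le_of_dvd h2 h1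
    have h4 := Nat.le_of_dvd Nat.card_pos (orderOf_dvd_natCard g)
    omega

theorem cup_eq_zero_of_not_disjoint {g h : G} (ho : ∀ g : G, (orderOf g : k) ≠ 0)
    (hfac : ∀ m ≤ finrank k V, (m.factorial : k) ≠ 0)
    (B : ∀ g : G, EigenBasis ρ g (finrank k V))
    {s : ∀ g : G, ⋀[k]^(codim ρ g) (movingSpace ρ g)} (hs : ∀ g, s g ≠ 0)
    (hd : ¬ Disjoint (movingSpace ρ g) (movingSpace ρ h)) (i j : ℕ)
    (x : Cohomology k (PolyFun k V) (Component ρ g) i)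
    (y : Cohomology k (PolyFun k V) (Component ρ h) j) :
    cup (componentMul ρ g h) i j x y = 0 := by
  -- Here `V^(gh)` need not lie in `V^g`, so restricted alternations are not enough. Each class is
  -- represented by a cocycle whose alternation is constant along `π^g`, which makes the factor
  -- `s_g` visible on all of `V`.
  have key : ∀ (g : G) (i : ℕ) (x : Cohomology k (PolyFun k V) (Component ρ g) i),
      ∃ (φ : cocycles k (PolyFun k V) (Component ρ g) i) (z : _), cls φ = x ∧
        altCoeff ρ g φ.1 = evalForms _ i (LinearMap.lTensor _
          (pullback (symmetrization ρ g)).toLinearMap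
            (wedgeWith ρ g (movingToExt ρ g (s g)) (toMultiVec
              (n := (i : ℤ) - codim ρ g) z))) := by
    intro g i x
    let e := cohomologyEquiv (ho g) hfac (B g) (hs g) i
    obtain ⟨φ, hφ, h1, h2⟩ := exists_altCoeff_eq_evalForms (ho g) hfac (B g) (s g) i (e x)
    refine ⟨⟨φ, hφ⟩, e x, e.injective (alternation_injective (B g) (hs g) i ?_), h1⟩
    rw [alternation_cohomologyEquiv, h2]
  obtain ⟨φ, z, rfl, h1⟩ := key g i x
  obtain ⟨ψ, z', rfl, h2⟩ := key h j y
  rw [Submodule.disjoint_def] at hd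
  push Not at hd
  obtain ⟨v, hvg, hvh, hv⟩ := hd
  rw [cup_cls]
  refine (Submodule.Quotient.mk_eq_zero _).2 ?_
  refine mem_coboundaries_of_altEvalMap_eq_zero (B (g * h))
    (cupCochain_mem_cocycles _ φ.2 ψ.2) ?_
  rw [Submodule.subtype_apply, altEvalMap_eq, altCoeff_cupCochain_eq_zero (B g) (B h)
    hv hvg hvh (s g) (s h) h1 h2]
  ext y
  simp

end Main

end Symplectic

/-! ### Frames of moving spaces and Wall's form. -/

namespace Symplectic

open Koszul Module Hochschild MulOpposite

section Frames

variable {k V : Type*} [Field k] [AddCommGroup V] [Module k V]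

theorem pairForms_ιMulti_eq_det {n : ℕ} (y : Fin n → Dual k V) (u : Fin n → V) :
    pairForms y (ExteriorAlgebra.ιMulti k n u) = (Matrix.of fun p q => y q (u p)).det := by
  rw [pairForms, ExteriorAlgebra.liftAlternating_apply_ιMulti, Pi.single_eq_same]
  rfl

theorem ιMulti_append {m n : ℕ} (u : Fin m → V) (w : Fin n → V) :
    ExteriorAlgebra.ιMulti k (m + n) (Fin.append u w) =
      ExteriorAlgebra.ιMulti k m u * ExteriorAlgebra.ιMulti k n w := by
  rw [ExteriorAlgebra.ιMulti_apply, ExteriorAlgebra.ιMulti_apply, ExteriorAlgebra.ιMulti_apply,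
    ← List.prod_append, ← List.ofFn_fin_append]
  congr 2
  funext i
  refine Fin.addCases (fun i => ?_) (fun i => ?_) i <;> simp

theorem exists_dual_forms {n : ℕ} {u : Fin n → V} (hu : LinearIndependent k u) :
    ∃ y : Fin n → Dual k V, (Matrix.of fun p q => y q (u p)) = 1 := by
  choose y hy using fun i => LinearMap.exists_extend ((Basis.span hu).coord i)
  refine ⟨y, ?_⟩
  ext p q
  have h : u p = (Basis.span hu p : V) := by rw [Basis.span_apply]
  have h2 := LinearMap.congr_fun (hy q) (Basis.span hu p)
  rw [Matrix.of_apply, h]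
  refine h2.trans ?_
  rw [Basis.coord_apply, Basis.repr_self, Finsupp.single_apply, Matrix.one_apply]

/-- On the span of `u` every alternating map of `n` vectors is a multiple of the determinant in the
basis `u`. -/
theorem exists_ιMulti_eq_smul {n : ℕ} {u w : Fin n → V} (hu : LinearIndependent k u)
    (hw : ∀ i, w i ∈ Submodule.span k (Set.range u)) :
    ∃ c : k, ExteriorAlgebra.ιMulti k n w = c • ExteriorAlgebra.ιMulti k n u := by
  classical
  set e := Basis.span hu
  have h : (ExteriorAlgebra.ιMulti k n).compLinearMap (Submodule.span k (Set.range u)).subtype =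
      (LinearMap.toSpanSingleton k _ (ExteriorAlgebra.ιMulti k n u)).compAlternatingMap e.det := by
    refine Basis.ext_alternating e fun v hv => ?_
    obtain ⟨σ, rfl⟩ : ∃ σ : Equiv.Perm (Fin n), v = σ :=
      ⟨Equiv.ofBijective v (Finite.injective_iff_bijective.1 hv), rfl⟩
    have h2 : (fun i => e (σ i)) = e ∘ σ := rfl
    rw [h2, LinearMap.compAlternatingMap_apply, AlternatingMap.map_perm, AlternatingMap.map_perm,
      e.det_self, LinearMap.toSpanSingleton_apply, AlternatingMap.compLinearMap_apply]
    have h3 : (fun i => (e i : V)) = u := by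
      funext i
      simp [e, Basis.span_apply]
    change Equiv.Perm.sign σ • ExteriorAlgebra.ιMulti k n (fun i => (e i : V)) = _
    rw [h3]
    rcases Int.units_eq_one_or (Equiv.Perm.sign σ) with h | h <;> simp [h]
  have := AlternatingMap.congr_fun h fun i => ⟨w i, hw i⟩
  exact ⟨_, this⟩

end Frames

section Wall

variable {k V G : Type*} [Field k] [AddCommGroup V] [Module k V] [Group G]
  (ρ : Representation k G V) (ω : LinearMap.BilinForm k V)

/-- The multivector `(x₁ - g x₁) ∧ … ∧ (xₙ - g xₙ)`. -/
def frameVec (g : G) {n : ℕ} (x : Fin n → V) : ExteriorAlgebra k V :=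
  ExteriorAlgebra.ιMulti k n fun i => x i - ρ g (x i)

/-- The vectors `xᵢ - g xᵢ` form a basis of the moving space of `g`. -/
structure IsFrame (g : G) {n : ℕ} (x : Fin n → V) : Prop where
  linearIndependent : LinearIndependent k fun i => x i - ρ g (x i)
  span_eq : Submodule.span k (Set.range fun i => x i - ρ g (x i)) = movingSpace ρ g

/-- The determinant of Wall's form `(x - g x, y - g y) ↦ ω(x, y - g y)` of `g`. -/
def wall (g : G) {n : ℕ} (x : Fin n → V) : k :=
  (Matrix.of fun i j => ω (x i) (x j - ρ g (x j))).det

variable {ρ ω} {g h : G} {n : ℕ}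

theorem IsFrame.mem {x : Fin n → V} (hx : IsFrame ρ g x) (i : Fin n) :
    x i - ρ g (x i) ∈ movingSpace ρ g := by
  rw [← hx.span_eq]
  exact Submodule.subset_span ⟨i, rfl⟩

theorem frameVec_ne_zero {x : Fin n → V} (hx : IsFrame ρ g x) : frameVec ρ g x ≠ 0 := by
  intro h0
  obtain ⟨y, hy⟩ := exists_dual_forms hx.linearIndependent
  have := pairForms_ιMulti_eq_det y fun i => x i - ρ g (x i)
  rw [hy, Matrix.det_one] at this
  change pairForms y (frameVec ρ g x) = 1 at this
  rw [h0, map_zero] at this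
  exact zero_ne_one this

theorem pairForms_frameVec (x w : Fin n → V) :
    pairForms (fun i => ω (x i)) (frameVec ρ g w) =
      (Matrix.of fun i j => ω (x i) (w j - ρ g (w j))).det := by
  rw [frameVec, pairForms_ιMulti_eq_det, ← Matrix.det_transpose]
  rfl

/-- A determinant depends on the vectors in the second slot only through their frame multivector.
The identity `ω(a, b - g b) = ω(g b, a - g a)` exchanges the slots, so each slot contributes one
factor `c`. -/
theorem wall_eq_of_frameVec_eq_smul (hω : ω.IsAlt)
    (hρ : ∀ (g : G) (v w : V), ω (ρ g v) (ρ g w) = ω v w) {x z : Fin n → V} {c : k}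
    (hxz : frameVec ρ g x = c • frameVec ρ g z) : wall ρ ω g x = c ^ 2 * wall ρ ω g z := by
  have key : ∀ a b : V, ω a (b - ρ g b) = ω (ρ g b) (a - ρ g a) := fun a b => by
    rw [map_sub, map_sub, hρ, ← hω.neg_eq (ρ g b) a, ← hω.neg_eq b a]
    ring
  have swap : ∀ a b : Fin n → V, (Matrix.of fun i j => ω (a i) (b j - ρ g (b j))).det =
      (Matrix.of fun i j => ω (ρ g (b i)) (a j - ρ g (a j))).det := fun a b => by
    rw [← Matrix.det_transpose]
    congr 1
    ext i j
    exact key _ _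
  rw [wall, ← pairForms_frameVec x x, hxz, map_smul, pairForms_frameVec, swap,
    ← pairForms_frameVec, hxz, map_smul, pairForms_frameVec (fun i => ρ g (z i)) z, ← swap,
    smul_smul, wall, sq, smul_eq_mul]

/-- A kernel vector of the matrix gives a moving vector `v` orthogonal to all `x i`, and `v` is
orthogonal to `V^g` anyway. The `x i` and `V^g` together span `V`, so `v` lies in the radical of
`ω`. -/
theorem wall_ne_zero {N : ℕ} (B : EigenBasis ρ g N) (hω_alt : ω.IsAlt)
    (hω_nondeg : ω.Nondegenerate) (hρ : ∀ (g : G) (v w : V), ω (ρ g v) (ρ g w) = ω v w)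
    {x : Fin n → V} (hx : IsFrame ρ g x) : wall ρ ω g x ≠ 0 := by
  intro h0
  obtain ⟨c, hc, hM⟩ := Matrix.exists_mulVec_eq_zero_iff.2 h0
  set v := ∑ j, c j • (x j - ρ g (x j)) with hv
  have hvI : v ∈ movingSpace ρ g :=
    Submodule.sum_mem _ fun j _ => Submodule.smul_mem _ _ (hx.mem j)
  have hx0 : ∀ i, ω (x i) v = 0 := by
    intro i
    have := congrFun hM i
    rw [Matrix.mulVec, dotProduct] at this
    rw [hv, map_sum]
    simpa [mul_comm] using this
  have hF0 : ∀ a ∈ fixedSpace ρ g, ω a v = 0 := fun a ha => by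
    rw [← hω_alt.neg_eq, B.apply_eq_zero hρ hvI ha, neg_zero]
  have hv0 : v = 0 := by
    refine hω_nondeg.2 _ fun a => ?_
    have ha : a - ρ g a ∈ movingSpace ρ g := by
      rw [← neg_sub]
      exact neg_mem (apply_sub_mem_movingSpace B a)
    rw [← hx.span_eq, Submodule.mem_span_range_iff_exists_fun] at ha
    obtain ⟨e, he⟩ := ha
    have hmem : a - ∑ i, e i • x i ∈ fixedSpace ρ g := by
      change ρ g _ = _
      simp only [smul_sub, Finset.sum_sub_distrib] at he
      simp only [map_sub, map_sum, map_smul]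
      linear_combination (norm := module) he
    have := hF0 _ hmem
    rw [LinearMap.BilinForm.sub_left, map_sum ω, LinearMap.sum_apply] at this
    simpa [hx0] using this
  exact hc (funext (Fintype.linearIndependent_iff.1 hx.linearIndependent c hv0))

/-- The concatenated frame of `g` and `h` is written as `w - g h w`. With these `w` the matrix of
Wall's form of `gh` is block triangular with the matrices of `g` and `h` on the diagonal, so its
determinant is their product; passing to the given frame `z` costs `c ^ 2`. -/
theorem exists_frameVec_mul_eq {N m n l : ℕ} (Bg : EigenBasis ρ g N) (Bh : EigenBasis ρ h N)
    (Bgh : EigenBasis ρ (g * h) N) (hω_alt : ω.IsAlt) (hω_nondeg : ω.Nondegenerate)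
    (hρ : ∀ (g : G) (v w : V), ω (ρ g v) (ρ g w) = ω v w)
    (hd : Disjoint (movingSpace ρ g) (movingSpace ρ h)) {x : Fin m → V} {y : Fin n → V}
    {z : Fin l → V} (hx : IsFrame ρ g x) (hy : IsFrame ρ h y) (hz : IsFrame ρ (g * h) z)
    (hl : l = m + n) :
    ∃ c : k, c ≠ 0 ∧ frameVec ρ g x * frameVec ρ h y = c • frameVec ρ (g * h) z ∧
      wall ρ ω g x * wall ρ ω h y = c ^ 2 * wall ρ ω (g * h) z := by
  subst hl
  have hI := movingSpace_mul_eq Bg Bh Bgh hω_alt hω_nondeg hρ hd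
  set u := fun i => x i - ρ g (x i) with hu
  set v := fun i => y i - ρ h (y i) with hv
  have huv : ∀ i, Fin.append u v i ∈ movingSpace ρ (g * h) := by
    intro i
    rw [hI]
    refine Fin.addCases (fun i => ?_) (fun i => ?_) i
    · rw [Fin.append_left]
      exact Submodule.mem_sup_left (hx.mem i)
    · rw [Fin.append_right]
      exact Submodule.mem_sup_right (hy.mem i)
  have hpre : ∀ i, ∃ w, w - ρ (g * h) w = Fin.append u v i := by
    intro i
    have := huv i
    rw [← Bgh.range_sub] at this
    obtain ⟨w, hw⟩ := this
    refine ⟨-w, ?_⟩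
    rw [← hw, LinearMap.sub_apply, map_neg, LinearMap.id_apply]
    abel
  choose w hw using hpre
  have hwprod : frameVec ρ (g * h) w = frameVec ρ g x * frameVec ρ h y := by
    rw [frameVec, frameVec, frameVec, ← ιMulti_append]
    exact congrArg _ (funext hw)
  obtain ⟨c, hc⟩ := exists_ιMulti_eq_smul (w := Fin.append u v) hz.linearIndependent (by
    rw [hz.span_eq]
    exact huv)
  have hc : frameVec ρ g x * frameVec ρ h y = c • frameVec ρ (g * h) z := by
    rw [frameVec, frameVec, ← ιMulti_append]
    exact hc
  have hF : ∀ {g : G} {a b : V}, a - ρ g a = b - ρ g b → a - b ∈ fixedSpace ρ g := by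
    intro g a b hab
    change ρ g (a - b) = a - b
    rw [map_sub]
    linear_combination (norm := module) -hab
  -- From `a - g h a = (h a - g (h a)) + (a - h a)`: the decomposition into moving vectors of `g`
  -- and of `h` is unique.
  have hsplit : ∀ a b c : V, a - ρ (g * h) a = b + c → b ∈ movingSpace ρ g →
      c ∈ movingSpace ρ h → a - ρ h a = c ∧ ρ h a - ρ g (ρ h a) = b := by
    intro a b c ha hb hc
    rw [map_mul, Module.End.mul_apply] at ha
    have h1 : b - (ρ h a - ρ g (ρ h a)) = (a - ρ h a) - c := by
      linear_combination (norm := module) -ha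
    have h2 : b - (ρ h a - ρ g (ρ h a)) ∈ movingSpace ρ g := by
      refine sub_mem hb ?_
      rw [← neg_sub]
      exact neg_mem (apply_sub_mem_movingSpace Bg _)
    have h3 : b - (ρ h a - ρ g (ρ h a)) ∈ movingSpace ρ h := by
      rw [h1]
      refine sub_mem ?_ hc
      rw [← neg_sub]
      exact neg_mem (apply_sub_mem_movingSpace Bh _)
    have h4 := Submodule.disjoint_def.1 hd _ h2 h3
    exact ⟨sub_eq_zero.1 (h1 ▸ h4), (sub_eq_zero.1 h4).symm⟩
  have hωF : ∀ {g : G} (_ : EigenBasis ρ g N) {a b c : V}, a - b ∈ fixedSpace ρ g →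
      c ∈ movingSpace ρ g → ω a c = ω b c := by
    intro g B a b c ha hc
    have h1 := B.apply_eq_zero hρ hc ha
    rw [← hω_alt.neg_eq, neg_eq_zero, map_sub, LinearMap.sub_apply] at h1
    exact sub_eq_zero.1 h1
  have hl : ∀ i : Fin m, w (Fin.castAdd n i) ∈ fixedSpace ρ h ∧
      w (Fin.castAdd n i) - x i ∈ fixedSpace ρ g := by
    intro i
    obtain ⟨h1, h2⟩ := hsplit (w (Fin.castAdd n i)) (u i) 0 (by
      rw [hw, Fin.append_left, add_zero]) (hx.mem i) (zero_mem _)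
    have h3 := (sub_eq_zero.1 h1).symm
    rw [h3] at h2
    exact ⟨h3, hF h2⟩
  have hr : ∀ i : Fin n, w (Fin.natAdd m i) - y i ∈ fixedSpace ρ h := by
    intro i
    obtain ⟨h1, -⟩ := hsplit (w (Fin.natAdd m i)) 0 (v i) (by
      rw [hw, Fin.append_right, zero_add]) (zero_mem _) (hy.mem i)
    exact hF h1
  have hdet : wall ρ ω (g * h) w = wall ρ ω g x * wall ρ ω h y := by
    rw [wall, wall, wall, ← Matrix.det_fromBlocks_zero₁₂ _
      (Matrix.of fun i j => ω (w (Fin.natAdd m i)) (u j)), ← Matrix.det_reindex_self finSumFinEquiv]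
    congr 1
    ext i j
    rw [Matrix.of_apply, hw]
    refine Fin.addCases (fun i => ?_) (fun i => ?_) i <;>
      refine Fin.addCases (fun j => ?_) (fun j => ?_) j
    · have := hωF Bg (hl i).2 (hx.mem j)
      simp only [Fin.append_left]
      simpa [-map_sub] using this
    · have := hωF Bh (b := 0) (by simpa using (hl i).1) (hy.mem j)
      rw [map_zero, LinearMap.zero_apply] at this
      simpa [-map_sub] using this
    · simp
    · have := hωF Bh (hr i) (hy.mem j)
      simpa [-map_sub] using this
  have hsq : wall ρ ω g x * wall ρ ω h y = c ^ 2 * wall ρ ω (g * h) z := by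
    rw [← hdet]
    exact wall_eq_of_frameVec_eq_smul hω_alt hρ (hwprod.trans hc)
  refine ⟨c, fun h0 => ?_, hc, hsq⟩
  rw [h0, sq, zero_mul, zero_mul] at hsq
  exact mul_ne_zero (wall_ne_zero Bg hω_alt hω_nondeg hρ hx)
    (wall_ne_zero Bh hω_alt hω_nondeg hρ hy) hsq

end Wall

end Symplectic

/-! ### Multivectors of quaternionic subspaces. -/

namespace Symplectic

open Koszul Module Hochschild MulOpposite

section Quaternionic

open scoped ComplexConjugate

variable {W : Type*} [AddCommGroup W] [Module ℂ W] (j : W →ₗ⋆[ℂ] W)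

/-- The bivector `v ∧ j v`. -/
def quatPair (v : W) : ExteriorAlgebra ℂ W := ExteriorAlgebra.ι ℂ v * ExteriorAlgebra.ι ℂ (j v)

/-- The multivector `v₁ ∧ j v₁ ∧ v₂ ∧ j v₂ ∧ …`. -/
def quatProd (L : List W) : ExteriorAlgebra ℂ W := (L.map (quatPair j)).prod

/-- The quaternionic span of the members of a list. -/
def quatSpan (L : List W) : Submodule ℂ W := Submodule.span ℂ {w | ∃ v ∈ L, w = v ∨ w = j v}

theorem quatProd_cons (v : W) (L : List W) :
    quatProd j (v :: L) = quatPair j v * quatProd j L := by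
  simp [quatProd]

theorem quatProd_append (L L' : List W) :
    quatProd j (L ++ L') = quatProd j L * quatProd j L' := by
  simp [quatProd]

theorem quatSpan_nil : quatSpan j [] = ⊥ := by
  simp [quatSpan]

theorem quatSpan_cons (v : W) (L : List W) :
    quatSpan j (v :: L) = Submodule.span ℂ {v, j v} ⊔ quatSpan j L := by
  rw [quatSpan, quatSpan, ← Submodule.span_union]
  congr 1
  ext w
  simp [or_and_right, exists_or]

theorem mem_quatSpan_cons {v w : W} {L : List W} :
    w ∈ quatSpan j (v :: L) ↔
      ∃ (a b : ℂ) (w' : W), w' ∈ quatSpan j L ∧ w = a • v + b • j v + w' := by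
  rw [quatSpan_cons, Submodule.mem_sup]
  constructor
  · rintro ⟨y, hy, z, hz, rfl⟩
    obtain ⟨a, b, rfl⟩ := Submodule.mem_span_pair.1 hy
    exact ⟨a, b, z, hz, rfl⟩
  · rintro ⟨a, b, z, hz, rfl⟩
    exact ⟨_, Submodule.mem_span_pair.2 ⟨a, b, rfl⟩, z, hz, rfl⟩

theorem ι_mul_ι_comm (v w : W) : ExteriorAlgebra.ι ℂ v * ExteriorAlgebra.ι ℂ w =
    -(ExteriorAlgebra.ι ℂ w * ExteriorAlgebra.ι ℂ v) :=
  eq_neg_of_add_eq_zero_left (ExteriorAlgebra.ι_add_mul_swap v w)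

theorem ι_mul_quatPair (v w : W) :
    ExteriorAlgebra.ι ℂ w * quatPair j v = quatPair j v * ExteriorAlgebra.ι ℂ w := by
  rw [quatPair, ← mul_assoc, ι_mul_ι_comm w v, neg_mul, mul_assoc, ι_mul_ι_comm w, mul_neg,
    neg_neg, mul_assoc]

theorem quatPair_mul_comm (v w : W) :
    quatPair j w * quatPair j v = quatPair j v * quatPair j w := by
  rw [quatPair, mul_assoc, ι_mul_quatPair, ← mul_assoc, ι_mul_quatPair, mul_assoc, ← quatPair]

theorem ι_mul_quatPair_self (v : W) : ExteriorAlgebra.ι ℂ v * quatPair j v = 0 := by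
  rw [quatPair, ← mul_assoc, ExteriorAlgebra.ι_sq_zero, zero_mul]

theorem ι_apply_mul_quatPair_self (v : W) : ExteriorAlgebra.ι ℂ (j v) * quatPair j v = 0 := by
  rw [ι_mul_quatPair, quatPair, mul_assoc, ExteriorAlgebra.ι_sq_zero, mul_zero]

theorem ι_mul_quatProd {L : List W} {w : W} (hw : w ∈ quatSpan j L) :
    ExteriorAlgebra.ι ℂ w * quatProd j L = 0 := by
  induction L generalizing w with
  | nil =>
    rw [quatSpan_nil, Submodule.mem_bot] at hw
    rw [hw, map_zero, zero_mul]
  | cons v L ih =>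
    obtain ⟨a, b, w', hw', rfl⟩ := (mem_quatSpan_cons j).1 hw
    rw [quatProd_cons, map_add, map_add, map_smul, map_smul, add_mul, add_mul, smul_mul_assoc,
      smul_mul_assoc, ← mul_assoc, ← mul_assoc, ← mul_assoc, ι_mul_quatPair_self,
      ι_apply_mul_quatPair_self, ι_mul_quatPair, mul_assoc, ih hw']
    simp

theorem apply_mem_quatSpan (hj : ∀ v, j (j v) = -v) {L : List W} {w : W}
    (hw : w ∈ quatSpan j L) : j w ∈ quatSpan j L := by
  induction L generalizing w with
  | nil =>
    rw [quatSpan_nil, Submodule.mem_bot] at hw ⊢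
    rw [hw, map_zero]
  | cons v L ih =>
    obtain ⟨a, b, w', hw', rfl⟩ := (mem_quatSpan_cons j).1 hw
    refine (mem_quatSpan_cons j).2 ⟨-conj b, conj a, _, ih hw', ?_⟩
    rw [map_add, map_add, LinearMap.map_smulₛₗ, LinearMap.map_smulₛₗ, hj]
    module

/-- Adding to `v` a vector of a quaternionic subspace does not change `v ∧ j v` modulo that
subspace. -/
theorem quatPair_add_mul {v w : W} {x : ExteriorAlgebra ℂ W} (h1 : ExteriorAlgebra.ι ℂ w * x = 0)
    (h2 : ExteriorAlgebra.ι ℂ (j w) * x = 0) :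
    quatPair j (v + w) * x = quatPair j v * x := by
  have h3 : ExteriorAlgebra.ι ℂ w * (ExteriorAlgebra.ι ℂ (j v) * x) = 0 := by
    rw [← mul_assoc, ι_mul_ι_comm, neg_mul, mul_assoc, h1, mul_zero, neg_zero]
  rw [quatPair, quatPair, map_add, map_add, map_add, mul_assoc, mul_assoc, add_mul, add_mul, mul_add,
    mul_add, h2, h3]
  simp

/-- The matrix expressing `(u, j u)` by `(v, j v)` has determinant `|a|² + |b|²`. All positivity
statements about quaternionic multivectors come from this. -/
theorem quatPair_combination (hj : ∀ v, j (j v) = -v) (a b : ℂ) (v : W) :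
    quatPair j (a • v + b • j v) = ((Complex.normSq a + Complex.normSq b : ℝ) : ℂ) • quatPair j v := by
  rw [quatPair, quatPair, map_add j, LinearMap.map_smulₛₗ, LinearMap.map_smulₛₗ, hj, map_add,
    map_add, map_smul, map_smul, map_smul, map_smul, map_neg, add_mul, mul_add, mul_add]
  simp only [smul_mul_assoc, mul_smul_comm, mul_neg, ExteriorAlgebra.ι_sq_zero, smul_zero,
    neg_zero, add_zero, zero_add, smul_neg, ι_mul_ι_comm (j v) v, neg_neg, smul_smul, ← add_smul]
  congr 1
  push_cast
  rw [← Complex.mul_conj, ← Complex.mul_conj]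
  ring

/-- Steinitz exchange: `v` replaces a member that occurs in it with a nonzero quaternionic
coefficient. The bivectors `u ∧ j u` commute, so reordering the list costs no sign. -/
theorem exists_quatSpan_cons_eq (hj : ∀ v, j (j v) = -v) {v : W} (hv : v ≠ 0) {L : List W}
    (hvL : v ∈ quatSpan j L) :
    ∃ L' : List W, L'.length + 1 = L.length ∧ quatSpan j (v :: L') = quatSpan j L ∧
      ∃ r : ℝ, 0 < r ∧ quatProd j (v :: L') = (r : ℂ) • quatProd j L := by
  induction L with
  | nil =>
    rw [quatSpan_nil, Submodule.mem_bot] at hvL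
    exact absurd hvL hv
  | cons u L ih =>
    obtain ⟨a, b, w, hw, hvw⟩ := (mem_quatSpan_cons j).1 hvL
    by_cases h0 : a = 0 ∧ b = 0
    · obtain ⟨rfl, rfl⟩ := h0
      obtain rfl : v = w := by rw [hvw]; module
      obtain ⟨L', h1, h2, r, hr, h3⟩ := ih hw
      refine ⟨u :: L', by simp [h1], ?_, r, hr, ?_⟩
      · rw [quatSpan_cons, quatSpan_cons, sup_left_comm, ← quatSpan_cons j v, h2, ← quatSpan_cons]
      · rw [quatProd_cons, quatProd_cons, ← mul_assoc, quatPair_mul_comm, mul_assoc,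
          ← quatProd_cons, h3, mul_smul_comm, ← quatProd_cons]
    · have hpos : 0 < Complex.normSq a + Complex.normSq b := by
        rcases not_and_or.1 h0 with h | h
        · exact add_pos_of_pos_of_nonneg (Complex.normSq_pos.2 h) (Complex.normSq_nonneg _)
        · exact add_pos_of_nonneg_of_pos (Complex.normSq_nonneg _) (Complex.normSq_pos.2 h)
      refine ⟨L, rfl, le_antisymm ?_ ?_, _, hpos, ?_⟩
      · rw [quatSpan_cons, sup_le_iff, Submodule.span_le]
        refine ⟨?_, by rw [quatSpan_cons]; exact le_sup_right⟩
        rintro x (rfl | rfl)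
        · exact hvL
        · exact apply_mem_quatSpan j hj hvL
      · have hvm : v ∈ quatSpan j (v :: L) := (mem_quatSpan_cons j).2 ⟨1, 0, 0, zero_mem _, by simp⟩
        have hwm : w ∈ quatSpan j (v :: L) := by
          rw [quatSpan_cons]
          exact Submodule.mem_sup_right hw
        have hvw' : a • u + b • j u ∈ quatSpan j (v :: L) := by
          rw [eq_sub_iff_add_eq.2 hvw.symm]
          exact sub_mem hvm hwm
        -- For `x = a u + b j u`, the combination `conj a · x - b · j x` equals `(|a|² + |b|²) u`.
        have hN : ((Complex.normSq a + Complex.normSq b : ℝ) : ℂ) • u ∈ quatSpan j (v :: L) := by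
          have h1 := apply_mem_quatSpan j hj hvw'
          rw [map_add, LinearMap.map_smulₛₗ, LinearMap.map_smulₛₗ, hj] at h1
          have h2 := sub_mem (Submodule.smul_mem _ (conj a) hvw') (Submodule.smul_mem _ b h1)
          convert h2 using 1
          push_cast
          rw [← Complex.mul_conj, ← Complex.mul_conj]
          module
        have hu : u ∈ quatSpan j (v :: L) := by
          have := Submodule.smul_mem _ ((Complex.normSq a + Complex.normSq b : ℝ) : ℂ)⁻¹ hN
          rwa [smul_smul, inv_mul_cancel₀ (by exact_mod_cast hpos.ne'), one_smul] at this
        rw [quatSpan_cons, sup_le_iff, Submodule.span_le]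
        refine ⟨?_, by rw [quatSpan_cons]; exact le_sup_right⟩
        rintro x (rfl | rfl)
        · exact hu
        · exact apply_mem_quatSpan j hj hu
      · rw [quatProd_cons, hvw, quatPair_add_mul j (ι_mul_quatProd j hw)
          (ι_mul_quatProd j (apply_mem_quatSpan j hj hw)), quatPair_combination j hj, smul_mul_assoc,
          ← quatProd_cons]

/-- Members of `L` are exchanged for those of `L'` one at a time, each exchange contributing a
nonnegative factor. Hence a quaternionic subspace determines a ray in its top exterior power. -/
theorem exists_quatProd_eq_smul (hj : ∀ v, j (j v) = -v) (L' : List W) :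
    ∀ L : List W, L'.length = L.length → (∀ v ∈ L', v ∈ quatSpan j L) →
      ∃ r : ℝ, 0 ≤ r ∧ quatProd j L' = (r : ℂ) • quatProd j L := by
  induction h : L'.length generalizing L' with
  | zero =>
    intro L hL _
    rw [List.length_eq_zero_iff.1 h, List.length_eq_zero_iff.1 hL.symm]
    exact ⟨1, zero_le_one, by simp⟩
  | succ n ih =>
    obtain ⟨v, M, rfl⟩ := List.exists_cons_of_length_eq_add_one h
    intro L hL hmem
    by_cases hv : v = 0
    · refine ⟨0, le_rfl, ?_⟩
      rw [quatProd_cons, hv, quatPair, map_zero]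
      simp
    obtain ⟨L₁, h1, h2, r, hr, h3⟩ := exists_quatSpan_cons_eq j hj hv (hmem v (by simp))
    -- In the presence of the factor `v ∧ j v` the other members may be changed by quaternionic
    -- multiples of `v`, which brings them into the span of `L₁`.
    have hred : ∀ N : List W, (∀ w ∈ N, w ∈ quatSpan j (v :: L₁)) →
        ∃ N' : List W, N'.length = N.length ∧ (∀ w ∈ N', w ∈ quatSpan j L₁) ∧
          quatPair j v * quatProd j N = quatPair j v * quatProd j N' := by
      intro N
      induction N with
      | nil => exact fun _ => ⟨[], rfl, by simp, rfl⟩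
      | cons w N ihN =>
        intro hN
        obtain ⟨N', e1, e2, e3⟩ := ihN fun x hx => hN x (by simp [hx])
        obtain ⟨a, b, w', hw', hww⟩ := (mem_quatSpan_cons j).1 (hN w (by simp))
        have hw0 : ∀ a b : ℂ, ExteriorAlgebra.ι ℂ (a • v + b • j v) * quatPair j v = 0 := by
          intro a b
          rw [map_add, map_smul, map_smul, add_mul, smul_mul_assoc, smul_mul_assoc,
            ι_mul_quatPair_self, ι_apply_mul_quatPair_self, smul_zero, smul_zero, add_zero]
        refine ⟨w' :: N', by simp [e1], ?_, ?_⟩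
        · intro x hx
          rcases List.mem_cons.1 hx with rfl | hx
          · exact hw'
          · exact e2 x hx
        · have e4 : quatPair j w * quatPair j v = quatPair j w' * quatPair j v := by
            rw [hww, add_comm]
            refine quatPair_add_mul j (hw0 a b) ?_
            rw [map_add, LinearMap.map_smulₛₗ, LinearMap.map_smulₛₗ, hj, smul_neg, ← neg_smul,
              add_comm]
            exact hw0 _ _
          rw [quatProd_cons, quatProd_cons, ← mul_assoc, ← mul_assoc, ← quatPair_mul_comm, e4,
            mul_assoc, e3, ← mul_assoc, quatPair_mul_comm]
    obtain ⟨N', e1, e2, e3⟩ := hred M fun w hw => h2 ▸ hmem w (by simp [hw])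
    have hM : M.length = n := by simpa using h
    obtain ⟨s, hs, e4⟩ := ih N' (e1.trans hM) L₁ (by omega) e2
    refine ⟨s * r, mul_nonneg hs hr.le, ?_⟩
    rw [quatProd_cons, e3, e4, mul_smul_comm, ← quatProd_cons, h3, smul_smul, Complex.ofReal_mul]

theorem eq_zero_of_ι_mul_eq_zero {U : Submodule ℂ W} {v : W} (hv : v ∉ U) {x : ExteriorAlgebra ℂ W}
    (hx : ∀ e : Dual ℂ W, (∀ u ∈ U, e u = 0) → contract e x = 0)
    (h0 : ExteriorAlgebra.ι ℂ v * x = 0) : x = 0 := by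
  obtain ⟨e, he, heU⟩ := Submodule.exists_dual_map_eq_bot_of_notMem hv inferInstance
  have h1 := contract_ι_mul e v x
  rw [h0, map_zero, hx e fun u hu => by
    rw [← Submodule.mem_bot ℂ, ← heU]; exact Submodule.mem_map_of_mem hu, mul_zero, sub_zero] at h1
  exact (smul_eq_zero.1 h1.symm).resolve_left he

theorem contract_quatProd {L : List W} {e : Dual ℂ W} (he : ∀ u ∈ quatSpan j L, e u = 0) :
    contract e (quatProd j L) = 0 := by
  induction L with
  | nil => simp [quatProd, contract_one]
  | cons v L ih =>
    have h1 : e v = 0 := he v ((mem_quatSpan_cons j).2 ⟨1, 0, 0, zero_mem _, by simp⟩)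
    have h2 : e (j v) = 0 := he _ ((mem_quatSpan_cons j).2 ⟨0, 1, 0, zero_mem _, by simp⟩)
    rw [quatProd_cons, quatPair, mul_assoc, contract_ι_mul, contract_ι_mul, h1, h2, ih fun u hu =>
      he u (by rw [quatSpan_cons]; exact Submodule.mem_sup_right hu)]
    simp

/-- A vector `v` outside a quaternionic subspace is independent of `j v` modulo it: from `v = c j v
+ z`, applying `j` would put `(1 + |c|²) v` into the subspace. So each new vector contributes a
nonzero bivector. -/
theorem exists_quatProd_ne_zero (hj : ∀ v, j (j v) = -v) (M : List W) :
    ∃ L : List W, quatSpan j L = quatSpan j M ∧ quatProd j L ≠ 0 := by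
  induction M with
  | nil => exact ⟨[], rfl, by simp [quatProd]⟩
  | cons v M ih =>
    obtain ⟨L, h1, h2⟩ := ih
    by_cases hv : v ∈ quatSpan j L
    · refine ⟨L, ?_, h2⟩
      rw [quatSpan_cons, ← h1, eq_comm, sup_eq_right, Submodule.span_le]
      rintro x (rfl | rfl)
      · exact hv
      · exact apply_mem_quatSpan j hj hv
    · refine ⟨v :: L, by rw [quatSpan_cons, quatSpan_cons, h1], ?_⟩
      have hjv : j v ∉ quatSpan j L := fun h => hv <| by
        simpa [hj] using apply_mem_quatSpan j hj h
      have hv' : v ∉ Submodule.span ℂ {j v} ⊔ quatSpan j L := by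
        intro h
        obtain ⟨y, hy, z, hz, hyz⟩ := Submodule.mem_sup.1 h
        obtain ⟨c, rfl⟩ := Submodule.mem_span_singleton.1 hy
        have e1 := congrArg j hyz
        rw [map_add, LinearMap.map_smulₛₗ, hj] at e1
        have e2 : ((1 + Complex.normSq c : ℝ) : ℂ) • v ∈ quatSpan j L := by
          have : ((1 + Complex.normSq c : ℝ) : ℂ) • v = c • j z + z := by
            push_cast
            rw [← Complex.mul_conj]
            linear_combination (norm := module) -hyz - c • e1
          rw [this]
          exact add_mem (Submodule.smul_mem _ _ (apply_mem_quatSpan j hj hz)) hz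
        refine hv ?_
        have h1 : ((1 + Complex.normSq c : ℝ) : ℂ) ≠ 0 := by
          exact_mod_cast (add_pos_of_pos_of_nonneg one_pos (Complex.normSq_nonneg c)).ne'
        have := Submodule.smul_mem _ ((1 + Complex.normSq c : ℝ) : ℂ)⁻¹ e2
        rwa [smul_smul, inv_mul_cancel₀ h1, one_smul] at this
      intro h0
      rw [quatProd_cons, quatPair, mul_assoc] at h0
      refine h2 (eq_zero_of_ι_mul_eq_zero hjv (fun e he => contract_quatProd j he)
        (eq_zero_of_ι_mul_eq_zero hv' (fun e he => ?_) h0))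
      have he' : ∀ u ∈ quatSpan j L, e u = 0 := fun u hu => he u (Submodule.mem_sup_right hu)
      rw [contract_ι_mul, contract_quatProd j he', he (j v) (Submodule.mem_sup_left
        (Submodule.mem_span_singleton_self _)), zero_smul, mul_zero, sub_zero]

end Quaternionic

end Symplectic

/-! ### Invariant quaternionic structures and the scalars over the complex numbers. -/

namespace Symplectic

open Koszul Module Hochschild MulOpposite

section QuaternionicStructure

open scoped ComplexConjugate InnerProductSpace

/-- Only real linearity of `f` is needed, so this covers antilinear maps as well as the group
action. -/
theorem map_aeval_real {W : Type*} [AddCommGroup W] [Module ℂ W] (N : W →ₗ[ℂ] W) (f : W →+ W)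
    (hf : ∀ (a : ℝ) v, f ((a : ℂ) • v) = (a : ℂ) • f v) (hN : ∀ v, f (N v) = N (f v))
    (p : Polynomial ℝ) (v : W) :
    f (Polynomial.aeval N (p.map Complex.ofRealHom) v) =
      Polynomial.aeval N (p.map Complex.ofRealHom) (f v) := by
  have hpow : ∀ (n : ℕ) v, f ((N ^ n) v) = (N ^ n) (f v) := by
    intro n
    induction n with
    | zero => intro v; simp
    | succ n ih => intro v; rw [pow_succ, Module.End.mul_apply, ih, hN, Module.End.mul_apply]
  induction p using Polynomial.induction_on' with
  | add p q hp hq => simp only [Polynomial.map_add, map_add, LinearMap.add_apply, hp, hq]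
  | monomial n a =>
    rw [Polynomial.map_monomial, Polynomial.aeval_monomial, Module.End.mul_apply,
      Module.End.mul_apply, Module.algebraMap_end_apply, Module.algebraMap_end_apply]
    exact (hf a _).trans (by rw [hpow]; rfl)

/-- Comparing `ω` with the invariant Hermitian form gives an antilinear `j₀`. Because `ω` is
alternating and nondegenerate, `N = -j₀²` is self-adjoint with positive eigenvalues, and `N^(-1/2)
j₀` squares to `-1`. -/
theorem exists_quaternionic_of_inner {W G : Type*} [NormedAddCommGroup W] [InnerProductSpace ℂ W]
    [FiniteDimensional ℂ W] [Group G] (ρ : Representation ℂ G W) (ω : LinearMap.BilinForm ℂ W)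
    (hω_alt : ω.IsAlt) (hω_nondeg : ω.Nondegenerate)
    (hρ : ∀ (g : G) (v w : W), ω (ρ g v) (ρ g w) = ω v w)
    (hinner : ∀ (g : G) (v w : W), ⟪ρ g v, ρ g w⟫_ℂ = ⟪v, w⟫_ℂ) :
    ∃ j : W →ₗ⋆[ℂ] W, (∀ v, j (j v) = -v) ∧ ∀ g v, j (ρ g v) = ρ g (j v) := by
  let j₀ : W →ₗ⋆[ℂ] W :=
    { toFun := fun u => (InnerProductSpace.toDual ℂ W).symm (LinearMap.toContinuousLinearMap (ω u))
      map_add' := fun u v => by simp only [map_add]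
      map_smul' := fun c u => by simp only [map_smul, LinearIsometryEquiv.map_smulₛₗ] }
  have hj₀ : ∀ u v, ⟪j₀ u, v⟫_ℂ = ω u v := fun u v => InnerProductSpace.toDual_symm_apply
  have hj₀ρ : ∀ g v, j₀ (ρ g v) = ρ g (j₀ v) := by
    intro g v
    refine ext_inner_right ℂ fun w => ?_
    have hw : ρ g (ρ g⁻¹ w) = w := by
      rw [← Module.End.mul_apply, ← map_mul, mul_inv_cancel, map_one, Module.End.one_apply]
    rw [hj₀, ← hw, hρ, hinner, hj₀]
  let N : W →ₗ[ℂ] W := -(j₀.comp j₀)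
  have hNapp : ∀ v, N v = -j₀ (j₀ v) := fun v => rfl
  have hNin : ∀ u v, ⟪N u, v⟫_ℂ = ⟪j₀ v, j₀ u⟫_ℂ := by
    intro u v
    rw [hNapp, inner_neg_left, hj₀, hj₀, hω_alt.neg_eq]
  have hsymm : N.IsSymmetric := by
    intro u v
    rw [hNin, ← inner_conj_symm u, hNin, inner_conj_symm]
  have hj₀N : ∀ v, j₀ (N v) = N (j₀ v) := fun v => by rw [hNapp, hNapp, map_neg]
  set e := hsymm.eigenvectorBasis rfl with he
  set ν := hsymm.eigenvalues rfl with hν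
  have hNe : ∀ i, N (e i) = (ν i : ℂ) • e i := fun i => hsymm.apply_eigenvectorBasis rfl i
  have hνpos : ∀ i, 0 < ν i := by
    intro i
    have h1 := hNin (e i) (e i)
    rw [hNe, inner_smul_left, Complex.conj_ofReal, inner_self_eq_norm_sq_to_K,
      inner_self_eq_norm_sq_to_K, e.norm_eq_one] at h1
    have h2 : ν i = ‖j₀ (e i)‖ ^ 2 := by
      have : (ν i : ℂ) = ((‖j₀ (e i)‖ ^ 2 : ℝ) : ℂ) := by simpa using h1
      exact_mod_cast this
    rw [h2]
    have h3 : j₀ (e i) ≠ 0 := by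
      intro h
      have : e i = 0 := hω_nondeg.1 _ fun v => by rw [← hj₀, h, inner_zero_left]
      have h4 := e.norm_eq_one i
      rw [this, norm_zero] at h4
      exact zero_ne_one h4
    positivity
  -- Interpolation at the eigenvalues realizes `N^(-1/2)` as a real polynomial in `N`; therefore it
  -- commutes with the group and with the antilinear `j₀`.
  let q : Polynomial ℝ := Lagrange.interpolate (Finset.univ.image ν) id fun x => (√x)⁻¹
  have hq : ∀ i, q.eval (ν i) = (√(ν i))⁻¹ := fun i =>
    Lagrange.eval_interpolate_at_node (v := id) _ (Set.injOn_id _)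
      (Finset.mem_image_of_mem ν (Finset.mem_univ i))
  let P : W →ₗ[ℂ] W := Polynomial.aeval N (q.map Complex.ofRealHom)
  have hPe : ∀ i, P (e i) = (((√(ν i))⁻¹ : ℝ) : ℂ) • e i := by
    intro i
    have h1 : Module.End.HasEigenvector N (ν i : ℂ) (e i) :=
      ⟨Module.End.mem_eigenspace_iff.2 (hNe i), fun h => by
        have h4 := e.norm_eq_one i
        rw [h, norm_zero] at h4
        exact zero_ne_one h4⟩
    have h2 := Module.End.aeval_apply_of_hasEigenvector (p := q.map Complex.ofRealHom) h1
    change P (e i) = _ at h2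
    rw [h2, ← hq]
    congr 1
    exact Polynomial.eval_map_apply Complex.ofRealHom (ν i)
  have hPj : ∀ v, j₀ (P v) = P (j₀ v) := map_aeval_real N j₀.toAddMonoidHom
    (fun a v => (j₀.map_smulₛₗ _ _).trans (by rw [Complex.conj_ofReal]; rfl)) hj₀N q
  have hPρ : ∀ g v, ρ g (P v) = P (ρ g v) := fun g => map_aeval_real N (ρ g).toAddMonoidHom
    (fun a v => map_smul (ρ g) _ _) (fun v => by
      change ρ g (N v) = N (ρ g v)
      rw [hNapp, hNapp, map_neg, hj₀ρ, hj₀ρ]) q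
  have hPPN : P ∘ₗ P ∘ₗ N = LinearMap.id := by
    refine e.toBasis.ext fun i => ?_
    rw [OrthonormalBasis.coe_toBasis, LinearMap.comp_apply, LinearMap.comp_apply, hNe, map_smul,
      map_smul, hPe, map_smul, hPe, smul_smul, smul_smul, LinearMap.id_apply]
    convert one_smul ℂ (e i) using 2
    have h1 := Real.mul_self_sqrt (hνpos i).le
    have h2 := (Real.sqrt_pos.2 (hνpos i)).ne'
    norm_cast
    field_simp
    nlinarith
  refine ⟨P.comp j₀, fun v => ?_, fun g v => ?_⟩
  · have := LinearMap.congr_fun hPPN v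
    rw [LinearMap.comp_apply, LinearMap.comp_apply, LinearMap.id_apply, hNapp, map_neg, map_neg]
      at this
    rw [LinearMap.comp_apply, LinearMap.comp_apply, hPj, ← neg_eq_iff_eq_neg]
    exact this
  · rw [LinearMap.comp_apply, LinearMap.comp_apply, hj₀ρ, hPρ]

/-- A finite group preserving a complex symplectic form preserves a quaternionic structure. -/
theorem exists_quaternionic {W G : Type*} [AddCommGroup W] [Module ℂ W]
    [FiniteDimensional ℂ W] [Group G] [Finite G] (ρ : Representation ℂ G W)
    (ω : LinearMap.BilinForm ℂ W) (hω_alt : ω.IsAlt) (hω_nondeg : ω.Nondegenerate)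
    (hρ : ∀ (g : G) (v w : W), ω (ρ g v) (ρ g w) = ω v w) :
    ∃ j : W →ₗ⋆[ℂ] W, (∀ v, j (j v) = -v) ∧ ∀ g v, j (ρ g v) = ρ g (j v) := by
  classical
  cases nonempty_fintype G
  let T : W ≃ₗ[ℂ] EuclideanSpace ℂ (Fin (finrank ℂ W)) :=
    LinearEquiv.ofFinrankEq _ _ (by simp)
  let c : InnerProductSpace.Core ℂ W :=
    { inner := fun v w => ∑ g : G, ⟪T (ρ g v), T (ρ g w)⟫_ℂ
      conj_inner_symm := fun v w => by
        simp only [map_sum, inner_conj_symm]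
      re_inner_nonneg := fun v => by
        rw [map_sum]
        exact Finset.sum_nonneg fun g _ => inner_self_nonneg
      add_left := fun u v w => by
        simp only [map_add, inner_add_left, Finset.sum_add_distrib]
      smul_left := fun u v r => by
        simp only [map_smul, inner_smul_left, Finset.mul_sum]
      definite := fun v hv => by
        have h1 := congrArg RCLike.re hv
        rw [map_sum, map_zero, Finset.sum_eq_zero_iff_of_nonneg fun g _ => inner_self_nonneg] at h1
        have h2 := h1 1 (Finset.mem_univ _)
        rw [map_one, Module.End.one_apply] at h2
        have h3 : T v = 0 := by
          rw [← inner_self_eq_zero (𝕜 := ℂ), ← inner_self_ofReal_re, h2]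
          simp
        exact T.map_eq_zero_iff.1 h3 }
  let _ := c.toNormedAddCommGroup
  let _ : InnerProductSpace ℂ W := InnerProductSpace.ofCore c.toCore
  refine exists_quaternionic_of_inner ρ ω hω_alt hω_nondeg hρ fun g v w => ?_
  change ∑ x : G, ⟪T (ρ x (ρ g v)), T (ρ x (ρ g w))⟫_ℂ = ∑ x : G, ⟪T (ρ x v), T (ρ x w)⟫_ℂ
  refine Fintype.sum_equiv (Equiv.mulRight g) _ _ fun x => ?_
  rw [Equiv.coe_mulRight, map_mul, Module.End.mul_apply, Module.End.mul_apply]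

end QuaternionicStructure

section ComplexFrames

open scoped ComplexConjugate

variable {W G : Type*} [AddCommGroup W] [Module ℂ W] [Group G]
  {ρ : Representation ℂ G W} {g h : G}

/-- Since `j` commutes with `g`, it preserves the moving space, which therefore has a quaternionic
basis; its multivector and that of the frame lie on the same line. -/
theorem exists_quatProd_eq_smul_frameVec [FiniteDimensional ℂ W] {N : ℕ} (B : EigenBasis ρ g N)
    {j : W →ₗ⋆[ℂ] W} (hj : ∀ v, j (j v) = -v)
    (hjρ : ∀ g v, j (ρ g v) = ρ g (j v)) {n : ℕ} {x : Fin n → W} (hx : IsFrame ρ g x) :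
    ∃ L : List W, 2 * L.length = n ∧ quatSpan j L = movingSpace ρ g ∧
      ∃ c : ℂ, c ≠ 0 ∧ quatProd j L = c • frameVec ρ g x := by
  have hstab : ∀ v ∈ movingSpace ρ g, j v ∈ movingSpace ρ g := by
    rw [← B.range_sub]
    rintro _ ⟨v, rfl⟩
    exact ⟨j v, by simp [hjρ]⟩
  obtain ⟨S, hS⟩ := (IsNoetherian.noetherian (movingSpace ρ g) : (movingSpace ρ g).FG)
  have hM : quatSpan j S.toList = movingSpace ρ g := by
    refine le_antisymm (Submodule.span_le.2 ?_) ?_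
    · rintro w ⟨v, hv, hw⟩
      have hv' : v ∈ movingSpace ρ g := hS ▸ Submodule.subset_span (Finset.mem_toList.1 hv)
      rcases hw with rfl | rfl
      · exact hv'
      · exact hstab v hv'
    · rw [← hS]
      exact Submodule.span_mono fun v hv => ⟨v, Finset.mem_toList.2 hv, Or.inl rfl⟩
  obtain ⟨L, hL, hne⟩ := exists_quatProd_ne_zero j hj S.toList
  rw [hM] at hL
  set F := L.flatMap fun v => [v, j v] with hF
  have hlen : F.length = 2 * L.length := by
    simp [hF, List.length_flatMap, mul_comm]
  have hprod : ExteriorAlgebra.ιMulti ℂ F.length F.get = quatProd j L := by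
    have h1 : ExteriorAlgebra.ιMulti ℂ F.length F.get = (F.map (ExteriorAlgebra.ι ℂ)).prod := by
      rw [ExteriorAlgebra.ιMulti_apply]
      congr 1
      conv_rhs => rw [← List.ofFn_get F, List.map_ofFn]
      rfl
    rw [h1, hF, quatProd]
    clear_value F
    clear * -
    induction L with
    | nil => rfl
    | cons v L ih => simp [quatPair, ih, mul_assoc]
  have hli : LinearIndependent ℂ F.get := by
    by_contra h
    exact hne (hprod ▸ AlternatingMap.map_linearDependent _ _ h)
  have hspan : Submodule.span ℂ (Set.range F.get) = movingSpace ρ g := by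
    rw [← hL, quatSpan]
    congr 1
    ext w
    simp only [Set.mem_range, Set.mem_ofPred_eq, ← List.mem_iff_get, hF, List.mem_flatMap]
    simp
  have hn : F.length = n := by
    have h1 := finrank_span_eq_card hli
    have h2 := finrank_span_eq_card hx.linearIndependent
    rw [hspan, Fintype.card_fin] at h1
    rw [hx.span_eq, Fintype.card_fin] at h2
    exact h1.symm.trans h2
  refine ⟨L, hlen ▸ hn, hL, ?_⟩
  clear_value F
  subst hn
  obtain ⟨c, hc⟩ := exists_ιMulti_eq_smul (w := F.get) hx.linearIndependent fun i => by
    rw [hx.span_eq, ← hspan]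
    exact Submodule.subset_span ⟨i, rfl⟩
  rw [hprod] at hc
  refine ⟨c, ?_, hc⟩
  rintro rfl
  rw [zero_smul] at hc
  exact hne hc

/-- The phase of `t g` is that of the factor `c g` relating the frame to the quaternionic
multivector, and its modulus is the inverse square root of `|wall|`. Phases multiply correctly up to
a positive factor by the exchange argument, and moduli by multiplicativity of Wall's determinant. -/
theorem exists_complex_scalars [FiniteDimensional ℂ W] [Finite G] {ω : LinearMap.BilinForm ℂ W}
    (hω_alt : ω.IsAlt) (hω_nondeg : ω.Nondegenerate)
    (hρ : ∀ (g : G) (v w : W), ω (ρ g v) (ρ g w) = ω v w) {n : G → ℕ}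
    {x : ∀ g, Fin (n g) → W} (hx : ∀ g, IsFrame ρ g (x g)) :
    ∃ t : G → ℂ, (∀ g, t g ≠ 0) ∧ ∀ g h, Disjoint (movingSpace ρ g) (movingSpace ρ h) →
      ∀ β : ℂ, frameVec ρ g (x g) * frameVec ρ h (x h) = β • frameVec ρ (g * h) (x (g * h)) →
        t g * t h * β = t (g * h) := by
  have B : ∀ g, EigenBasis ρ g (finrank ℂ W) := fun g => Classical.choice
    (nonempty_eigenBasis ρ g (by exact_mod_cast (orderOf_pos g).ne'))
  obtain ⟨j, hj, hjρ⟩ := exists_quaternionic ρ ω hω_alt hω_nondeg hρ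
  choose L hlen hspan c hc hL using fun g =>
    exists_quatProd_eq_smul_frameVec (B g) hj hjρ (hx g)
  have hD : ∀ g, 0 < ‖wall ρ ω g (x g)‖ := fun g =>
    norm_pos_iff.2 (wall_ne_zero (B g) hω_alt hω_nondeg hρ (hx g))
  have hc' : ∀ g, 0 < ‖c g‖ := fun g => norm_pos_iff.2 (hc g)
  refine ⟨fun g => c g * ((‖c g‖ * √‖wall ρ ω g (x g)‖ : ℝ) : ℂ)⁻¹, fun g => ?_,
    fun g h hd β hβ => ?_⟩
  · refine mul_ne_zero (hc g) (inv_ne_zero ?_)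
    exact_mod_cast (mul_pos (hc' g) (Real.sqrt_pos.2 (hD g))).ne'
  have hn : ∀ g, n g = codim ρ g := fun g => by
    rw [← (B g).finrank_movingSpace_eq_codim, ← (hx g).span_eq,
      finrank_span_eq_card (hx g).linearIndependent, Fintype.card_fin]
  have hngh : n (g * h) = n g + n h := by
    rw [hn, hn, hn, codim_mul_eq (B g) (B h) (B _) hω_alt hω_nondeg hρ hd]
  obtain ⟨β', hβ'0, hβ', hwall⟩ := exists_frameVec_mul_eq (B g) (B h) (B _) hω_alt hω_nondeg hρ hd
    (hx g) (hx h) (hx _) hngh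
  obtain rfl : β = β' := by
    have h1 := hβ.symm.trans hβ'
    exact smul_left_injective ℂ (frameVec_ne_zero (hx (g * h))) h1
  obtain ⟨r, hr, hQ⟩ := exists_quatProd_eq_smul j hj (L g ++ L h) (L (g * h)) (by
    have h1 := hlen g
    have h2 := hlen h
    have h3 := hlen (g * h)
    rw [List.length_append]
    omega) (fun v hv => by
    rw [hspan, movingSpace_mul_eq (B g) (B h) (B _) hω_alt hω_nondeg hρ hd, ← hspan g, ← hspan h]
    rcases List.mem_append.1 hv with hv | hv
    · exact Submodule.mem_sup_left (Submodule.subset_span ⟨v, hv, Or.inl rfl⟩)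
    · exact Submodule.mem_sup_right (Submodule.subset_span ⟨v, hv, Or.inl rfl⟩))
  rw [quatProd_append, hL, hL, hL, smul_mul_smul_comm, hβ, smul_smul, smul_smul] at hQ
  have hcc : c g * c h * β = r * c (g * h) :=
    smul_left_injective ℂ (frameVec_ne_zero (hx (g * h))) hQ
  have hnorm : ‖c g‖ * ‖c h‖ * ‖β‖ = r * ‖c (g * h)‖ := by
    rw [← norm_mul, ← norm_mul, hcc, norm_mul, Complex.norm_real, Real.norm_of_nonneg hr]
  have hsq : √‖wall ρ ω g (x g)‖ * √‖wall ρ ω h (x h)‖ =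
      ‖β‖ * √‖wall ρ ω (g * h) (x (g * h))‖ := by
    rw [← Real.sqrt_mul (norm_nonneg _), ← norm_mul, hwall, norm_mul, norm_pow,
      Real.sqrt_mul (sq_nonneg _), Real.sqrt_sq (norm_nonneg _)]
  have hpos : ∀ g, (‖c g‖ * √‖wall ρ ω g (x g)‖ : ℝ) ≠ 0 := fun g =>
    (mul_pos (hc' g) (Real.sqrt_pos.2 (hD g))).ne'
  -- The norms of `hcc` eliminate `‖β‖` from `hsq`, so the normalizing denominators multiply with
  -- the same factor `r` as the numerators, and `r` cancels.
  have key : (‖c g‖ * √‖wall ρ ω g (x g)‖) * (‖c h‖ * √‖wall ρ ω h (x h)‖) =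
      r * (‖c (g * h)‖ * √‖wall ρ ω (g * h) (x (g * h))‖) := by
    linear_combination (‖c g‖ * ‖c h‖) * hsq + √‖wall ρ ω (g * h) (x (g * h))‖ * hnorm
  have hr0 : (r : ℂ) ≠ 0 := by
    rintro h0
    rw [h0, zero_mul] at hcc
    exact mul_ne_zero (mul_ne_zero (hc g) (hc h)) hβ'0 hcc
  have e1 : ∀ g, ((‖c g‖ * √‖wall ρ ω g (x g)‖ : ℝ) : ℂ) ≠ 0 := fun g => by
    exact_mod_cast hpos g
  have key' := congrArg (fun a : ℝ => (a : ℂ)) key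
  simp only [Complex.ofReal_mul _ (_ * _)] at key'
  beta_reduce
  have e2 := e1 g
  have e3 := e1 h
  have e4 := e1 (g * h)
  generalize ((‖c g‖ * √‖wall ρ ω g (x g)‖ : ℝ) : ℂ) = A at *
  generalize ((‖c h‖ * √‖wall ρ ω h (x h)‖ : ℝ) : ℂ) = A' at *
  generalize ((‖c (g * h)‖ * √‖wall ρ ω (g * h) (x (g * h))‖ : ℝ) : ℂ) = A'' at *
  have : c g * A⁻¹ * (c h * A'⁻¹) * β = (c g * c h * β) * (A * A')⁻¹ := by
    rw [mul_inv]
    ring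
  rw [this, hcc, key']
  field_simp

end ComplexFrames

end Symplectic

/-! ### Local rings between the complex numbers and `k`; extension of characters. -/

namespace Symplectic

open Koszul Module Hochschild MulOpposite

section LocalLift

open Polynomial

theorem exists_ringHom_extension {A B k : Type*} [CommRing A] [IsDomain A] [CommRing B] [IsDomain B]
    [Field k] [IsAlgClosed k] (φ : A →+* B) (hφ : Function.Injective φ) (hφi : φ.IsIntegral)
    (θ : A →+* k) (hθ : Function.Injective θ) : ∃ θ' : B →+* k, ∀ a, θ' (φ a) = θ a := by
  let := φ.toAlgebra
  let := θ.toAlgebra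
  have : Algebra.IsIntegral A B := ⟨hφi⟩
  have : FaithfulSMul A B := (faithfulSMul_iff_algebraMap_injective _ _).2 hφ
  have : FaithfulSMul A k := (faithfulSMul_iff_algebraMap_injective _ _).2 hθ
  let l : B →ₐ[A] k := IsAlgClosed.lift
  exact ⟨l.toRingHom, l.commutes⟩

/-- A homomorphism to an algebraically closed field extends along an integral extension. -/
theorem exists_ringHom_of_isIntegral {R S k : Type*} [CommRing R] [CommRing S] [IsDomain S]
    [Algebra R S] [Algebra.IsIntegral R S] (hRS : Function.Injective (algebraMap R S)) [Field k]
    [IsAlgClosed k] (θ : R →+* k) : ∃ θ' : S →+* k, ∀ r, θ' (algebraMap R S r) = θ r := by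
  have hP : (RingHom.ker θ).IsPrime := RingHom.ker_isPrime θ
  obtain ⟨Q, hQ, hQP⟩ := Ideal.exists_ideal_over_prime_of_isIntegral_of_isDomain (S := S)
    (RingHom.ker θ) (by rw [(RingHom.injective_iff_ker_eq_bot _).1 hRS]; exact bot_le)
  let φ : R ⧸ RingHom.ker θ →+* S ⧸ Q := Ideal.quotientMap Q (algebraMap R S) hQP.ge
  have hφ : Function.Injective φ := Ideal.quotientMap_injective' hQP.le
  have hφi : φ.IsIntegral := by
    have h1 : ((Ideal.Quotient.mk Q).comp (algebraMap R S)).IsIntegral :=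
      (algebraMap_isIntegral_iff.2 inferInstance).trans _ _
        (RingHom.isIntegral_of_surjective _ Ideal.Quotient.mk_surjective)
    have h2 : φ.comp (Ideal.Quotient.mk (RingHom.ker θ)) =
        (Ideal.Quotient.mk Q).comp (algebraMap R S) := rfl
    rw [← h2] at h1
    exact RingHom.IsIntegral.tower_top _ _ h1
  obtain ⟨l, hl⟩ := exists_ringHom_extension φ hφ hφi (RingHom.kerLift θ)
    (RingHom.kerLift_injective θ)
  exact ⟨l.comp (Ideal.Quotient.mk Q), fun r => hl (Ideal.Quotient.mk _ r)⟩

theorem exists_prod_X_sub_C_of_map {O K : Type*} [CommRing O] [Field K] [IsAlgClosed K]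
    (i : O →+* K) (hi : Function.Injective i) (p : O[X]) (hp : p.Monic)
    (h : ∀ z : K, (p.map i).IsRoot z → ∃ a, i a = z) :
    ∃ s : Multiset O, p = (s.map fun a => X - C a).prod := by
  have h1 : ∃ s : Multiset O, s.map i = (p.map i).roots := by
    have h2 : ∀ z ∈ (p.map i).roots, ∃ a, i a = z := fun z hz => h z (isRoot_of_mem_roots hz)
    choose f hf using h2
    refine ⟨(p.map i).roots.pmap f fun _ hz => hz, ?_⟩
    rw [Multiset.map_pmap]
    simp only [hf]
    exact (Multiset.pmap_eq_map _ id _ fun _ hz => hz).trans (Multiset.map_id _)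
  obtain ⟨s, hs⟩ := h1
  refine ⟨s, map_injective i hi ?_⟩
  have h2 := (IsAlgClosed.splits (p.map i)).eq_prod_roots_of_monic (hp.map i)
  rw [h2, ← hs, Polynomial.map_multiset_prod, Multiset.map_map, Multiset.map_map]
  simp

/-- A finite transcendence basis over `ℤ` would make `ℂ` countable. -/
theorem exists_algebraicIndependent_complex (m : ℕ) :
    ∃ x : Fin m → ℂ, AlgebraicIndependent ℤ x := by
  obtain ⟨s, hs⟩ := exists_isTranscendenceBasis ℤ ℂ
  have h1 := IsAlgClosed.cardinal_le_max_transcendence_basis' _ hs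
  have h2 : Infinite s := by
    by_contra h
    rw [not_infinite_iff_finite] at h
    have h3 : Cardinal.mk s ≤ Cardinal.aleph0 := (Cardinal.lt_aleph0_of_finite s).le
    rw [Cardinal.mk_complex, Cardinal.mk_int, max_eq_left h3, max_self] at h1
    exact absurd h1 (not_le.2 Cardinal.aleph0_lt_continuum)
  exact ⟨_, hs.1.comp (fun l : Fin m => Infinite.natEmbedding s l) fun l l' h =>
    Fin.ext ((Infinite.natEmbedding s).injective h)⟩

/-- Finitely many elements of an algebraically closed field lift to a local ring that embeds into
the complex numbers and over which every monic polynomial splits. -/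
theorem exists_local_lift (k : Type*) [Field k] [IsAlgClosed k] {m : ℕ} (a : Fin m → k) :
    ∃ (O : Type) (_ : CommRing O) (i : O →+* ℂ) (Θ : O →+* k), Function.Injective i ∧
      (∀ x, Θ x ≠ 0 → IsUnit x) ∧
      (∀ p : O[X], p.Monic → ∃ s : Multiset O, p = (s.map fun a => X - C a).prod) ∧
      ∀ l, ∃ x, Θ x = a l := by
  obtain ⟨x, hx⟩ := exists_algebraicIndependent_complex m
  let := (MvPolynomial.aeval (R := ℤ) x).toRingHom.toAlgebra
  have hinj : Function.Injective (algebraMap (MvPolynomial (Fin m) ℤ) ℂ) := hx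
  -- The variables are independent, so they may be specialized to the given elements of `k`; lying
  -- over extends this to the integral closure `S`. Integral closedness in `ℂ` makes monic
  -- polynomials split, and localizing at the kernel makes the specialization detect units.
  let S := integralClosure (MvPolynomial (Fin m) ℤ) ℂ
  have hS : Function.Injective (algebraMap (MvPolynomial (Fin m) ℤ) S) := fun p q h =>
    hinj (congrArg Subtype.val h)
  obtain ⟨θ, hθ⟩ := exists_ringHom_of_isIntegral hS
    (MvPolynomial.aeval (R := ℤ) a : MvPolynomial (Fin m) ℤ →ₐ[ℤ] k).toRingHom
  have hprime : (RingHom.ker θ).IsPrime := RingHom.ker_isPrime θ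
  let O := Localization.AtPrime (RingHom.ker θ)
  have hθu : ∀ y : (RingHom.ker θ).primeCompl, IsUnit (θ y) := fun y => IsUnit.mk0 _ y.2
  have hiu : ∀ y : (RingHom.ker θ).primeCompl, IsUnit (algebraMap S ℂ y) := fun y => by
    refine IsUnit.mk0 _ fun h => y.2 ?_
    have : (y : S) = 0 := Subtype.ext h
    rw [this]
    exact zero_mem _
  let i : O →+* ℂ := IsLocalization.lift hiu
  let Θ : O →+* k := IsLocalization.lift hθu
  have hi : ∀ y, i (algebraMap S O y) = y := fun y => IsLocalization.lift_eq hiu y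
  have hΘ : ∀ y, Θ (algebraMap S O y) = θ y := fun y => IsLocalization.lift_eq hθu y
  have hinji : Function.Injective i := by
    rw [injective_iff_map_eq_zero]
    intro z hz
    obtain ⟨⟨y, s⟩, hys⟩ := IsLocalization.surj (RingHom.ker θ).primeCompl z
    have h1 := congrArg i hys
    rw [map_mul, hz, zero_mul, hi] at h1
    have h2 : y = 0 := Subtype.ext h1.symm
    change z * algebraMap S O s = algebraMap S O y at hys
    rw [h2, map_zero] at hys
    exact (IsLocalization.map_units O s).mul_left_eq_zero.1 hys
  refine ⟨O, inferInstance, i, Θ, hinji, fun z hz => ?_, fun p hp => ?_, fun l => ?_⟩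
  · obtain ⟨⟨y, s⟩, hys⟩ := IsLocalization.surj (RingHom.ker θ).primeCompl z
    change z * algebraMap S O s = algebraMap S O y at hys
    have hy : y ∈ (RingHom.ker θ).primeCompl := by
      intro hy
      have h1 := congrArg Θ hys
      rw [map_mul, hΘ, hΘ, (RingHom.mem_ker).1 hy] at h1
      exact mul_ne_zero hz s.2 h1
    have h2 : IsUnit (algebraMap S O y) := IsLocalization.map_units O ⟨y, hy⟩
    rw [← hys] at h2
    exact isUnit_of_mul_isUnit_left h2
  · refine exists_prod_X_sub_C_of_map i hinji p hp fun z hz => ?_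
    let := i.toAlgebra
    have : IsScalarTower S O ℂ := IsScalarTower.of_algebraMap_eq fun y => (hi y).symm
    have hz : IsIntegral O z := ⟨p, hp, by
      rw [← eval_map]
      exact hz⟩
    -- Clearing a denominator turns a root of a monic polynomial over `O` into an element integral
    -- over `S`, hence belonging to `S`.
    obtain ⟨s, hs⟩ := hz.exists_multiple_integral_of_isLocalization (RingHom.ker θ).primeCompl z
    have hs' : IsIntegral (MvPolynomial (Fin m) ℤ) (s • z) := isIntegral_trans _ hs
    obtain ⟨u, hu⟩ := IsLocalization.map_units O s
    refine ⟨algebraMap S O ⟨s • z, hs'⟩ * ↑u⁻¹, ?_⟩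
    have h1 : i u * i ↑u⁻¹ = 1 := by rw [← map_mul, Units.mul_inv, map_one]
    have h2 : i u = ((s : S) : ℂ) := by rw [hu]; exact hi _
    rw [map_mul, hi]
    change ((s : S) : ℂ) * z * _ = z
    rw [← h2, mul_right_comm, h1, one_mul]
  · refine ⟨algebraMap S O (algebraMap (MvPolynomial (Fin m) ℤ) S (MvPolynomial.X l)), ?_⟩
    rw [hΘ, hθ]
    exact MvPolynomial.aeval_X a l

theorem exists_local_lift_of_finite (k : Type*) [Field k] [IsAlgClosed k] (T : Set k)
    (hT : T.Finite) :
    ∃ (O : Type) (_ : CommRing O) (i : O →+* ℂ) (Θ : O →+* k), Function.Injective i ∧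
      (∀ x, Θ x ≠ 0 → IsUnit x) ∧
      (∀ p : O[X], p.Monic → ∃ s : Multiset O, p = (s.map fun a => X - C a).prod) ∧
      ∀ a ∈ T, ∃ x, Θ x = a := by
  obtain ⟨m, a, -, ha⟩ := hT.fin_param
  obtain ⟨O, inst, i, Θ, hi, hloc, hsplit, hlift⟩ := exists_local_lift k a
  refine ⟨O, inst, i, Θ, hi, hloc, hsplit, fun z hz => ?_⟩
  rw [← ha] at hz
  obtain ⟨l, rfl⟩ := hz
  exact hlift l

end LocalLift

section Divisible

/-- A homomorphism to the units of an algebraically closed field extends to overgroups. -/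
theorem exists_monoidHom_extension {k A B : Type*} [Field k] [IsAlgClosed k] [CommGroup A]
    [CommGroup B] (i : A →* B) (hi : Function.Injective i) (f : A →* kˣ) :
    ∃ F : B →* kˣ, ∀ a, F (i a) = f a := by
  -- Roots exist in an algebraically closed field, so `kˣ` is divisible and hence an injective
  -- abelian group.
  have hdiv : ∀ {n : ℕ} (_ : n ≠ 0) (x : kˣ), ∃ y : kˣ, y ^ n = x := by
    intro n hn x
    obtain ⟨z, hz⟩ := IsAlgClosed.exists_pow_nat_eq (x : k) (Nat.pos_of_ne_zero hn)
    have hz0 : z ≠ 0 := by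
      rintro rfl
      rw [zero_pow hn] at hz
      exact x.ne_zero hz.symm
    exact ⟨Units.mk0 z hz0, Units.ext (by simpa using hz)⟩
  let : DivisibleBy (Additive kˣ) ℤ := by
    refine divisibleByOfSMulRightSurj _ _ fun {n} hn x => ?_
    obtain ⟨y, hy⟩ := hdiv (Int.natAbs_ne_zero.2 hn) (Additive.toMul x)
    rcases Int.natAbs_eq n with h | h
    · exact ⟨Additive.ofMul y, by
        rw [h]
        exact (natCast_zsmul _ _).trans (congrArg Additive.ofMul hy)⟩
    · exact ⟨-Additive.ofMul y, by
        rw [h]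
        simp only [smul_neg, neg_smul, neg_neg]
        exact (natCast_zsmul _ _).trans (congrArg Additive.ofMul hy)⟩
  obtain ⟨F, hF⟩ := (Module.Baer.of_divisible (Additive kˣ)).extension_property_addMonoidHom
    (MonoidHom.toAdditive i) hi (MonoidHom.toAdditive f)
  exact ⟨MonoidHom.toAdditive.symm F, fun a => DFunLike.congr_fun hF (Additive.ofMul a)⟩

end Divisible

end Symplectic

/-! ### Lifting matrix representations along a local homomorphism. -/

namespace Symplectic

open Koszul Module Hochschild MulOpposite

section MatrixLift

open Polynomial

variable {O k : Type*} [CommRing O] [Field k] {Θ : O →+* k}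
  (hloc : ∀ x, Θ x ≠ 0 → IsUnit x)
  {I n : Type*} [Fintype I] [DecidableEq I] [Fintype n] [DecidableEq n]

include hloc

theorem isUnit_of_map_eq_one {M : Matrix I I O} (hM : M.map Θ = 1) : IsUnit M := by
  rw [Matrix.isUnit_iff_isUnit_det]
  refine hloc _ ?_
  rw [RingHom.map_det]
  change (M.map Θ).det ≠ 0
  rw [hM, Matrix.det_one]
  exact one_ne_zero

/-- `E - F` is an idempotent with zero reduction, so `1 - (E - F)` is invertible; it annihilates `E
- F`. -/
theorem eq_of_map_eq_of_mul_self {E F : Matrix I I O} (hE : E * E = E) (hF : F * F = F)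
    (hEF : E * F = F) (hFE : F * E = F) (h : E.map Θ = F.map Θ) : E = F := by
  have h1 : IsUnit (1 - (E - F)) := isUnit_of_map_eq_one hloc <| by
    ext i j
    have := congrFun (congrFun h i) j
    simp only [Matrix.map_apply] at this
    simp [Matrix.map_apply, Matrix.one_apply, this, apply_ite Θ]
  have h2 : (1 - (E - F)) * (E - F) = 0 := by
    rw [sub_mul, sub_mul, mul_sub, mul_sub, mul_sub, hE, hF, hEF, hFE]
    simp
  exact sub_eq_zero.1 (h1.mul_right_eq_zero.1 h2)

theorem isCoprime_prod_X_sub_C (s t : Multiset O) (h : ∀ a ∈ s, ∀ b ∈ t, Θ a ≠ Θ b) :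
    IsCoprime (s.map fun a => X - C a).prod (t.map fun a => X - C a).prod := by
  have hpair : ∀ a ∈ s, ∀ b ∈ t, IsCoprime (X - C a) (X - C b) := by
    intro a ha b hb
    refine isCoprime_X_sub_C_of_isUnit_sub (hloc _ ?_)
    rw [map_sub]
    exact sub_ne_zero.2 (h a ha b hb)
  clear h
  induction s using Multiset.induction with
  | empty => simpa using isCoprime_one_left
  | cons a s ih =>
    rw [Multiset.map_cons, Multiset.prod_cons]
    refine IsCoprime.mul_left ?_ (ih fun a ha => hpair a (Multiset.mem_cons_of_mem ha))
    replace hpair := hpair a (Multiset.mem_cons_self a s)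
    clear ih
    induction t using Multiset.induction with
    | empty => simpa using isCoprime_one_right
    | cons b t ih =>
      rw [Multiset.map_cons, Multiset.prod_cons]
      exact IsCoprime.mul_right (hpair b (Multiset.mem_cons_self b t))
        (ih fun b hb => hpair b (Multiset.mem_cons_of_mem hb))

/-- A lift of an idempotent matrix can be corrected to an idempotent one by a polynomial. -/
theorem exists_aeval_mul_self_eq
    (hsplit : ∀ p : O[X], p.Monic → ∃ s : Multiset O, p = (s.map fun a => X - C a).prod)
    (M : Matrix I I O) (hM : M.map Θ * M.map Θ = M.map Θ) :
    ∃ p : O[X], aeval M p * aeval M p = aeval M p ∧ (aeval M p).map Θ = M.map Θ := by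
  classical
  obtain ⟨s, hs⟩ := hsplit M.charpoly M.charpoly_monic
  set f := fun a : O => X - C a with hf
  set s₀ := s.filter fun a => Θ a = 0 with hs₀
  set s₁ := s.filter fun a => ¬ Θ a = 0 with hs₁
  -- The eigenvalues are separated by whether they reduce to zero. The extra roots `0` and `1` make
  -- `X` divide `P` and `X - 1` divide `1 - P`, which yields that `P(M)` and `M` have the same
  -- reduction.
  obtain ⟨u, v, huv⟩ := isCoprime_prod_X_sub_C hloc (0 ::ₘ s₀) (1 ::ₘ s₁) <| by
    intro a ha b hb
    have ha' : Θ a = 0 := by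
      rcases Multiset.mem_cons.1 ha with rfl | ha
      · exact map_zero Θ
      · exact (Multiset.mem_filter.1 ha).2
    have hb' : Θ b ≠ 0 := by
      rcases Multiset.mem_cons.1 hb with rfl | hb
      · rw [map_one]
        exact one_ne_zero
      · exact (Multiset.mem_filter.1 hb).2
    rw [ha']
    exact hb'.symm
  rw [Multiset.map_cons, Multiset.map_cons, Multiset.prod_cons, Multiset.prod_cons] at huv
  have hχ : M.charpoly = (s₀.map f).prod * (s₁.map f).prod := by
    rw [hs, ← Multiset.prod_add, ← Multiset.map_add, Multiset.filter_add_not]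
  obtain ⟨P, hP⟩ : ∃ P, P = u * (f 0 * (s₀.map f).prod) := ⟨_, rfl⟩
  have hP' : 1 - P = v * (f 1 * (s₁.map f).prod) := by
    rw [hP, ← huv]
    ring
  have hmul : P * (1 - P) = (u * v * f 0 * f 1) * M.charpoly := by
    rw [hP', hP, hχ]
    ring
  have h1 : aeval M P * (1 - aeval M P) = 0 := by
    have := congrArg (aeval M) hmul
    rw [map_mul, map_sub, map_one, map_mul, Matrix.aeval_self_charpoly, mul_zero] at this
    exact this
  have h2 : aeval M P = M * aeval M (u * (s₀.map f).prod) := by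
    have : P = X * (u * (s₀.map f).prod) := by
      rw [hP, hf]
      simp only [map_zero, sub_zero]
      ring
    rw [this, map_mul, aeval_X]
  have h3 : 1 - aeval M P = (M - 1) * aeval M (v * (s₁.map f).prod) := by
    have : 1 - P = (X - 1) * (v * (s₁.map f).prod) := by
      rw [hP', hf]
      simp only [map_one]
      ring
    have := congrArg (aeval M) this
    rwa [map_sub, map_one, map_mul, map_sub, aeval_X, map_one] at this
  refine ⟨P, ?_, ?_⟩
  · rw [mul_sub, mul_one, sub_eq_zero] at h1
    exact h1.symm
  · have e2 := congrArg (RingHom.mapMatrix Θ) h2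
    have e3 := congrArg (RingHom.mapMatrix Θ) h3
    rw [map_mul] at e2
    rw [map_sub, map_mul, map_sub, map_one] at e3
    have hM' : RingHom.mapMatrix Θ M * RingHom.mapMatrix Θ M = RingHom.mapMatrix Θ M := hM
    change RingHom.mapMatrix Θ (aeval M P) = RingHom.mapMatrix Θ M
    have e4 := congrArg (RingHom.mapMatrix Θ M * ·) e3
    simp only [mul_sub, ← mul_assoc, mul_one, hM', sub_self, zero_mul] at e4
    rw [sub_eq_zero, e2, ← mul_assoc, hM', ← e2] at e4
    exact e4.symm

/-- The image of the equivariant idempotent `E` carries the lifted representation. `B` and `C` lift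
the maps into and out of it; `C * B` reduces to the identity, and its inverse `M` makes `B * M * C`
equal to `E`. -/
theorem exists_matrix_monoidHom {G : Type*} [Group G] (T : G →* Matrix I I O) {E : Matrix I I O}
    (hE : E * E = E) (hET : ∀ g, E * T g = T g * E) {i : Matrix I n O} {p : Matrix n I O}
    (hpi : p.map Θ * i.map Θ = 1) (hip : i.map Θ * p.map Θ = E.map Θ) :
    ∃ A : G →* Matrix n n O, ∀ g, (A g).map Θ = p.map Θ * (T g).map Θ * i.map Θ := by
  set B := E * i with hB
  set C := p * E with hC
  have hBm : B.map Θ = i.map Θ := by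
    rw [hB, Matrix.map_mul, ← hip, Matrix.mul_assoc, hpi, Matrix.mul_one]
  have hCm : C.map Θ = p.map Θ := by
    rw [hC, Matrix.map_mul, ← hip, ← Matrix.mul_assoc, hpi, Matrix.one_mul]
  obtain ⟨M, hCB, hMm⟩ : ∃ M : Matrix n n O, M * (C * B) = 1 ∧ M.map Θ = 1 := by
    have h0 : (C * B).map Θ = 1 := by rw [Matrix.map_mul, hBm, hCm, hpi]
    obtain ⟨M, hM⟩ := (isUnit_of_map_eq_one hloc h0).exists_left_inv
    refine ⟨M, hM, ?_⟩
    have h2 := congrArg (RingHom.mapMatrix Θ) hM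
    rwa [map_mul, RingHom.mapMatrix_apply Θ (C * B), h0, mul_one, map_one] at h2
  have hEB : E * B = B := by rw [hB, ← Matrix.mul_assoc, hE]
  have hCE : C * E = C := by rw [hC, Matrix.mul_assoc, hE]
  clear_value B C
  have hEeq : E = B * M * C := by
    refine eq_of_map_eq_of_mul_self hloc hE ?_ ?_ ?_ ?_
    · calc B * M * C * (B * M * C) = B * (M * (C * B)) * M * C := by
            simp only [Matrix.mul_assoc]
        _ = B * M * C := by rw [hCB, Matrix.mul_one]
    · rw [← Matrix.mul_assoc, ← Matrix.mul_assoc, hEB]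
    · rw [Matrix.mul_assoc, hCE]
    · rw [Matrix.map_mul, Matrix.map_mul, hBm, hCm, hMm, Matrix.mul_one, hip]
  refine ⟨{ toFun := fun g => M * C * T g * B
            map_one' := by rw [map_one, Matrix.mul_one, Matrix.mul_assoc, hCB]
            map_mul' := fun g h => ?_ }, fun g => ?_⟩
  · calc M * C * T (g * h) * B = M * C * T g * (T h * (E * B)) := by
          rw [map_mul, hEB]
          simp only [Matrix.mul_assoc]
      _ = M * C * T g * (E * (T h * B)) := by
          rw [← Matrix.mul_assoc (T h), ← hET, Matrix.mul_assoc E]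
      _ = M * C * T g * B * (M * C * T h * B) := by
          rw [hEeq]
          simp only [Matrix.mul_assoc]
  · change (M * C * T g * B).map Θ = _
    rw [Matrix.map_mul, Matrix.map_mul, Matrix.map_mul, hMm, hBm, hCm, Matrix.one_mul]

omit [Fintype I] [DecidableEq I] in
/-- Matrix representations of a finite group of invertible order lift along a local homomorphism if
monic polynomials split. -/
theorem exists_representation_lift
    (hsplit : ∀ p : O[X], p.Monic → ∃ s : Multiset O, p = (s.map fun a => X - C a).prod)
    {G : Type*} [Group G] [Finite G] (hG : (Nat.card G : k) ≠ 0) (r : G →* Matrix n n k)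
    (hr : ∀ g a b, ∃ x, Θ x = r g a b) :
    ∃ A : G →* Matrix n n O, ∀ g, (A g).map Θ = r g := by
  classical
  cases nonempty_fintype G
  choose r' hr' using hr
  obtain ⟨c, hc⟩ : IsUnit (Nat.card G : O) := hloc _ (by simpa using hG)
  have hc' : Θ ↑c⁻¹ * (Nat.card G : k) = 1 := by
    rw [← map_natCast Θ, ← map_mul, ← hc, Units.inv_mul, map_one]
  -- `T` is the translation representation on `G × n`, defined over any ring. Averaging over `G`
  -- makes `r` a direct summand of its reduction through `i` and `p`. Entries of `M` depend only on
  -- `s⁻¹ t` in the group variable, so this lift of the projection commutes with `T` although the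
  -- entrywise lift `r'` is not multiplicative.
  let T : G →* Matrix (G × n) (G × n) O :=
    { toFun := fun g => Matrix.of fun s t => if s = (g * t.1, t.2) then 1 else 0
      map_one' := by
        ext s t
        simp [Matrix.one_apply]
      map_mul' := fun g h => by
        ext s t
        simp [Matrix.mul_apply, mul_assoc] }
  have hT : ∀ (g : G) (s t : G × n), s = (g * t.1, t.2) ↔ t = (g⁻¹ * s.1, s.2) := by
    intro g s t
    simp only [Prod.ext_iff, eq_inv_mul_iff_mul_eq]
    exact and_congr eq_comm eq_comm
  let M : Matrix (G × n) (G × n) O := Matrix.of fun s t => ↑c⁻¹ * r' (s.1⁻¹ * t.1) s.2 t.2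
  let i : Matrix (G × n) n O := Matrix.of fun s b => r' s.1⁻¹ s.2 b
  let p : Matrix n (G × n) O := Matrix.of fun a t => ↑c⁻¹ * r' t.1 a t.2
  have hsum : ∀ (g : G) (a b : n),
      ∑ t : G × n, Θ ↑c⁻¹ * r t.1 a t.2 * r (t.1⁻¹ * g) t.2 b = r g a b := by
    intro g a b
    have h1 : ∀ x : G, ∑ y : n, Θ ↑c⁻¹ * r x a y * r (x⁻¹ * g) y b = Θ ↑c⁻¹ * r g a b := by
      intro x
      have : r g a b = (r x * r (x⁻¹ * g)) a b := by rw [← map_mul, mul_inv_cancel_left]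
      rw [this, Matrix.mul_apply, Finset.mul_sum]
      exact Finset.sum_congr rfl fun y _ => mul_assoc _ _ _
    rw [Fintype.sum_prod_type]
    simp only [h1, Finset.sum_const, Finset.card_univ, nsmul_eq_mul]
    rw [← Nat.card_eq_fintype_card, ← mul_assoc, mul_comm (Nat.card G : k), hc', one_mul]
  have hpi : p.map Θ * i.map Θ = 1 := by
    ext a b
    rw [← map_one r, ← hsum]
    simp [Matrix.mul_apply, p, i, hr']
  have hip : i.map Θ * p.map Θ = M.map Θ := by
    ext s t
    simp only [Matrix.mul_apply, Matrix.map_apply, p, i, M, Matrix.of_apply, map_mul, hr',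
      Finset.mul_sum]
    refine Finset.sum_congr rfl fun y _ => ?_
    ring
  obtain ⟨q, hq1, hq2⟩ := exists_aeval_mul_self_eq hloc hsplit M (by
    rw [← hip, Matrix.mul_assoc, ← Matrix.mul_assoc (p.map Θ), hpi, Matrix.one_mul])
  have hcomm : ∀ g, aeval M q * T g = T g * aeval M q := by
    intro g
    have h1 : Commute M (T g) := by
      change M * T g = T g * M
      ext s t
      have h2 : (T g * M) s t = M (g⁻¹ * s.1, s.2) t := by
        simp [Matrix.mul_apply, T, hT g s]
      rw [h2]
      simp [Matrix.mul_apply, T, M, mul_assoc]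
    have h2 : aeval M q ∈ Subalgebra.centralizer O {T g} := by
      have hm : M ∈ Subalgebra.centralizer O {T g} := by
        rw [Subalgebra.mem_centralizer_iff]
        rintro _ rfl
        exact h1.eq.symm
      exact Algebra.adjoin_le (Set.singleton_subset_iff.2 hm) (aeval_mem_adjoin_singleton O M)
    rw [Subalgebra.mem_centralizer_iff] at h2
    exact (h2 _ rfl).symm
  obtain ⟨A, hA⟩ := exists_matrix_monoidHom hloc T hq1 hcomm hpi (hip.trans hq2.symm)
  refine ⟨A, fun g => ?_⟩
  rw [hA, Matrix.mul_assoc]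
  ext a b
  rw [← hsum g a b, Matrix.mul_apply]
  refine Finset.sum_congr rfl fun t _ => ?_
  have h2 : ((T g).map Θ * i.map Θ) t b = i.map Θ (g⁻¹ * t.1, t.2) b := by
    simp [Matrix.mul_apply, T, hT g t, apply_ite Θ]
  rw [h2]
  simp [p, i, hr']

end MatrixLift

end Symplectic

/-! ### Specialization of coordinates and of frames. -/

namespace Symplectic

open Koszul Module Hochschild MulOpposite

section Specialization

open scoped Matrix

variable {O K W G : Type*} [CommRing O] [Field K] [AddCommGroup W] [Module K W] [Group G] {n : ℕ}

/-- The specialization along `f` of a coordinate vector over `O`. -/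
def vec (c : Basis (Fin n) K W) (f : O →+* K) : (Fin n → O) →+ W where
  toFun v := c.equivFun.symm (f ∘ v)
  map_zero' := by
    rw [← map_zero c.equivFun.symm]
    congr 1
    ext
    simp
  map_add' v w := by
    rw [← map_add]
    congr 1
    ext
    simp

variable (c : Basis (Fin n) K W) (f : O →+* K)

theorem equivFun_vec (v : Fin n → O) : c.equivFun (vec c f v) = f ∘ v :=
  c.equivFun.apply_symm_apply _

theorem coord_vec (a : Fin n) (v : Fin n → O) : c.coord a (vec c f v) = f (v a) :=
  congrFun (equivFun_vec c f v) a

theorem pairForms_vec {d : ℕ} (Y u : Fin d → Fin n → O) :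
    pairForms (fun q => ∑ a, f (Y q a) • c.coord a)
        (ExteriorAlgebra.ιMulti K d fun p => vec c f (u p)) =
      f (Matrix.of fun p q => Y q ⬝ᵥ u p).det := by
  rw [pairForms_ιMulti_eq_det, RingHom.map_det]
  congr 1
  ext p q
  have h : ∀ a, c.coord a (vec c f (u p)) = f (u p a) := fun a => coord_vec c f a _
  simp only [Matrix.of_apply, LinearMap.sum_apply, LinearMap.smul_apply, h, smul_eq_mul,
    RingHom.mapMatrix_apply, Matrix.map_apply, dotProduct, map_sum, map_mul]

theorem linearIndependent_vec_iff {Z : Fin n → Fin n → O} :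
    LinearIndependent K (fun l => vec c f (Z l)) ↔ f (Matrix.of Z).det ≠ 0 := by
  rw [RingHom.map_det, ← isUnit_iff_ne_zero, ← Matrix.isUnit_iff_isUnit_det,
    ← Matrix.linearIndependent_rows_iff_isUnit]
  have h : (RingHom.mapMatrix f (Matrix.of Z)).row = c.equivFun ∘ fun l => vec c f (Z l) := by
    funext l
    rw [Function.comp_apply, equivFun_vec]
    rfl
  rw [h]
  exact (LinearMap.linearIndependent_iff c.equivFun.toLinearMap
    (LinearEquiv.ker c.equivFun)).symm

/-- The vectors `x - g x` for `x = X l` with `l ∈ S`, and the sums over the orbit of `x = X l` under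
the cyclic group generated by `g` for `l ∉ S`. -/
def splitVec (σ : Representation K G W) (g : G) (S : Finset (Fin n)) (X : Fin n → W) (l : Fin n) : W :=
  if l ∈ S then X l - σ g (X l) else ∑ i ∈ Finset.range (orderOf g), σ (g ^ (i + 1)) (X l)

/-- The vectors with index in `S` are moving and the others are fixed; as together they form a
basis, those in `S` span the moving space. Independence is the nonvanishing of one determinant, so
the frame property can be transferred between fields. -/
theorem isFrame_of_splitVec [FiniteDimensional K W] {σ : Representation K G W} {g : G} {N d : ℕ}
    (B : EigenBasis σ g N) {S : Finset (Fin n)} (hn : finrank K W = n) {X : Fin n → W}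
    (hX : LinearIndependent K (splitVec σ g S X)) {e : Fin d → Fin n} (he : Function.Injective e)
    (heS : Set.range e = S) : IsFrame σ g fun i => X (e i) := by
  have hmem : ∀ i, e i ∈ S := fun i => by
    rw [← Finset.mem_coe, ← heS]
    exact ⟨i, rfl⟩
  have hZ : (fun i => X (e i) - σ g (X (e i))) = splitVec σ g S X ∘ e := by
    funext i
    rw [Function.comp_apply, splitVec, if_pos (hmem i)]
  have hI : ∀ l ∈ S, splitVec σ g S X l ∈ movingSpace σ g := by
    intro l hl
    rw [splitVec, if_pos hl, ← neg_sub]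
    exact neg_mem (apply_sub_mem_movingSpace B _)
  have hF : ∀ l ∉ S, splitVec σ g S X l ∈ fixedSpace σ g := by
    intro l hl
    rw [splitVec, if_neg hl]
    change σ g _ = _
    rw [map_sum]
    have h : ∀ i, σ g (σ (g ^ (i + 1)) (X l)) = σ (g ^ (i + 2)) (X l) := fun i => by
      rw [← Module.End.mul_apply, ← map_mul, ← pow_succ']
    simp only [h]
    have h1 := Finset.sum_range_succ (fun i => σ (g ^ (i + 1)) (X l)) (orderOf g)
    have h2 := Finset.sum_range_succ' (fun i => σ (g ^ (i + 1)) (X l)) (orderOf g)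
    rw [h1] at h2
    rw [pow_succ, pow_orderOf_eq_one, one_mul, zero_add, pow_one] at h2
    exact (add_right_cancel h2).symm
  refine ⟨hZ ▸ hX.comp e he, ?_⟩
  rw [hZ]
  apply le_antisymm
  · rw [Submodule.span_le]
    rintro _ ⟨i, rfl⟩
    exact hI _ (hmem i)
  · intro v hv
    have hspan := hX.span_eq_top_of_card_eq_finrank' (by rw [Fintype.card_fin, hn])
    obtain ⟨a, ha⟩ := (Submodule.mem_span_range_iff_exists_fun K).1
      (hspan ▸ Submodule.mem_top : v ∈ Submodule.span K (Set.range (splitVec σ g S X)))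
    rw [← Finset.sum_add_sum_compl S] at ha
    have h1 : ∑ l ∈ S, a l • splitVec σ g S X l ∈ movingSpace σ g :=
      Submodule.sum_mem _ fun l hl => Submodule.smul_mem _ _ (hI l hl)
    have h2 : ∑ l ∈ Sᶜ, a l • splitVec σ g S X l ∈ fixedSpace σ g :=
      Submodule.sum_mem _ fun l hl => Submodule.smul_mem _ _ (hF l (Finset.mem_compl.1 hl))
    have h3 : ∑ l ∈ Sᶜ, a l • splitVec σ g S X l ∈ movingSpace σ g := by
      rw [eq_sub_iff_add_eq'.2 ha]
      exact sub_mem hv h1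
    rw [Submodule.disjoint_def.1 B.isCompl.disjoint _ h2 h3, add_zero] at ha
    rw [← ha]
    refine Submodule.sum_mem _ fun l hl => Submodule.smul_mem _ _ (Submodule.subset_span ?_)
    obtain ⟨i, rfl⟩ : l ∈ Set.range e := by
      rw [heS]
      exact hl
    exact ⟨i, rfl⟩

/-- On an eigenbasis `splitVec` multiplies moving vectors by `1 - μ` and fixed vectors by the order
of `g`, both invertible. -/
theorem EigenBasis.linearIndependent_splitVec {σ : Representation K G W} {g : G}
    (B : EigenBasis σ g n) (ho : (orderOf g : K) ≠ 0) {S : Finset (Fin n)}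
    (hS : ∀ l, l ∈ S ↔ B.μ l ≠ 1) : LinearIndependent K (splitVec σ g S B.b) := by
  have h : ∀ l, ∃ w : Kˣ, splitVec σ g S B.b l = w • B.b l := by
    intro l
    by_cases hl : l ∈ S
    · refine ⟨Units.mk0 (1 - B.μ l) (sub_ne_zero.2 ((hS l).1 hl).symm), ?_⟩
      rw [splitVec, if_pos hl, B.apply_b, Units.smul_mk0, sub_smul, one_smul]
    · have hμ : B.μ l = 1 := by
        by_contra h
        exact hl ((hS l).2 h)
      refine ⟨Units.mk0 _ ho, ?_⟩
      have hfix : ∀ i : ℕ, σ (g ^ i) (B.b l) = B.b l := fun i => by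
        induction i with
        | zero => simp
        | succ i ih => rw [pow_succ, map_mul, Module.End.mul_apply, B.apply_b, hμ, one_smul, ih]
      rw [splitVec, if_neg hl, Units.smul_mk0]
      simp only [hfix, Finset.sum_const, Finset.card_range]
      exact (Nat.cast_smul_eq_nsmul K _ _).symm
  choose w hw using h
  have : splitVec σ g S B.b = w • B.b := funext hw
  rw [this]
  exact B.b.linearIndependent.units_smul w

variable {c f}

theorem splitVec_vec {σ : Representation K G W} {A : G →* Matrix (Fin n) (Fin n) O}
    (hA : ∀ g v, σ g (vec c f v) = vec c f (A g *ᵥ v)) (g : G) (S : Finset (Fin n))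
    (X : Fin n → Fin n → O) (l : Fin n) :
    splitVec σ g S (fun l => vec c f (X l)) l = vec c f (if l ∈ S then X l - A g *ᵥ X l else
      ∑ i ∈ Finset.range (orderOf g), A (g ^ (i + 1)) *ᵥ X l) := by
  rw [splitVec]
  split_ifs with h
  · rw [hA, map_sub]
  · rw [map_sum]
    exact Finset.sum_congr rfl fun i _ => hA _ _

theorem frameVec_vec {σ : Representation K G W} {A : G →* Matrix (Fin n) (Fin n) O}
    (hA : ∀ g v, σ g (vec c f v) = vec c f (A g *ᵥ v)) (g : G) {d : ℕ} (X : Fin d → Fin n → O) :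
    frameVec σ g (fun i => vec c f (X i)) =
      ExteriorAlgebra.ιMulti K d fun i => vec c f (X i - A g *ᵥ X i) := by
  rw [frameVec]
  congr 1
  funext i
  rw [hA, map_sub]

/-- If `U_g U_h = β U_{gh}` for the multivectors of frames, then `β` is a quotient of determinants. -/
theorem det_eq_of_frameVec_mul_eq {σ : Representation K G W} {A : G →* Matrix (Fin n) (Fin n) O}
    (hA : ∀ g v, σ g (vec c f v) = vec c f (A g *ᵥ v)) {g h u : G} {d e m : ℕ} (hm : m = d + e)
    (X : Fin d → Fin n → O) (X' : Fin e → Fin n → O) (X'' Y : Fin m → Fin n → O) {β : K}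
    (hβ : frameVec σ g (fun i => vec c f (X i)) * frameVec σ h (fun i => vec c f (X' i)) =
      β • frameVec σ u (fun i => vec c f (X'' i))) :
    f (Matrix.of fun p q => Y q ⬝ᵥ Fin.append (fun i => X i - A g *ᵥ X i)
        (fun i => X' i - A h *ᵥ X' i) (Fin.cast hm p)).det =
      β * f (Matrix.of fun p q => Y q ⬝ᵥ (X'' p - A u *ᵥ X'' p)).det := by
  subst hm
  rw [frameVec_vec hA, frameVec_vec hA, frameVec_vec hA, ← ιMulti_append] at hβ
  rw [← pairForms_vec c f, ← pairForms_vec c f]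
  have h := congrArg (pairForms fun q => ∑ a, f (Y q a) • c.coord a) hβ
  rw [map_smul, smul_eq_mul] at h
  rw [← h]
  congr 2
  funext p
  refine Fin.addCases (fun i => ?_) (fun i => ?_) p <;> simp

end Specialization

end Symplectic

/-! ### Lifting the form and transferring the scalars to `k`. -/

namespace Symplectic

open Koszul Module Hochschild MulOpposite

section FormLift

open scoped Matrix

variable {O k V G : Type*} [CommRing O] [Field k] [AddCommGroup V] [Module k V] [Group G] [Finite G]
  {n : ℕ}

theorem map_vec_of_toMatrix {c : Basis (Fin n) k V} {Θ : O →+* k} {ρ : Representation k G V}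
    {A : G →* Matrix (Fin n) (Fin n) O} (hA : ∀ g, (A g).map Θ = LinearMap.toMatrix c c (ρ g))
    (g : G) (v : Fin n → O) : ρ g (vec c Θ v) = vec c Θ (A g *ᵥ v) := by
  apply c.equivFun.injective
  rw [equivFun_vec]
  funext a
  rw [Function.comp_apply, RingHom.map_mulVec]
  change _ = (((A g).map Θ) *ᵥ (Θ ∘ v)) a
  rw [hA, ← equivFun_vec c Θ]
  exact (congrFun (LinearMap.toMatrix_mulVec_repr c c (ρ g) (vec c Θ v)) a).symm

/-- A symplectic form invariant under a finite group of invertible order lifts along a local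
homomorphism, together with the group action. -/
theorem exists_form_lift {Θ : O →+* k} (hG : (Nat.card G : k) ≠ 0) {ρ : Representation k G V}
    {c : Basis (Fin n) k V} {A : G →* Matrix (Fin n) (Fin n) O}
    (hA : ∀ g, (A g).map Θ = LinearMap.toMatrix c c (ρ g)) {ω : LinearMap.BilinForm k V}
    (hω_alt : ω.IsAlt) (hω_nondeg : ω.Nondegenerate)
    (hρ : ∀ (g : G) (v w : V), ω (ρ g v) (ρ g w) = ω v w)
    (hlift : ∀ a b, ∃ x, Θ x = ω (c a) (c b)) :
    ∃ Ω : Matrix (Fin n) (Fin n) O, Ωᵀ = -Ω ∧ (∀ g, (A g)ᵀ * Ω * A g = Ω) ∧ Θ Ω.det ≠ 0 := by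
  cases nonempty_fintype G
  choose w hw using hlift
  -- Only the entries above the diagonal are lifted, so the lift is antisymmetric. Its sum over the
  -- group is invariant and reduces to `|G|` times the original form.
  let w₀ : Matrix (Fin n) (Fin n) O :=
    Matrix.of fun a b => if a < b then w a b else if b < a then -w b a else 0
  have hw₀ : w₀ᵀ = -w₀ := by
    ext a b
    simp only [Matrix.transpose_apply, Matrix.neg_apply, w₀, Matrix.of_apply]
    rcases lt_trichotomy a b with h | rfl | h
    · simp [h, h.not_gt]
    · simp
    · simp [h, h.not_gt]
  have hw₀m : w₀.map Θ = LinearMap.BilinForm.toMatrix c ω := by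
    ext a b
    rw [LinearMap.BilinForm.toMatrix_apply]
    simp only [Matrix.map_apply, w₀, Matrix.of_apply]
    rcases lt_trichotomy a b with h | rfl | h
    · simp [h, hw]
    · simp [hω_alt.self_eq_zero]
    · simp [h, h.not_gt, hw, hω_alt.neg_eq]
  refine ⟨∑ g, (A g)ᵀ * w₀ * A g, ?_, fun h => ?_, ?_⟩
  · rw [Matrix.transpose_sum, ← Finset.sum_neg_distrib]
    refine Finset.sum_congr rfl fun g _ => ?_
    rw [Matrix.transpose_mul, Matrix.transpose_mul, hw₀, Matrix.transpose_transpose,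
      Matrix.neg_mul, Matrix.mul_neg, Matrix.mul_assoc]
  · rw [Finset.mul_sum, Finset.sum_mul]
    refine Fintype.sum_equiv (Equiv.mulRight h) _ _ fun g => ?_
    rw [Equiv.coe_mulRight, map_mul, Matrix.transpose_mul]
    simp only [Matrix.mul_assoc]
  · have h1 : ∀ g, ((A g)ᵀ * w₀ * A g).map Θ = LinearMap.BilinForm.toMatrix c ω := by
      intro g
      rw [Matrix.map_mul, Matrix.map_mul, Matrix.transpose_map, hw₀m, hA,
        ← LinearMap.BilinForm.toMatrix_comp]
      congr 1
      ext v w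
      exact hρ g v w
    have h2 : RingHom.mapMatrix Θ (∑ g, (A g)ᵀ * w₀ * A g) =
        (Nat.card G : k) • LinearMap.BilinForm.toMatrix c ω := by
      rw [map_sum]
      simp only [RingHom.mapMatrix_apply, h1, Finset.sum_const, Finset.card_univ,
        Nat.card_eq_fintype_card, Nat.cast_smul_eq_nsmul]
    rw [RingHom.map_det, h2, Matrix.det_smul]
    exact mul_ne_zero (pow_ne_zero _ hG)
      ((LinearMap.BilinForm.nondegenerate_iff_det_ne_zero c).1 hω_nondeg)

theorem isAlt_toBilin' {M : Matrix (Fin n) (Fin n) ℂ} (hM : Mᵀ = -M) :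
    (Matrix.toBilin' M).IsAlt := by
  intro v
  have h1 : v ⬝ᵥ M *ᵥ v = -(v ⬝ᵥ M *ᵥ v) := by
    conv_lhs => rw [Matrix.dotProduct_mulVec, ← Matrix.mulVec_transpose, hM, dotProduct_comm,
      Matrix.neg_mulVec, dotProduct_neg]
  rw [Matrix.toBilin'_apply']
  exact self_eq_neg.1 h1

theorem toBilin'_mulVec {M T : Matrix (Fin n) (Fin n) ℂ} (hM : Tᵀ * M * T = M)
    (v w : Fin n → ℂ) :
    Matrix.toBilin' M (T *ᵥ v) (T *ᵥ w) = Matrix.toBilin' M v w := by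
  rw [Matrix.toBilin'_apply', Matrix.toBilin'_apply']
  conv_rhs => rw [← hM]
  rw [← Matrix.mulVec_mulVec, ← Matrix.mulVec_mulVec, Matrix.dotProduct_mulVec v,
    Matrix.vecMul_transpose]

end FormLift

section Scalars

open scoped Matrix

variable {k V G : Type*} [Field k] [IsAlgClosed k] [AddCommGroup V] [Module k V]
  [FiniteDimensional k V] [Group G] [Finite G]

theorem EigenBasis.exists_frame_indices {N : ℕ} {ρ : Representation k G V} {g : G}
    (B : EigenBasis ρ g N) : ∃ (S : Finset (Fin N)) (e : Fin (codim ρ g) → Fin N),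
      (∀ l, l ∈ S ↔ B.μ l ≠ 1) ∧ Function.Injective e ∧ Set.range e = S := by
  refine ⟨B.moving.toFinset, fun i => B.moving.get (i.cast B.codim_eq), fun l => ?_, ?_, ?_⟩
  · rw [List.mem_toFinset, B.mem_moving]
  · exact (B.moving_nodup.injective_get).comp (Fin.cast_injective _)
  · ext l
    simp only [Set.mem_range, Finset.mem_coe, List.mem_toFinset, List.mem_iff_get]
    exact ⟨fun ⟨i, hi⟩ => ⟨_, hi⟩, fun ⟨i, hi⟩ => ⟨i.cast B.codim_eq.symm, hi⟩⟩

/-- Frames of the moving spaces can be rescaled to be multiplicative on transversal pairs. -/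
theorem exists_frames (hn : ∀ g : G, (orderOf g : k) ≠ 0) (hG : (Nat.card G : k) ≠ 0)
    {ω : LinearMap.BilinForm k V} (hω_alt : ω.IsAlt) (hω_nondeg : ω.Nondegenerate)
    {ρ : Representation k G V} (hρ : ∀ (g : G) (v w : V), ω (ρ g v) (ρ g w) = ω v w) :
    ∃ (x : ∀ g, Fin (codim ρ g) → V) (t : G → k), (∀ g, IsFrame ρ g (x g)) ∧ (∀ g, t g ≠ 0) ∧
      ∀ g h, Disjoint (movingSpace ρ g) (movingSpace ρ h) →
        t (g * h) • frameVec ρ (g * h) (x (g * h)) =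
          (t g • frameVec ρ g (x g)) * (t h • frameVec ρ h (x h)) := by
  classical
  set n := finrank k V with hnV
  let c : Basis (Fin n) k V := finBasis k V
  have B : ∀ g, EigenBasis ρ g n := fun g => Classical.choice (nonempty_eigenBasis ρ g (hn g))
  choose S e hS he hrange using fun g => (B g).exists_frame_indices
  have hZ := fun g => (B g).linearIndependent_splitVec (hn g) (hS g)
  have hframe : ∀ g, IsFrame ρ g fun i => (B g).b (e g i) := fun g =>
    isFrame_of_splitVec (B g) hnV.symm (hZ g) (he g) (hrange g)
  choose y hy using fun g => exists_dual_forms (hframe g).linearIndependent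
  -- The finitely many elements to be lifted are the matrix entries of the group, the coordinates of
  -- the eigenvectors and of the dual forms, and the entries of `ω`.
  obtain ⟨O, _, ι, Θ, hι, hloc, hsplit, hlift⟩ := exists_local_lift_of_finite k
    (Set.range (fun z : G × Fin n × Fin n => LinearMap.toMatrix c c (ρ z.1) z.2.1 z.2.2) ∪
      Set.range (fun z : G × Fin n × Fin n => c.coord z.2.2 ((B z.1).b z.2.1)) ∪
      Set.range (fun z : (Σ g : G, Fin (codim ρ g)) × Fin n => y z.1.1 z.1.2 (c z.2)) ∪
      Set.range (fun z : Fin n × Fin n => ω (c z.1) (c z.2))) (Set.toFinite _)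
  obtain ⟨A, hA⟩ := exists_representation_lift hloc hsplit hG
    ((LinearMap.toMatrixAlgEquiv c).toMulEquiv.toMonoidHom.comp ρ) fun g a b =>
      hlift _ (Or.inl (Or.inl (Or.inl ⟨(g, a, b), rfl⟩)))
  replace hA : ∀ g, (A g).map Θ = LinearMap.toMatrix c c (ρ g) := hA
  obtain ⟨Ω, hΩ, hΩA, hΩdet⟩ := exists_form_lift hG hA hω_alt hω_nondeg hρ fun a b =>
    hlift _ (Or.inr ⟨(a, b), rfl⟩)
  choose X hX using fun g l a => hlift _ (Or.inl (Or.inl (Or.inr ⟨(g, l, a), rfl⟩)))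
  choose Y hY using fun g q a => hlift _ (Or.inl (Or.inr ⟨(⟨g, q⟩, a), rfl⟩))
  have hXb : ∀ g l, vec c Θ (X g l) = (B g).b l := by
    intro g l
    apply c.equivFun.injective
    rw [equivFun_vec]
    funext a
    exact hX g l a
  have hYy : ∀ g q, ∑ a, Θ (Y g q a) • c.coord a = y g q := by
    intro g q
    refine c.ext fun b => ?_
    rw [LinearMap.sum_apply]
    simp [hY, Finsupp.single_apply]
  have hAk := map_vec_of_toMatrix hA
  let σ : Representation ℂ G (Fin n → ℂ) :=
    (Matrix.toLinAlgEquiv'.toMulEquiv.toMonoidHom).comp 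
      (ι.mapMatrix.toMonoidHom.comp A)
  have hσ : ∀ g v, σ g v = (A g).map ι *ᵥ v := fun g v => rfl
  let b := Pi.basisFun ℂ (Fin n)
  have hAC : ∀ g v, σ g (vec b ι v) = vec b ι (A g *ᵥ v) := by
    have hb : ∀ v, vec b ι v = ι ∘ v := fun v => rfl
    intro g v
    rw [hσ, hb, hb]
    funext a
    exact (RingHom.map_mulVec ι (A g) v a).symm
  -- A determinant that is nonzero in `k` comes from a unit of `O` and stays nonzero in `ℂ`;
  -- nondegeneracy and the frames transfer in this way.
  have hunit : ∀ a, Θ a ≠ 0 → ι a ≠ 0 := fun a ha => ((hloc a ha).map ι).ne_zero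
  let ω' : LinearMap.BilinForm ℂ (Fin n → ℂ) := Matrix.toBilin' (Ω.map ι)
  have hω'_alt : ω'.IsAlt := isAlt_toBilin' <| by
    rw [← Matrix.transpose_map, hΩ]
    ext
    simp
  have hω'_nondeg : ω'.Nondegenerate := by
    rw [LinearMap.BilinForm.nondegenerate_toBilin'_iff_det_ne_zero]
    have := hunit _ hΩdet
    rwa [RingHom.map_det] at this
  have hσω : ∀ g v w, ω' (σ g v) (σ g w) = ω' v w := fun g v w => by
    rw [hσ, hσ]
    refine toBilin'_mulVec ?_ v w
    rw [← Matrix.transpose_map, ← Matrix.map_mul, ← Matrix.map_mul, hΩA]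
  have B' : ∀ g, EigenBasis σ g (finrank ℂ (Fin n → ℂ)) := fun g => Classical.choice
    (nonempty_eigenBasis σ g (by exact_mod_cast (orderOf_pos g).ne'))
  have hframe' : ∀ g, IsFrame σ g fun i => vec b ι (X g (e g i)) := by
    intro g
    refine isFrame_of_splitVec (X := fun l => vec b ι (X g l)) (B' g) (by simp) ?_ (he g) (hrange g)
    have h1 := hZ g
    rw [← funext (hXb g), funext (splitVec_vec hAk g (S g) (X g)), linearIndependent_vec_iff] at h1
    rw [funext (splitVec_vec hAC g (S g) (X g)), linearIndependent_vec_iff]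
    exact hunit _ h1
  have hcodim : ∀ g, codim σ g = codim ρ g := fun g => by
    rw [← (B' g).finrank_movingSpace_eq_codim, ← (hframe' g).span_eq,
      finrank_span_eq_card (hframe' g).linearIndependent, Fintype.card_fin]
  obtain ⟨t, ht0, ht⟩ := exists_complex_scalars hω'_alt hω'_nondeg hσω hframe'
  -- The pairing of the lifted frame with the lifted dual forms; by the choice of these forms it
  -- reduces to `1`.
  let D : G → O := fun g =>
    (Matrix.of fun p q => Y g q ⬝ᵥ (X g (e g p) - A g *ᵥ X g (e g p))).det
  have hD : ∀ g, Θ (D g) = 1 := by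
    intro g
    have h1 := pairForms_vec c Θ (Y g) fun p => X g (e g p) - A g *ᵥ X g (e g p)
    rw [funext (hYy g), ← frameVec_vec hAk g (fun p => X g (e g p))] at h1
    change _ = Θ (D g) at h1
    rw [← h1, frameVec, pairForms_ιMulti_eq_det]
    simp only [hXb]
    rw [hy, Matrix.det_one]
  -- The scalars `t g` need not lie in `O`. The extension `F` is still defined on them and agrees
  -- with the reduction on units of `O`.
  obtain ⟨F, hF⟩ := exists_monoidHom_extension (Units.map (ι : O →* ℂ)) (Units.map_injective hι)
    (Units.map (Θ : O →* k))
  refine ⟨fun g i => (B g).b (e g i), fun g => (F (Units.mk0 (t g) (ht0 g)) : k), hframe,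
    fun g => Units.ne_zero _, fun g h hd => ?_⟩
  have hadd := codim_mul_eq (B g) (B h) (B (g * h)) hω_alt hω_nondeg hρ hd
  obtain ⟨β, hβ0, hβ, -⟩ := exists_frameVec_mul_eq (B g) (B h) (B (g * h)) hω_alt hω_nondeg hρ hd
    (hframe g) (hframe h) (hframe _) hadd
  -- Over `ℂ` disjointness is recovered from the codimensions, which agree because the frames have
  -- the same lengths.
  have hd' := disjoint_of_codim_mul_eq (B' g) (B' h) (B' (g * h)) (by
    rw [hcodim, hcodim, hcodim, hadd])
  obtain ⟨β', -, hβ', -⟩ := exists_frameVec_mul_eq (B' g) (B' h) (B' (g * h)) hω'_alt hω'_nondeg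
    hσω hd' (hframe' g) (hframe' h) (hframe' _) hadd
  have hβt := ht g h hd' β' hβ'
  have e1 := det_eq_of_frameVec_mul_eq hAC hadd (fun i => X g (e g i)) (fun i => X h (e h i))
    (fun i => X (g * h) (e (g * h) i)) (Y (g * h)) hβ'
  have e2 := det_eq_of_frameVec_mul_eq hAk hadd (fun i => X g (e g i)) (fun i => X h (e h i))
    (fun i => X (g * h) (e (g * h) i)) (Y (g * h)) (β := β) (by simpa only [hXb] using hβ)
  change _ = β' * ι (D (g * h)) at e1
  change _ = β * Θ (D (g * h)) at e2
  rw [hD, mul_one] at e2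
  generalize (Matrix.of fun p q => Y (g * h) q ⬝ᵥ Fin.append (fun i => X g (e g i) - A g *ᵥ X g (e g i))
        (fun i => X h (e h i) - A h *ᵥ X h (e h i)) (Fin.cast hadd p)).det = E at e1 e2
  obtain ⟨u, rfl⟩ := hloc E (by rw [e2]; exact hβ0)
  obtain ⟨v, hv⟩ := hloc (D (g * h)) (by rw [hD]; exact one_ne_zero)
  -- The complex structure constant is the quotient of the units `E` and `D (g * h)` of `O`, and the
  -- reduction of this quotient is `β`. Applying `F` to the resulting identity gives
  -- multiplicativity over `k`.
  have e3 : Units.mk0 (t g) (ht0 g) * Units.mk0 (t h) (ht0 h) * Units.map (ι : O →* ℂ) u =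
      Units.mk0 (t (g * h)) (ht0 (g * h)) * Units.map (ι : O →* ℂ) v := by
    ext
    simp only [Units.val_mul, Units.val_mk0, Units.coe_map, MonoidHom.coe_coe]
    rw [hv, e1, ← hβt]
    ring
  have e4 := congrArg (fun z : kˣ => (z : k)) (congrArg F e3)
  simp only [map_mul, hF, Units.val_mul, Units.coe_map, MonoidHom.coe_coe] at e4
  rw [hv, hD, mul_one, e2] at e4
  rw [smul_mul_smul_comm, hβ, smul_smul, e4]

theorem exists_multiplicative
    (hchar : ringChar k = 0 ∨ (Module.finrank k V < ringChar k ∧ Nat.card G < ringChar k))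
    (ω : LinearMap.BilinForm k V) (hω_alt : ω.IsAlt) (hω_nondeg : ω.Nondegenerate)
    (ρ : Representation k G V) (hρ : ∀ (g : G) (v w : V), ω (ρ g v) (ρ g w) = ω v w) :
    ∃ s : ∀ g : G, ⋀[k]^(codim ρ g) (movingSpace ρ g),
      (∀ g, s g ≠ 0) ∧ ∀ g h, Disjoint (movingSpace ρ g) (movingSpace ρ h) →
        movingToExt ρ (g * h) (s (g * h)) = movingToExt ρ g (s g) * movingToExt ρ h (s h) := by
  have ho : ∀ g : G, (orderOf g : k) ≠ 0 :=
    fun g => orderOf_ne_zero_of_lt_ringChar (hchar.imp_right And.right) g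
  have hG : (Nat.card G : k) ≠ 0 := fun h0 => by
    have h1 := (ringChar.spec k _).1 h0
    rcases hchar with h | ⟨-, h⟩
    · rw [h, zero_dvd_iff] at h1
      exact Nat.card_pos.ne' h1
    · exact absurd (Nat.le_of_dvd Nat.card_pos h1) (not_le.2 h)
  obtain ⟨x, t, hx, ht, hmul⟩ := exists_frames ho hG hω_alt hω_nondeg hρ
  let s : ∀ g : G, ⋀[k]^(codim ρ g) (movingSpace ρ g) := fun g =>
    t g • ⟨ExteriorAlgebra.ιMulti k _ fun i => ⟨x g i - ρ g (x g i), (hx g).mem i⟩,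
      ExteriorAlgebra.ιMulti_range k _ ⟨_, rfl⟩⟩
  have hs : ∀ g, movingToExt ρ g (s g) = t g • frameVec ρ g (x g) := by
    intro g
    change ExteriorAlgebra.map (movingSpace ρ g).subtype (t g • ExteriorAlgebra.ιMulti k _ _) = _
    rw [map_smul, ExteriorAlgebra.map_apply_ιMulti]
    rfl
  refine ⟨s, fun g h0 => ?_, fun g h hd => by rw [hs, hs, hs, hmul g h hd]⟩
  have h1 := hs g
  rw [h0] at h1
  refine smul_ne_zero (ht g) (frameVec_ne_zero (hx g)) (h1.symm.trans ?_)
  exact map_zero (ExteriorAlgebra.map (movingSpace ρ g).subtype)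

end Scalars

end Symplectic

end

/-! ### The main theorem. -/

open Symplectic Hochschild in
theorem mainTheorem7 {k V G : Type*} [Field k] [IsAlgClosed k] [AddCommGroup V] [Module k V]
    [FiniteDimensional k V] [Group G] [Finite G]
    (hchar : ringChar k = 0 ∨ (Module.finrank k V < ringChar k ∧ Nat.card G < ringChar k))
    (ω : LinearMap.BilinForm k V) (hω_alt : ω.IsAlt) (hω_nondeg : ω.Nondegenerate)
    (ρ : Representation k G V) (hρ : ∀ (g : G) (v w : V), ω (ρ g v) (ρ g w) = ω v w) :
    ∃ (s : ∀ g : G, ⋀[k]^(Symplectic.codim ρ g) (Symplectic.movingSpace ρ g))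
      (Φ : ∀ (g : G) (i : ℕ),
        Hochschild.Cohomology k (Symplectic.PolyFun k V) (Symplectic.Component ρ g) i ≃ₗ[k]
          (Symplectic.extPow k (Symplectic.fixedSpace ρ g) ((i : ℤ) - Symplectic.codim ρ g) ⊗[k]
            Symplectic.PolyFun k (Symplectic.fixedSpace ρ g))),
      -- the elements `s_g` are nonzero and multiplicative
      (∀ g : G, s g ≠ 0) ∧
      (∀ g h : G,
        Symplectic.fixedSpace ρ (g * h) = Symplectic.fixedSpace ρ g ⊓ Symplectic.fixedSpace ρ h →
        Symplectic.codim ρ (g * h) = Symplectic.codim ρ g + Symplectic.codim ρ h →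
        Symplectic.movingToExt ρ (g * h) (s (g * h)) =
          Symplectic.movingToExt ρ g (s g) * Symplectic.movingToExt ρ h (s h)) ∧
      -- the isomorphism is the natural one, determined by `s_g`: the alternation of a cocycle on
      -- linear forms is given by the multivector field wedged with `s_g`
      (∀ (g : G) (i : ℕ)
        (φ : Hochschild.cocycles k (Symplectic.PolyFun k V) (Symplectic.Component ρ g) i)
        (y : Fin i → Module.Dual k V),
        Symplectic.altEval ρ g φ.1 y =
          TensorProduct.lid k _ (LinearMap.rTensor _ (Symplectic.pairForms y)
            (Symplectic.wedgeWith ρ g (Symplectic.movingToExt ρ g (s g))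
              (Symplectic.toMultiVec (Φ g i (Hochschild.cls φ)))))) ∧
      -- the product of two classes
      ∀ (g h : G) (i j : ℕ)
        (x : Hochschild.Cohomology k (Symplectic.PolyFun k V) (Symplectic.Component ρ g) i)
        (y : Hochschild.Cohomology k (Symplectic.PolyFun k V) (Symplectic.Component ρ h) j),
        (Symplectic.fixedSpace ρ (g * h) ≠
            Symplectic.fixedSpace ρ g ⊓ Symplectic.fixedSpace ρ h →
          Hochschild.cup (Symplectic.componentMul ρ g h) i j x y = 0) ∧
        (Symplectic.codim ρ (g * h) ≠ Symplectic.codim ρ g + Symplectic.codim ρ h →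
          Hochschild.cup (Symplectic.componentMul ρ g h) i j x y = 0) ∧
        ∀ hfix : Symplectic.fixedSpace ρ (g * h) =
            Symplectic.fixedSpace ρ g ⊓ Symplectic.fixedSpace ρ h,
          Symplectic.codim ρ (g * h) = Symplectic.codim ρ g + Symplectic.codim ρ h →
          Symplectic.toMultiVec
              (Φ (g * h) (i + j) (Hochschild.cup (Symplectic.componentMul ρ g h) i j x y)) =
            (-1 : k) ^ ((Symplectic.codim ρ g : ℤ) * ((j : ℤ) - Symplectic.codim ρ h)) •
              (Symplectic.restrictMultiVec ρ (hfix.le.trans inf_le_left)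
                  (Symplectic.toMultiVec (Φ g i x)) *
                Symplectic.restrictMultiVec ρ (hfix.le.trans inf_le_right)
                  (Symplectic.toMultiVec (Φ h j y))) := by
  obtain ⟨s, hs0, hsm⟩ := exists_multiplicative hchar ω hω_alt hω_nondeg ρ hρ
  have ho : ∀ g : G, (orderOf g : k) ≠ 0 :=
    orderOf_ne_zero_of_lt_ringChar (hchar.imp_right And.right)
  have hfac := factorial_ne_zero_of_lt_ringChar (k := k) (n := Module.finrank k V)
    (hchar.imp_right And.left)
  have B : ∀ g : G, EigenBasis ρ g (Module.finrank k V) := fun g =>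
    (nonempty_eigenBasis ρ g (ho g)).some
  -- Additivity of the codimensions alone already forces the moving spaces to be disjoint.
  have hm : ∀ g h : G, codim ρ (g * h) = codim ρ g + codim ρ h →
      movingToExt ρ (g * h) (s (g * h)) = movingToExt ρ g (s g) * movingToExt ρ h (s h) :=
    fun g h hd => hsm g h (disjoint_of_codim_mul_eq (B g) (B h) (B (g * h)) hd)
  refine ⟨s, fun g i => cohomologyEquiv (ho g) hfac (B g) (hs0 g) i, hs0, fun g h _ => hm g h,
    fun g i φ y => ?_, fun g h i j x y => ⟨fun hne => ?_, fun hne => ?_, fun hfix hd => ?_⟩⟩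
  · rw [← altEvalMap_apply, ← alternation_cohomologyEquiv (ho g) hfac (B g) (hs0 g), alternation_apply,
      evalForms_apply]
  -- Disjoint moving spaces imply both transversality conditions, so the failure of either one
  -- provides a common moving vector.
  · exact cup_eq_zero_of_not_disjoint ho hfac B hs0
      (fun hd => hne (fixedSpace_mul_eq (B g) (B h) hd)) i j x y
  · exact cup_eq_zero_of_not_disjoint ho hfac B hs0
      (fun hd => hne (codim_mul_eq (B g) (B h) (B (g * h)) hω_alt hω_nondeg hρ hd)) i j x y
  · obtain ⟨φ, rfl⟩ := Submodule.Quotient.mk_surjective _ x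
    obtain ⟨ψ, rfl⟩ := Submodule.Quotient.mk_surjective _ y
    exact toMultiVec_cup (B (g * h)) (ho _) _ _ hd (hs0 _) (hm g h hd)
      (alternation_cohomologyEquiv (ho g) hfac (B g) (hs0 g) i φ)
      (alternation_cohomologyEquiv (ho h) hfac (B h) (hs0 h) j ψ)
      (alternation_cohomologyEquiv (ho (g * h)) hfac (B (g * h)) (hs0 (g * h)) (i + j) _)
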